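/- Let $F$ be a field. An $F$-variety is a separated $F$-scheme of finite type. For an $F$-scheme $X$ and an $F$-algebra $A$ (commutative with unit) put $X_A = X\times_F A$, and let $\mathbf{Aut}(X)$ be the group functor on $F$-algebras $A \mapsto \mathrm{Aut}_A(X_A)$. Let $\iota: Z\hookrightarrow Y$ be a closed immersion of smooth $F$-varieties, and let $\beta: X := \mathrm{Bl}_Z(Y)\to Y$ be the blow-up of $Y$ along $Z$. Let $\mathrm{Stab}_{\mathbf{Aut}(Y)}(Z)\subset \mathbf{Aut}(Y)$ be the subgroup functor with \[\mathrm{Stab}_{\mathbf{Aut}(Y)}(Z)(A)=\{f\in \mathrm{Aut}_A(Y_A) : f(Z_A)=Z_A\}.\] For a group functor $G$ on $F$-algebras, a finite local $F$-algebra $A$ with residue field $F$, and its residue homomorphism $\rho: A\to F$, let $\mathbf J(G,\rho)$ be the group functor \[\mathbf J(G,\rho)(B)=\mathrm{Ker}\bigl(G(A\otimes_F B)\to G(B)\bigr)\] on $F$-algebras $B$, the map being induced by $\rho$; put $\mathbf J(X,\rho)=\mathbf J(\mathbf{Aut}(X),\rho)$. (1) For every $F$-algebra $A$ and every $f\in \mathrm{Stab}_{\mathbf{Aut}(Y)}(Z)(A)$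 there is exactly one $\phi(f)\in\mathbf{Aut}(X)(A)$ with $\beta_A\circ\phi(f)=f\circ\beta_A$. The resulting maps \[\phi: \mathrm{Stab}_{\mathbf{Aut}(Y)}(Z)(A)\to\mathbf{Aut}(X)(A)\] are group homomorphisms, natural in $A$. (2) If $Z$ contains no irreducible component of $Y$, then $\phi$ is injective for every $F$-algebra $A$. (3) If every irreducible component of $Z$ has codimension $\geq 2$ in $Y$, then for every finite local $F$-algebra $A$ with residue field $F$ and residue homomorphism $\rho: A\to F$, the morphism $\phi$ induces an isomorphism of group functors \[\Phi: \mathbf J\bigl(\mathrm{Stab}_{\mathbf{Aut}(Y)}(Z),\rho\bigr)\xrightarrow{\ \sim\ }\mathbf J(X,\rho).\] -/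

import Mathlib

open CategoryTheory Limits AlgebraicGeometry

universe u

noncomputable section

namespace BlowUp

/-! ### The Rees algebra, its grading, and the blow-up of an affine scheme -/

section Rees

variable {R S T : Type u} [CommRing R] [CommRing S] [CommRing T]

/-- The grading of the Rees algebra `⨁ₙ Iⁿ tⁿ`: the homogeneous elements of degree `n` are the
`a tⁿ` with `a ∈ Iⁿ`. -/
def reesGrading (I : Ideal R) (n : ℕ) : Submodule R (reesAlgebra I) where
  carrier := {p | ∀ m, m ≠ n → (p : Polynomial R).coeff m = 0}
  add_mem' hp hq m hm := by simp [hp m hm, hq m hm]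
  zero_mem' m _ := by simp
  smul_mem' c p hp m hm := by simp [hp m hm]

variable {I : Ideal R}

lemma mem_reesGrading {n : ℕ} {p : reesAlgebra I} :
    p ∈ reesGrading I n ↔ ∀ m, m ≠ n → (p : Polynomial R).coeff m = 0 := Iff.rfl

/-- The element `a tⁿ` of the Rees algebra, for `a ∈ Iⁿ`. -/
def reesMonomial (I : Ideal R) (n : ℕ) (a : R) (ha : a ∈ I ^ n) : reesAlgebra I :=
  ⟨Polynomial.monomial n a, reesAlgebra.monomial_mem.mpr ha⟩

lemma reesMonomial_mem (n : ℕ) (a : R) (ha : a ∈ I ^ n) :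
    reesMonomial I n a ha ∈ reesGrading I n := fun m hm ↦ by
  simp [reesMonomial, Polynomial.coeff_monomial, hm.symm]

lemma eq_reesMonomial {n : ℕ} {p : reesAlgebra I} (hp : p ∈ reesGrading I n) :
    p = reesMonomial I n ((p : Polynomial R).coeff n) (p.2 n) := by
  apply Subtype.ext
  ext m
  by_cases h : m = n
  · subst h; simp [reesMonomial]
  · simp [reesMonomial, Polynomial.coeff_monomial, hp m h, Ne.symm h]

instance : SetLike.GradedMonoid (reesGrading I) where
  one_mem m hm := by simp [Polynomial.coeff_one, hm]
  mul_mem i j p q hp hq m hm := by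
    change ((p : Polynomial R) * (q : Polynomial R)).coeff m = 0
    rw [Polynomial.coeff_mul]
    refine Finset.sum_eq_zero fun x hx ↦ ?_
    replace hx := Finset.HasAntidiagonal.mem_antidiagonal.mp hx
    by_cases h1 : x.1 = i
    · rw [hq x.2 (by omega), mul_zero]
    · rw [hp x.1 h1, zero_mul]

lemma coeff_coeAddMonoidHom (x : DirectSum ℕ fun n ↦ reesGrading I n) (m : ℕ) :
    ((DirectSum.coeAddMonoidHom (reesGrading I) x : reesAlgebra I) : Polynomial R).coeff m =
      ((x m : reesAlgebra I) : Polynomial R).coeff m := by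
  induction x using DirectSum.induction_on with
  | zero => simp
  | of i y =>
    rw [DirectSum.coeAddMonoidHom_of]
    by_cases h : i = m
    · subst h; simp
    · rw [y.2 m (Ne.symm h), DirectSum.of_eq_of_ne _ _ _ (Ne.symm h)]; simp
  | add x y hx hy => simp [hx, hy]

lemma isInternal_reesGrading : DirectSum.IsInternal (reesGrading I) := by
  classical
  refine ⟨fun x y hx ↦ ?_, fun p ↦ ?_⟩
  · refine DFinsupp.ext fun n ↦ Subtype.ext (Subtype.ext (Polynomial.ext fun m ↦ ?_))
    by_cases h : m = n
    · subst h
      rw [← coeff_coeAddMonoidHom, ← coeff_coeAddMonoidHom, hx]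
    · rw [(x n).2 m h, (y n).2 m h]
  · refine ⟨∑ n ∈ (p : Polynomial R).support, DirectSum.of (fun n ↦ reesGrading I n) n
      ⟨reesMonomial I n ((p : Polynomial R).coeff n) (p.2 n), reesMonomial_mem _ _ _⟩, ?_⟩
    apply Subtype.ext
    simp only [map_sum, DirectSum.coeAddMonoidHom_of, AddSubmonoidClass.coe_finsetSum]
    exact (Polynomial.as_sum_support _).symm

instance : GradedRing (reesGrading I) where
  __ := isInternal_reesGrading.chooseDecomposition

/-- The graded homomorphism `⨁ Iⁿ tⁿ → ⨁ Jⁿ tⁿ` induced by `f : R → S` with `f(I) ⊆ J`. -/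
def reesMap {J : Ideal S} (f : R →+* S) (h : I.map f ≤ J) :
    GradedRingHom (reesGrading I) (reesGrading J) where
  __ := ((Polynomial.mapRingHom f).comp (reesAlgebra I).val.toRingHom).codRestrict
    (reesAlgebra J) fun p i ↦ by
      have := Ideal.mem_map_of_mem f (p.2 i)
      rw [Ideal.map_pow] at this
      simpa using Ideal.pow_right_mono h i this
  map_mem {n p} hp m hm := by
    change ((p : Polynomial R).map f).coeff m = 0
    simp [hp m hm]

@[simp] lemma coe_reesMap {J : Ideal S} (f : R →+* S) (h : I.map f ≤ J) (p : reesAlgebra I) :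
    (reesMap f h p : Polynomial S) = (p : Polynomial R).map f := rfl

lemma irrelevant_le_map {J : Ideal S} (f : R →+* S) (h : I.map f = J) :
    HomogeneousIdeal.irrelevant (reesGrading J) ≤
      (HomogeneousIdeal.irrelevant (reesGrading I)).map (reesMap f h.le) := by
  rw [HomogeneousIdeal.irrelevant_le]
  intro n hn p hp
  rw [eq_reesMonomial hp]
  have hb : (p : Polynomial S).coeff n ∈ (I ^ n).map f := by
    rw [Ideal.map_pow, h]; exact p.2 n
  have key : ∀ b (hb : b ∈ (I ^ n).map f), ∀ hb' : b ∈ J ^ n, reesMonomial J n b hb' ∈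
      ((HomogeneousIdeal.irrelevant (reesGrading I)).map (reesMap f h.le)).toIdeal := by
    intro b hb
    induction hb using Submodule.span_induction with
    | mem x hx =>
      obtain ⟨a, ha, rfl⟩ := hx
      intro hb'
      have : reesMonomial J n (f a) hb' = reesMap f h.le (reesMonomial I n a ha) := by
        apply Subtype.ext; simp [reesMonomial]
      rw [this]
      exact Ideal.mem_map_of_mem _ (HomogeneousIdeal.mem_irrelevant_of_mem _ hn
        (reesMonomial_mem n a ha))
    | zero =>
      intro hb'
      have : reesMonomial J n 0 hb' = 0 := by apply Subtype.ext; simp [reesMonomial]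
      rw [this]; exact zero_mem _
    | add x y hx hy hx' hy' =>
      intro hb'
      have mx : x ∈ J ^ n := by rw [← h, ← Ideal.map_pow]; exact hx
      have my : y ∈ J ^ n := by rw [← h, ← Ideal.map_pow]; exact hy
      have : reesMonomial J n (x + y) hb' = reesMonomial J n x mx + reesMonomial J n y my := by
        apply Subtype.ext; simp [reesMonomial]
      rw [this]; exact add_mem (hx' mx) (hy' my)
    | smul s x hx hx' =>
      intro hb'
      have mx : x ∈ J ^ n := by rw [← h, ← Ideal.map_pow]; exact hx
      have : reesMonomial J n (s • x) hb' = algebraMap S _ s * reesMonomial J n x mx := by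
        apply Subtype.ext; simp [reesMonomial, Polynomial.C_mul_monomial]
      rw [this]; exact Ideal.mul_mem_left _ _ (hx' mx)
  exact key _ hb _

/-- The blow-up `Proj (⨁ₙ Iⁿ)` of `Spec R` along `V(I)`. -/
abbrev affineBlowUp (I : Ideal R) : Scheme.{u} := Proj (reesGrading I)

/-- The structure morphism `Proj (⨁ₙ Iⁿ) ⟶ Spec R`. -/
def affineBlowUpπ (I : Ideal R) : affineBlowUp I ⟶ Spec (.of R) :=
  Proj.toSpecZero (reesGrading I) ≫
    Spec.map (CommRingCat.ofHom (algebraMap R (reesGrading I 0)))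

/-- The morphism of affine blow-ups induced by `f : R → S` with `I S = J`. -/
def affineBlowUpMap {J : Ideal S} (f : R →+* S) (h : I.map f = J) :
    affineBlowUp J ⟶ affineBlowUp I :=
  Proj.map (reesMap f h.le) (irrelevant_le_map f h)

lemma affineBlowUpMap_id (h : I.map (RingHom.id R) = I) :
    affineBlowUpMap (RingHom.id R) h = 𝟙 (affineBlowUp I) := by
  have : reesMap (RingHom.id R) h.le = .id (reesGrading I) := by
    refine GradedRingHom.ext fun p ↦ Subtype.ext ?_; simp
  refine Eq.trans ?_ Proj.map_id
  unfold affineBlowUpMap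
  congr 1

lemma affineBlowUpMap_comp {J : Ideal S} {K : Ideal T} (f : R →+* S) (g : S →+* T)
    (h : I.map f = J) (h' : J.map g = K) (h'' : I.map (g.comp f) = K) :
    affineBlowUpMap (g.comp f) h'' = affineBlowUpMap g h' ≫ affineBlowUpMap f h := by
  have : reesMap (g.comp f) h''.le = (reesMap g h'.le).comp (reesMap f h.le) := by
    refine GradedRingHom.ext fun p ↦ Subtype.ext ?_; simp [Polynomial.map_map]
  refine Eq.trans ?_ (Proj.map_comp _ _ (irrelevant_le_map f h) (irrelevant_le_map g h'))
  unfold affineBlowUpMap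
  congr 1

end Rees

/-! ### Compatibility of the affine blow-up with restriction to basic open subsets -/

section Loc

open HomogeneousLocalization Graded

variable {A B σ τ : Type u} [CommRing A] [SetLike σ A] [AddSubgroupClass σ A]
  [CommRing B] [SetLike τ B] [AddSubgroupClass τ B]
  {𝒜 : ℕ → σ} {ℬ : ℕ → τ} [GradedRing 𝒜] [GradedRing ℬ] (g : 𝒜 →+*ᵍ ℬ)

lemma isLocalization_awayMap (r : 𝒜 0) (hu : ∃ v : ℬ 0, g r * v = 1)
    (hs : ∀ n, ∀ b ∈ ℬ n, ∃ k : ℕ, ∃ a ∈ 𝒜 n, g a = g r ^ k * b)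
    (hi : ∀ a, g a = 0 → ∃ k : ℕ, (r : A) ^ k * a = 0) {d : ℕ} {s : A} (hd : s ∈ 𝒜 d) :
    let := (Away.map g s).toAlgebra
    IsLocalization.Away (fromZeroRingHom 𝒜 (Submonoid.powers s) r) (Away ℬ (g s)) := by
  let := (Away.map g s).toAlgebra
  have hval (n : ℕ) (a : A) (ha : a ∈ 𝒜 (n • d)) :
      (algebraMap (Away 𝒜 s) (Away ℬ (g s)) (Away.mk 𝒜 hd n a ha)) =
        Away.mk ℬ (map_mem g hd) n (g a) (map_mem g ha) := Away.map_mk ..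
  have hr0 : fromZeroRingHom 𝒜 (Submonoid.powers s) r =
      Away.mk 𝒜 hd 0 r (by simp) := by
    apply val_injective
    rw [Away.val_mk]
    change Localization.mk _ _ = _
    congr 1
    exact Subtype.ext (by simp)
  have hrk (k : ℕ) : fromZeroRingHom 𝒜 (Submonoid.powers s) r ^ k =
      Away.mk 𝒜 hd 0 (r ^ k : A) (by simpa using (r ^ k).2) := by
    rw [← map_pow]
    apply val_injective
    rw [Away.val_mk]
    change Localization.mk _ _ = _
    congr 1
    exact Subtype.ext (by simp)
  refine (isLocalization_iff _ _).mpr ⟨?_, ?_, ?_⟩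
  · rintro ⟨_, k, rfl⟩
    dsimp only
    rw [map_pow]
    apply IsUnit.pow
    obtain ⟨v, hv⟩ := hu
    refine IsUnit.of_mul_eq_one (Away.mk ℬ (map_mem g hd) 0 v (by simp)) ?_
    rw [hr0, hval]
    apply val_injective
    rw [val_mul, Away.val_mk, Away.val_mk, val_one, Localization.mk_mul, hv]
    simp
  · intro z
    obtain ⟨n, b, hb, rfl⟩ := Away.mk_surjective (𝒜 := ℬ) (map_mem g hd) z
    obtain ⟨k, a, ha, hab⟩ := hs _ b hb
    refine ⟨⟨Away.mk 𝒜 hd n a ha, ⟨_, k, rfl⟩⟩, ?_⟩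
    dsimp only
    rw [hrk, hval, hval]
    apply val_injective
    rw [val_mul, Away.val_mk, Away.val_mk, Away.val_mk, Localization.mk_mul, hab, map_pow]
    simp [mul_comm]
  · intro x y hxy
    obtain ⟨n, a, ha, rfl⟩ := Away.mk_surjective (𝒜 := 𝒜) hd x
    obtain ⟨m, b, hb, rfl⟩ := Away.mk_surjective (𝒜 := 𝒜) hd y
    rw [hval, hval] at hxy
    replace hxy := congrArg val hxy
    rw [Away.val_mk, Away.val_mk, Localization.mk_eq_mk_iff, Localization.r_iff_exists] at hxy
    obtain ⟨⟨_, l, rfl⟩, hl⟩ := hxy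
    obtain ⟨k, hk⟩ := hi (s ^ l * (s ^ m * a) - s ^ l * (s ^ n * b)) (by
      simp only [map_sub, map_mul, map_pow]
      exact sub_eq_zero.mpr hl)
    refine ⟨⟨_, k, rfl⟩, ?_⟩
    dsimp only
    rw [hrk]
    apply val_injective
    rw [val_mul, val_mul, Away.val_mk, Away.val_mk, Away.val_mk, Localization.mk_mul,
      Localization.mk_mul, Localization.mk_eq_mk_iff, Localization.r_iff_exists]
    refine ⟨⟨_, l, rfl⟩, ?_⟩
    simp only [Submonoid.coe_mul]
    linear_combination hk

end Loc

section ReesLoc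

variable {R S : Type u} [CommRing R] [CommRing S] [Algebra R S] {I : Ideal R} {J : Ideal S}
  (r : R) [IsLocalization.Away r S]

lemma reesMap_surj (h : I.map (algebraMap R S) = J) (n : ℕ) (b : reesAlgebra J)
    (hb : b ∈ reesGrading J n) : ∃ k : ℕ, ∃ a ∈ reesGrading I n,
      reesMap _ h.le a = reesMap _ h.le (algebraMap R _ r) ^ k * b := by
  have hb' : (b : Polynomial S).coeff n ∈ (I ^ n).map (algebraMap R S) := by
    rw [Ideal.map_pow, h]; exact b.2 n
  rw [IsLocalization.mem_map_algebraMap_iff (Submonoid.powers r)] at hb'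
  obtain ⟨⟨⟨a, ha⟩, ⟨_, k, rfl⟩⟩, hk⟩ := hb'
  refine ⟨k, reesMonomial I n a ha, reesMonomial_mem _ _ _, Subtype.ext ?_⟩
  conv_rhs => rw [eq_reesMonomial hb]
  dsimp only at hk
  have e : (Polynomial.C (algebraMap R S r)) ^ k = Polynomial.C (algebraMap R S (r ^ k)) := by simp
  simp [reesMonomial, ← hk, e, Polynomial.C_mul_monomial, mul_comm, -map_pow]

lemma reesMap_inj (h : I.map (algebraMap R S) = J) (a : reesAlgebra I)
    (ha : reesMap (algebraMap R S) h.le a = 0) :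
    ∃ k : ℕ, (algebraMap R (reesAlgebra I) r) ^ k * a = 0 := by
  have h1 (m : ℕ) : ∃ k : ℕ, r ^ k * (a : Polynomial R).coeff m = 0 := by
    have : algebraMap R S ((a : Polynomial R).coeff m) = 0 := by
      rw [← Polynomial.coeff_map, ← coe_reesMap _ h.le, ha]; simp
    rw [IsLocalization.map_eq_zero_iff (Submonoid.powers r)] at this
    obtain ⟨⟨_, k, rfl⟩, hk⟩ := this
    exact ⟨k, hk⟩
  choose k hk using h1
  refine ⟨(a : Polynomial R).support.sup k, Subtype.ext (Polynomial.ext fun m ↦ ?_)⟩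
  have e (l : ℕ) : (Polynomial.C r) ^ l = Polynomial.C (r ^ l) := by simp
  by_cases hm : m ∈ (a : Polynomial R).support
  · obtain ⟨l, hl⟩ := Nat.exists_eq_add_of_le' (Finset.le_sup (f := k) hm)
    simp [hl, e, pow_add, mul_assoc, hk, -map_pow, -map_mul]
  · rw [Polynomial.notMem_support_iff] at hm
    simp [e, hm, -map_pow]

lemma isLocalization_reesAway (h : I.map (algebraMap R S) = J) {d : ℕ} {s : reesAlgebra I}
    (hd : s ∈ reesGrading I d) :
    let := (HomogeneousLocalization.Away.map (reesMap (algebraMap R S) h.le) s).toAlgebra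
    IsLocalization.Away (HomogeneousLocalization.fromZeroRingHom (reesGrading I)
      (Submonoid.powers s) (algebraMap R _ r))
      (HomogeneousLocalization.Away (reesGrading J) (reesMap (algebraMap R S) h.le s)) := by
  refine isLocalization_awayMap (reesMap (algebraMap R S) h.le) (algebraMap R (reesGrading I 0) r)
    ?_ (reesMap_surj r h) (reesMap_inj r h) hd
  obtain ⟨v, hv⟩ := (IsLocalization.Away.algebraMap_isUnit (S := S) r).exists_right_inv
  refine ⟨algebraMap S (reesGrading J 0) v, Subtype.ext ?_⟩
  change (Polynomial.C r).map (algebraMap R S) * Polynomial.C v = 1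
  simp [← Polynomial.C_mul, hv]


end ReesLoc

section Cartesian

variable {R S : Type u} [CommRing R] [CommRing S] {I : Ideal R} {J : Ideal S}

lemma awayι_affineBlowUpπ {d : ℕ} (h0 : 0 < d) {s : reesAlgebra I} (hd : s ∈ reesGrading I d) :
    Proj.awayι (reesGrading I) s hd h0 ≫ affineBlowUpπ I =
      Spec.map (CommRingCat.ofHom ((HomogeneousLocalization.fromZeroRingHom (reesGrading I)
      (Submonoid.powers s)).comp (algebraMap R (reesGrading I 0)))) := by
  rw [affineBlowUpπ, Proj.awayι_toSpecZero_assoc, ← Spec.map_comp, ← CommRingCat.ofHom_comp]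

lemma affineBlowUpMap_π (f : R →+* S) (h : I.map f = J) :
    affineBlowUpMap f h ≫ affineBlowUpπ I =
      affineBlowUpπ J ≫ Spec.map (CommRingCat.ofHom f) := by
  refine (Proj.mapAffineOpenCover _ (irrelevant_le_map f h)).openCover.hom_ext _ _
    fun (s : Σ i : ℕ+, reesGrading I i) ↦ ?_
  obtain ⟨⟨d, h0⟩, s, hd⟩ := s
  change s ∈ reesGrading I d at hd
  change Proj.awayι (reesGrading J) (reesMap f h.le s) ((reesMap f h.le).2 hd) h0 ≫ _ =
    Proj.awayι (reesGrading J) (reesMap f h.le s) ((reesMap f h.le).2 hd) h0 ≫ _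
  rw [affineBlowUpMap, Proj.awayι_comp_map_assoc _ _ _ _ hd, awayι_affineBlowUpπ]
  refine Eq.trans ?_ ((congrArg (· ≫ Spec.map (CommRingCat.ofHom f)) (awayι_affineBlowUpπ
    (s := reesMap f h.le s) h0 ((reesMap f h.le).2 hd))).symm.trans (Category.assoc _ _ _))
  simp only [← Spec.map_comp, ← CommRingCat.ofHom_comp]
  congr 2
  ext a
  change Localization.mk _ _ = Localization.mk _ _
  congr 1
  · apply Subtype.ext
    change (Polynomial.C a).map f = Polynomial.C (f a)
    simp
  · apply Subtype.ext
    change reesMap f h.le 1 = 1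
    simp

lemma isPullback_awayι (f : R →+* S) (h : I.map f = J) {d : ℕ} (h0 : 0 < d) {s : reesAlgebra I}
    (hd : s ∈ reesGrading I d) :
    IsPullback (Proj.awayι (reesGrading J) (reesMap f h.le s) ((reesMap f h.le).2 hd) h0)
      (Spec.map (CommRingCat.ofHom (HomogeneousLocalization.Away.map (reesMap f h.le) s)))
      (affineBlowUpMap f h) (Proj.awayι (reesGrading I) s hd h0) := by
  refine (IsOpenImmersion.isPullback _ _ _ _ ?_ ?_).flip
  · exact Proj.awayι_comp_map ..
  · rw [Proj.opensRange_awayι, Proj.opensRange_awayι]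
    rfl

variable [Algebra R S]

lemma isOpenImmersion_affineBlowUpMap (r : R) [IsLocalization.Away r S]
    (h : I.map (algebraMap R S) = J) :
    IsOpenImmersion (affineBlowUpMap (algebraMap R S) h) := by
  rw [IsZariskiLocalAtTarget.iff_of_openCover (P := @IsOpenImmersion)
    (Proj.affineOpenCover (reesGrading I)).openCover]
  intro (s : Σ i : ℕ+, reesGrading I i)
  obtain ⟨⟨d, h0⟩, s, hd⟩ := s
  change s ∈ reesGrading I d at hd
  have H := isPullback_awayι (algebraMap R S) h h0 hd
  change IsOpenImmersion (pullback.snd _ (Proj.awayι (reesGrading I) s hd h0))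
  rw [← H.isoPullback_inv_snd]
  let := (HomogeneousLocalization.Away.map (reesMap (algebraMap R S) h.le) s).toAlgebra
  have := isLocalization_reesAway r h hd
  have : IsOpenImmersion (Spec.map (CommRingCat.ofHom
      (HomogeneousLocalization.Away.map (reesMap (algebraMap R S) h.le) s))) :=
    IsOpenImmersion.of_isLocalization (HomogeneousLocalization.fromZeroRingHom (reesGrading I)
      (Submonoid.powers s) (algebraMap R _ r))
  infer_instance

lemma isPullback_affineBlowUpMap (r : R) [IsLocalization.Away r S]
    (h : I.map (algebraMap R S) = J) :
    IsPullback (affineBlowUpMap (algebraMap R S) h) (affineBlowUpπ J) (affineBlowUpπ I)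
      (Spec.map (CommRingCat.ofHom (algebraMap R S))) := by
  have := isOpenImmersion_affineBlowUpMap r h
  have : IsOpenImmersion (Spec.map (CommRingCat.ofHom (algebraMap R S))) :=
    IsOpenImmersion.of_isLocalization r
  refine (IsOpenImmersion.isPullback _ _ _ _ (affineBlowUpMap_π _ h) ?_).flip
  refine le_antisymm (fun x hx ↦ ?_) ?_
  · obtain ⟨s, x, rfl⟩ := (Proj.affineOpenCover (reesGrading I)).openCover.exists_eq x
    obtain ⟨⟨d, h0⟩, s, hd⟩ : Σ i : ℕ+, reesGrading I i := s
    change s ∈ reesGrading I d at hd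
    have H := isPullback_awayι (algebraMap R S) h h0 hd
    let := (HomogeneousLocalization.Away.map (reesMap (algebraMap R S) h.le) s).toAlgebra
    have := isLocalization_reesAway r h hd
    have hr := PrimeSpectrum.localization_away_comap_range (HomogeneousLocalization.Away
      (reesGrading J) (reesMap (algebraMap R S) h.le s)) (HomogeneousLocalization.fromZeroRingHom
      (reesGrading I) (Submonoid.powers s) (algebraMap R _ r))
    change Spec (.of (HomogeneousLocalization.Away (reesGrading I) s)) at x
    change (Proj.awayι (reesGrading I) s hd h0) x ∈ _
    have hx' : x ∈ (PrimeSpectrum.basicOpen (HomogeneousLocalization.fromZeroRingHom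
      (reesGrading I) (Submonoid.powers s) (algebraMap R _ r)) :
      Set (PrimeSpectrum (HomogeneousLocalization.Away (reesGrading I) s))) := by
      replace hx : (Proj.awayι (reesGrading I) s hd h0 ≫ affineBlowUpπ I) x ∈
        Set.range (Spec.map (CommRingCat.ofHom (algebraMap R S))) := hx
      rw [awayι_affineBlowUpπ] at hx
      have hx2 : _ ∈ Set.range (PrimeSpectrum.comap (algebraMap R S)) := hx
      rw [PrimeSpectrum.localization_away_comap_range S r] at hx2
      exact hx2
    rw [← hr] at hx'
    obtain ⟨y, rfl⟩ := hx'
    refine ⟨(Proj.awayι (reesGrading J) (reesMap (algebraMap R S) h.le s)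
      ((reesMap (algebraMap R S) h.le).2 hd) h0) y, ?_⟩
    exact congr($(H.w) y)
  · rintro _ ⟨y, rfl⟩
    refine ⟨affineBlowUpπ J y, ?_⟩
    exact congr($(affineBlowUpMap_π (algebraMap R S) h) y).symm

end Cartesian

section

variable {R S : Type u} [CommRing R] [CommRing S] {I : Ideal R} {J : Ideal S}

lemma isPullback_affineBlowUpMap_of_away (f : R →+* S) (r : R)
    (hr : @IsLocalization.Away R _ r S _ f.toAlgebra) (h : I.map f = J) :
    IsPullback (affineBlowUpMap f h) (affineBlowUpπ J) (affineBlowUpπ I)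
      (Spec.map (CommRingCat.ofHom f)) :=
  let := f.toAlgebra
  isPullback_affineBlowUpMap r h

end

/-! ### The blow-up of a scheme, glued from the affine blow-ups -/

section Global

open Scheme AffineZariskiSite

variable {Y : Scheme.{u}} (I : Y.IdealSheafData)

/-- The ideal of sections of `I` on an affine open subset. -/
def idealAt (U : Y.AffineZariskiSite) : Ideal Γ(Y, U.toOpens) := I.ideal ⟨U.1, U.2⟩

lemma map_idealAt {U V : Y.AffineZariskiSite} (h : U ⟶ V) :
    (idealAt I V).map (Y.presheaf.map ((toOpensFunctor Y).map h).op).hom = idealAt I U :=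
  I.map_ideal' (U := ⟨U.1, U.2⟩) (V := ⟨V.1, V.2⟩) _

/-- `U ↦ Proj (⨁ₙ I(U)ⁿ)` on the affine open subsets `U` of `Y`. -/
def blowUpFunctor : Y.AffineZariskiSite ⥤ Scheme.{u} where
  obj U := affineBlowUp (idealAt I U)
  map h := affineBlowUpMap _ (map_idealAt I h)
  map_id U := by
    have key : ∀ (f : Γ(Y, U.toOpens) →+* Γ(Y, U.toOpens)) (hf : (idealAt I U).map f = idealAt I U),
        f = RingHom.id _ → affineBlowUpMap f hf = 𝟙 _ := by
      rintro f hf rfl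
      exact affineBlowUpMap_id hf
    exact key _ _ (by simp; rfl)
  map_comp {U V W} h k := by
    have key : ∀ (f : Γ(Y, W.toOpens) →+* Γ(Y, U.toOpens)) (hf : (idealAt I W).map f = idealAt I U),
        f = (Y.presheaf.map ((toOpensFunctor Y).map h).op).hom.comp
          (Y.presheaf.map ((toOpensFunctor Y).map k).op).hom →
        affineBlowUpMap f hf = affineBlowUpMap _ (map_idealAt I h) ≫
          affineBlowUpMap _ (map_idealAt I k) := by
      rintro f hf rfl
      exact affineBlowUpMap_comp _ _ _ _ _
    exact key _ _ (by simp [← CommRingCat.hom_comp, ← Functor.map_comp, ← op_comp]; rfl)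

/-- The structure morphisms `Proj (⨁ₙ I(U)ⁿ) ⟶ Spec Γ(Y, U)`. -/
def blowUpNatTrans : blowUpFunctor I ⟶
    toOpensFunctor Y ⋙ Y.presheaf.rightOp ⋙ Scheme.Spec where
  app U := affineBlowUpπ (idealAt I U)
  naturality _ _ h := affineBlowUpMap_π _ (map_idealAt I h)

lemma equifibered_blowUpNatTrans : (blowUpNatTrans I).Equifibered := by
  intro U V h
  obtain ⟨r, hr⟩ := leOfHom h
  exact isPullback_affineBlowUpMap_of_away _ r
    (V.2.isLocalization_of_eq_basicOpen r ((toOpensFunctor Y).map h) hr.symm) (map_idealAt I h)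

lemma equifibered_restrictIsoSpec_inv : (restrictIsoSpec Y).inv.Equifibered := .of_isIso _

/-- The `Proj (⨁ₙ I(U)ⁿ) ⟶ U` as a relative gluing datum over `Y`. -/
def blowUpGluingData : (directedCover Y).RelativeGluingData where
  functor := blowUpFunctor I
  natTrans := blowUpNatTrans I ≫ (restrictIsoSpec Y).inv
  equifibered := (equifibered_blowUpNatTrans I).comp equifibered_restrictIsoSpec_inv

/-- The blow-up of `Y` along the closed subscheme with ideal sheaf `I`, i.e. the relative `Proj` of
`⨁ₙ Iⁿ`. -/
def blowUp : Scheme.{u} := (blowUpGluingData I).glued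

/-- The structure morphism of the blow-up. -/
def blowUpπ : blowUp I ⟶ Y := (blowUpGluingData I).toBase

end Global

/-! ### Varieties, extension of scalars and automorphism functors -/

section Aut

variable {F : Type u} [Field F]

/-- A variety over `F` is a separated `F`-scheme of finite type. -/
structure IsVariety (X : Over (Spec (.of F))) : Prop where
  isSeparated : IsSeparated X.hom
  locallyOfFiniteType : LocallyOfFiniteType X.hom
  quasiCompact : QuasiCompact X.hom

/-- `Spec A ⟶ Spec F`. -/
abbrev structMap (A : CommAlgCat.{u} F) : Spec (.of A) ⟶ Spec (.of F) :=
  Spec.map (CommRingCat.ofHom (algebraMap F A))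

lemma specMap_structMap {A B : CommAlgCat.{u} F} (h : A ⟶ B) :
    Spec.map (CommRingCat.ofHom h.hom.toRingHom) ≫ structMap A = structMap B := by
  rw [← Spec.map_comp, ← CommRingCat.ofHom_comp]
  congr 2
  exact h.hom.comp_algebraMap

/-- `X_A = X ×_F A`. -/
abbrev extend (X : Over (Spec (.of F))) (A : CommAlgCat.{u} F) : Over (Spec (.of A)) :=
  (Over.pullback (structMap A)).obj X

/-- `f_A : X_A ⟶ X'_A`. -/
abbrev extendMap {X X' : Over (Spec (.of F))} (f : X ⟶ X') (A : CommAlgCat.{u} F) :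
    extend X A ⟶ extend X' A :=
  (Over.pullback (structMap A)).map f

/-- `X_B ⟶ X_A` for `A ⟶ B`. -/
def transition (X : Over (Spec (.of F))) {A B : CommAlgCat.{u} F} (h : A ⟶ B) :
    (extend X B).left ⟶ (extend X A).left :=
  pullback.lift (pullback.fst _ _)
    (pullback.snd _ _ ≫ Spec.map (CommRingCat.ofHom h.hom.toRingHom))
    (by rw [Category.assoc, specMap_structMap, pullback.condition])

variable (X X' X'' : Over (Spec (.of F))) {A B C : CommAlgCat.{u} F}

lemma transition_fst (h : A ⟶ B) :
    transition X h ≫ pullback.fst X.hom (structMap A) = pullback.fst X.hom (structMap B) :=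
  pullback.lift_fst _ _ _

lemma transition_hom (h : A ⟶ B) :
    transition X h ≫ (extend X A).hom =
      (extend X B).hom ≫ Spec.map (CommRingCat.ofHom h.hom.toRingHom) :=
  pullback.lift_snd _ _ _

lemma transition_id : transition X (𝟙 A) = 𝟙 _ := by
  apply pullback.hom_ext
  · rw [transition_fst, Category.id_comp]
  · refine (transition_hom X (𝟙 A)).trans ?_
    have : Spec.map (CommRingCat.ofHom (CommAlgCat.Hom.hom (𝟙 A)).toRingHom) = 𝟙 _ :=
      Spec.map_id _
    rw [this, Category.comp_id, Category.id_comp]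
    rfl

lemma transition_comp (h : A ⟶ B) (k : B ⟶ C) :
    transition X (h ≫ k) = transition X k ≫ transition X h := by
  apply pullback.hom_ext
  · rw [Category.assoc, transition_fst, transition_fst, transition_fst]
  · refine (transition_hom X (h ≫ k)).trans ?_
    have : Spec.map (CommRingCat.ofHom (CommAlgCat.Hom.hom (h ≫ k)).toRingHom) =
      Spec.map (CommRingCat.ofHom k.hom.toRingHom) ≫
        Spec.map (CommRingCat.ofHom h.hom.toRingHom) :=
      Spec.map_comp (CommRingCat.ofHom h.hom.toRingHom) (CommRingCat.ofHom k.hom.toRingHom)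
    rw [this, Category.assoc]
    refine .trans ?_ (congrArg (transition X k ≫ ·) (transition_hom X h)).symm
    rw [← Category.assoc, ← Category.assoc, transition_hom]

lemma transition_extendMap (f : X ⟶ X') (h : A ⟶ B) :
    transition X h ≫ (extendMap f A).left = (extendMap f B).left ≫ transition X' h := by
  apply pullback.hom_ext
  · have e (A : CommAlgCat.{u} F) : (extendMap f A).left ≫ pullback.fst X'.hom (structMap A) =
      pullback.fst X.hom (structMap A) ≫ f.left := pullback.lift_fst _ _ _
    rw [Category.assoc, Category.assoc, e, transition_fst, e, ← Category.assoc, transition_fst]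
  · have e (A : CommAlgCat.{u} F) : (extendMap f A).left ≫ pullback.snd X'.hom (structMap A) =
      pullback.snd X.hom (structMap A) := Over.w (extendMap f A)
    have e2 (X : Over (Spec (.of F))) : transition X h ≫ pullback.snd X.hom (structMap A) =
      pullback.snd X.hom (structMap B) ≫ _ := transition_hom X h
    rw [Category.assoc, Category.assoc, e, e2, e2, ← Category.assoc, e]

variable {X X' X''}

lemma extend_hom_ext {T : Over (Spec (.of B))} (h : A ⟶ B) {f g : T ⟶ extend X B}
    (e : f.left ≫ transition X h = g.left ≫ transition X h) : f = g := by
  apply Over.OverMorphism.ext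
  apply pullback.hom_ext
  · rw [← transition_fst X h, ← Category.assoc, ← Category.assoc, e]
  · exact (Over.w f).trans (Over.w g).symm

/-- The base change along `A ⟶ B` of a morphism `X_A ⟶ X'_A` of `A`-schemes: the unique morphism
`X_B ⟶ X'_B` of `B`-schemes lying over it. -/
def baseChangeHom (h : A ⟶ B) (g : extend X A ⟶ extend X' A) : extend X B ⟶ extend X' B :=
  Over.homMk (pullback.lift (transition X h ≫ g.left ≫ pullback.fst _ _) (extend X B).hom (by
    rw [Category.assoc, Category.assoc, pullback.condition]
    have : g.left ≫ pullback.snd _ _ = (extend X A).hom := Over.w g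
    rw [← Category.assoc g.left, this, ← Category.assoc, transition_hom, Category.assoc,
      specMap_structMap])) (pullback.lift_snd _ _ _)

lemma baseChangeHom_transition (h : A ⟶ B) (g : extend X A ⟶ extend X' A) :
    (baseChangeHom h g).left ≫ transition X' h = transition X h ≫ g.left := by
  apply pullback.hom_ext
  · rw [Category.assoc, transition_fst]
    refine (pullback.lift_fst _ _ _).trans (Category.assoc _ _ _).symm
  · have e2 (X : Over (Spec (.of F))) : transition X h ≫ pullback.snd X.hom (structMap A) =
      pullback.snd X.hom (structMap B) ≫ _ := transition_hom X h
    have e3 : g.left ≫ pullback.snd _ _ = pullback.snd _ _ := Over.w g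
    have e4 : (baseChangeHom h g).left ≫ pullback.snd _ _ = pullback.snd _ _ :=
      Over.w (baseChangeHom h g)
    rw [Category.assoc, Category.assoc, e2, e3, e2, ← Category.assoc, e4]

lemma baseChangeHom_unique (h : A ⟶ B) (g : extend X A ⟶ extend X' A)
    (g' : extend X B ⟶ extend X' B)
    (e : g'.left ≫ transition X' h = transition X h ≫ g.left) : baseChangeHom h g = g' :=
  extend_hom_ext h (by rw [baseChangeHom_transition, e])

lemma baseChangeHom_id (h : A ⟶ B) : baseChangeHom h (𝟙 (extend X A)) = 𝟙 _ :=
  baseChangeHom_unique _ _ _ (by simp)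

lemma baseChangeHom_comp (h : A ⟶ B) (g : extend X A ⟶ extend X' A)
    (g' : extend X' A ⟶ extend X'' A) :
    baseChangeHom h (g ≫ g') = baseChangeHom h g ≫ baseChangeHom h g' :=
  baseChangeHom_unique _ _ _ (by
    rw [Over.comp_left, Over.comp_left, Category.assoc, baseChangeHom_transition,
      ← Category.assoc, baseChangeHom_transition, Category.assoc])

lemma baseChangeHom_extendMap (h : A ⟶ B) (f : X ⟶ X') :
    baseChangeHom h (extendMap f A) = extendMap f B :=
  baseChangeHom_unique _ _ _ (transition_extendMap _ _ _ _).symm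

lemma baseChangeHom_id_alg (g : extend X A ⟶ extend X' A) : baseChangeHom (𝟙 A) g = g :=
  baseChangeHom_unique _ _ _ (by rw [transition_id, transition_id, Category.id_comp,
    Category.comp_id])

lemma baseChangeHom_comp_alg (h : A ⟶ B) (k : B ⟶ C) (g : extend X A ⟶ extend X' A) :
    baseChangeHom (h ≫ k) g = baseChangeHom k (baseChangeHom h g) :=
  baseChangeHom_unique _ _ _ (by
    rw [transition_comp, transition_comp, ← Category.assoc, baseChangeHom_transition,
      Category.assoc, Category.assoc, baseChangeHom_transition])

/-- The base change of an isomorphism. -/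
def baseChangeIso (h : A ⟶ B) (g : extend X A ≅ extend X' A) : extend X B ≅ extend X' B where
  hom := baseChangeHom h g.hom
  inv := baseChangeHom h g.inv
  hom_inv_id := by rw [← baseChangeHom_comp, g.hom_inv_id, baseChangeHom_id]
  inv_hom_id := by rw [← baseChangeHom_comp, g.inv_hom_id, baseChangeHom_id]

/-- `Aut_A(X_A) → Aut_B(X_B)`, by base change along `A ⟶ B`. -/
def autMap (X : Over (Spec (.of F))) (h : A ⟶ B) : Aut (extend X A) →* Aut (extend X B) where
  toFun g := baseChangeIso h g
  map_one' := Aut.ext (baseChangeHom_id h)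
  map_mul' _ _ := Aut.ext (baseChangeHom_comp h _ _)

/-- The automorphism group functor `A ↦ Aut_A(X_A)` of `X`. -/
def autFunctor (X : Over (Spec (.of F))) : CommAlgCat.{u} F ⥤ GrpCat.{u} where
  obj A := .of (Aut (extend X A))
  map h := GrpCat.ofHom (autMap X h)
  map_id A := by
    refine GrpCat.hom_ext (MonoidHom.ext fun (g : Aut (extend X _)) ↦ ?_)
    exact Aut.ext (baseChangeHom_id_alg (A := A) (X := X) (X' := X) g.hom)
  map_comp h k := by
    refine GrpCat.hom_ext (MonoidHom.ext fun (g : Aut (extend X _)) ↦ ?_)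
    exact Aut.ext (baseChangeHom_comp_alg (X := X) (X' := X) h k g.hom)

variable {Z Y : Over (Spec (.of F))} (ι : Z ⟶ Y)

/-- The automorphisms `g` of `Y_A` with `g(Z_A) = Z_A` as closed subschemes, i.e. such that `g`
restricts to an automorphism of `Z_A`. -/
def stabSubgroup (A : CommAlgCat.{u} F) : Subgroup (Aut (extend Y A)) where
  carrier := {g | ∃ k : extend Z A ≅ extend Z A, k.hom ≫ extendMap ι A = extendMap ι A ≫ g.hom}
  one_mem' := ⟨Iso.refl _, (Category.id_comp _).trans (Category.comp_id _).symm⟩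
  mul_mem' := by
    rintro g g' ⟨k, hk⟩ ⟨k', hk'⟩
    refine ⟨k'.trans k, ?_⟩
    change (k'.hom ≫ k.hom) ≫ _ = _ ≫ (g'.hom ≫ g.hom)
    rw [Category.assoc, hk, ← Category.assoc, hk', Category.assoc]
  inv_mem' := by
    rintro g ⟨k, hk⟩
    refine ⟨k.symm, ?_⟩
    change k.inv ≫ _ = _ ≫ g.inv
    rw [Iso.inv_comp_eq, ← Category.assoc, hk, Category.assoc, g.hom_inv_id, Category.comp_id]

lemma autMap_mem_stabSubgroup (h : A ⟶ B) (g : Aut (extend Y A)) (hg : g ∈ stabSubgroup ι A) :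
    autMap Y h g ∈ stabSubgroup ι B := by
  obtain ⟨k, hk⟩ := hg
  refine ⟨baseChangeIso h k, ?_⟩
  change baseChangeHom h k.hom ≫ _ = _ ≫ baseChangeHom h g.hom
  rw [← baseChangeHom_extendMap h, ← baseChangeHom_comp, ← baseChangeHom_comp, hk]

/-- The stabiliser of `Z` in the automorphism group functor of `Y`. -/
def stabFunctor : CommAlgCat.{u} F ⥤ GrpCat.{u} where
  obj A := .of (stabSubgroup ι A)
  map h := GrpCat.ofHom (((autMap Y h).comp (stabSubgroup ι _).subtype).codRestrict _
    fun g ↦ autMap_mem_stabSubgroup ι h g.1 g.2)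
  map_id A := by
    refine GrpCat.hom_ext (MonoidHom.ext fun (g : stabSubgroup ι _) ↦ ?_)
    exact Subtype.ext (Aut.ext (baseChangeHom_id_alg (A := A) (X := Y) (X' := Y) g.1.hom))
  map_comp h k := by
    refine GrpCat.hom_ext (MonoidHom.ext fun (g : stabSubgroup ι _) ↦ ?_)
    exact Subtype.ext (Aut.ext (baseChangeHom_comp_alg (X := Y) (X' := Y) h k g.1.hom))

/-- The blow-up of `Y` along the closed subscheme `ι : Z ⟶ Y`, over `F`. -/
def blowUpOver : Over (Spec (.of F)) := Over.mk (blowUpπ ι.left.ker ≫ Y.hom)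

/-- The structure morphism `β : Bl_Z(Y) ⟶ Y`, over `F`. -/
def blowUpHom : blowUpOver ι ⟶ Y := Over.homMk (blowUpπ ι.left.ker)

/-- The codimension of an irreducible closed subset `T` of a topological space: the supremum of the
lengths of the chains `T = T₀ ⊂ T₁ ⊂ ⋯` of irreducible closed subsets. -/
def codim {W : Type*} [TopologicalSpace W] (T : TopologicalSpace.IrreducibleCloseds W) : ℕ∞ :=
  Order.coheight T

/-- Every irreducible component of `Z` has codimension at least `n` in `Y`. -/
def ComponentsCodimGE (n : ℕ) : Prop :=
  ∀ T : TopologicalSpace.IrreducibleCloseds Y.left,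
    (∃ C ∈ irreducibleComponents Z.left, (T : Set Y.left) = ι.left '' C) → (n : ℕ∞) ≤ codim T

/-- `Z` contains no irreducible component of `Y`. -/
def ContainsNoComponent : Prop :=
  ∀ C ∈ irreducibleComponents Y.left, ¬ C ⊆ Set.range ι.left

end Aut

/-! ### Jet groups -/

section Jet

open TensorProduct

variable {F : Type u} [Field F] {A : Type u} [CommRing A] [Algebra F A]

/-- `ρ ⊗ B : A ⊗ B ⟶ B`, for an `F`-algebra `B`. -/
def residueMap (ρ : A →ₐ[F] F) (B : CommAlgCat.{u} F) : CommAlgCat.of F (A ⊗[F] B) ⟶ B :=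
  CommAlgCat.ofHom ((Algebra.TensorProduct.lid F B).toAlgHom.comp
    (Algebra.TensorProduct.map ρ (AlgHom.id F B)))

variable (A) in
/-- `A ⊗ B ⟶ A ⊗ C`, for `B ⟶ C`. -/
def tensorMap {B C : CommAlgCat.{u} F} (h : B ⟶ C) :
    CommAlgCat.of F (A ⊗[F] B) ⟶ CommAlgCat.of F (A ⊗[F] C) :=
  CommAlgCat.ofHom (Algebra.TensorProduct.map (AlgHom.id F A) h.hom)

lemma tensorMap_residueMap (ρ : A →ₐ[F] F) {B C : CommAlgCat.{u} F} (h : B ⟶ C) :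
    tensorMap A h ≫ residueMap ρ C = residueMap ρ B ≫ h := by
  apply CommAlgCat.hom_ext
  apply Algebra.TensorProduct.ext'
  intro a b
  simp [tensorMap, residueMap]

variable (G H : CommAlgCat.{u} F ⥤ GrpCat.{u}) (ρ : A →ₐ[F] F)

lemma map_mem_ker {B C : CommAlgCat.{u} F} (h : B ⟶ C)
    (g : G.obj (.of F (A ⊗[F] B))) (hg : g ∈ (G.map (residueMap ρ B)).hom.ker) :
    G.map (tensorMap A h) g ∈ (G.map (residueMap ρ C)).hom.ker := by
  rw [MonoidHom.mem_ker] at hg ⊢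
  change G.map (residueMap ρ C) (G.map (tensorMap A h) g) = 1
  change G.map (residueMap ρ B) g = 1 at hg
  rw [← ConcreteCategory.comp_apply, ← G.map_comp, tensorMap_residueMap, G.map_comp,
    ConcreteCategory.comp_apply, hg, map_one]

lemma tensorMap_id (B : CommAlgCat.{u} F) : tensorMap A (𝟙 B) = 𝟙 _ := by
  apply CommAlgCat.hom_ext
  apply Algebra.TensorProduct.ext'
  intro a b
  simp [tensorMap]

lemma tensorMap_comp {B C D : CommAlgCat.{u} F} (h : B ⟶ C) (k : C ⟶ D) :
    tensorMap A (h ≫ k) = tensorMap A h ≫ tensorMap A k := by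
  apply CommAlgCat.hom_ext
  apply Algebra.TensorProduct.ext'
  intro a b
  simp [tensorMap]

/-- The group functor `J(G, ρ) : B ↦ Ker (G(A ⊗ B) → G(B))`. -/
def jet : CommAlgCat.{u} F ⥤ GrpCat.{u} where
  obj B := .of (G.map (residueMap ρ B)).hom.ker
  map {B C} h := GrpCat.ofHom
    (((G.map (tensorMap A h)).hom.comp (G.map (residueMap ρ B)).hom.ker.subtype).codRestrict _
      fun g ↦ map_mem_ker G ρ h g.1 g.2)
  map_id B := by
    refine GrpCat.hom_ext (MonoidHom.ext fun g ↦ Subtype.ext ?_)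
    change G.map (tensorMap A (𝟙 B)) g.1 = g.1
    rw [tensorMap_id, G.map_id]
    rfl
  map_comp h k := by
    refine GrpCat.hom_ext (MonoidHom.ext fun g ↦ Subtype.ext ?_)
    change G.map (tensorMap A (h ≫ k)) g.1 = G.map (tensorMap A k) (G.map (tensorMap A h) g.1)
    rw [tensorMap_comp, G.map_comp]
    rfl

variable {G H}

lemma app_mem_ker (φ : G ⟶ H) {B : CommAlgCat.{u} F}
    (g : G.obj (.of F (A ⊗[F] B))) (hg : g ∈ (G.map (residueMap ρ B)).hom.ker) :
    φ.app (.of F (A ⊗[F] B)) g ∈ (H.map (residueMap ρ B)).hom.ker := by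
  rw [MonoidHom.mem_ker] at hg ⊢
  change H.map (residueMap ρ B) (φ.app _ g) = 1
  change G.map (residueMap ρ B) g = 1 at hg
  rw [← ConcreteCategory.comp_apply, ← φ.naturality, ConcreteCategory.comp_apply, hg, map_one]

/-- The morphism `J(G, ρ) ⟶ J(H, ρ)` induced by a morphism `G ⟶ H` of group functors. -/
def jetMap (φ : G ⟶ H) : jet G ρ ⟶ jet H ρ where
  app B := GrpCat.ofHom
    (((φ.app (.of F (A ⊗[F] B))).hom.comp (G.map (residueMap ρ B)).hom.ker.subtype).codRestrict _
      fun g ↦ app_mem_ker ρ φ g.1 g.2)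
  naturality B C h := by
    ext g
    apply Subtype.ext
    exact ConcreteCategory.congr_hom (φ.naturality (tensorMap A h)) g.1

end Jet

end BlowUp

end

open BlowUp

noncomputable section

namespace BlowUp

/-! ### Smooth algebras over a field: reducedness, dual families of derivations, regular pairs -/

section SmoothAlgebra

open TensorProduct

/-! The lifting half rests on the universal property of the blow-up: a morphism to `Y` that makes
the ideal of `Z` locally generated by a nonzerodivisor factors uniquely through `X`
(`exists_lift_blowUp`, `blowUp_hom_ext`). Base change from the field `F` to `A` is flat, so the
ideal of `Z` stays Cartier on `X_A`; composing `β_A` with an automorphism that stabilises `Z_A`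
gives the same ideal, hence a unique lift. Uniqueness yields inverses, multiplicativity and
naturality.

Injectivity: `β` is an isomorphism over the complement of `Z`. If `Z` contains no component, that
complement is schematically dense because `Y` is reduced, so `β` is schematically dominant. This
survives flat base change, and morphisms to the separated `Y_A` are then determined after
composition with `β_A`.

For the jet groups, the kernel of `A ⊗ B → B` is nil, so an automorphism `g` in the kernel fixes
every point of the base-changed blow-up (`hom_left_apply_eq`). In codimension at least two, `Y` is
covered by affine opens `U` whose ideal contains a regular pair, and a Hartogs argument shows that
`U` and its preimage in `X` have the same functions (`isIso_blowUpπ_app_of_regular_pair`); flat base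
change preserves this. Since `β_A ∘ g` maps the preimage of `U` into the affine `U`, it descends to
an automorphism `f` (`exists_desc_aut`).

It remains to see that `f` preserves the ideal `I` of `Z`; the core is
`IsAffineChart.map_mem_of_derivation`. A derivation `δ` with `δ a ≡ 0` and `δ b ≡ 1` modulo `I`
gives a derivation `E = a δ` of the chart `R[I/a]`. Functions coming from `R` have `E`-derivative
divisible by `a`, whereas `E (b/a) ≡ 1` modulo `a`: the field `E` is tangent to the fibres of the
exceptional divisor and moves the coordinate `b/a`. Comparing the two through the surjection that
`g` induces on the chart forces `a ∣ f^*(a)`, and hence `f^*(I) ⊆ I`. The same for the inverse gives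
equality. -/

lemma isReduced_of_smooth (F R : Type u) [Field F] [CommRing R] [Algebra F R]
    [Algebra.Smooth F R] : IsReduced R := by
  refine ⟨fun x hx ↦ ?_⟩
  by_contra h0
  have hne : Ideal.span {x} ≠ ⊥ := by simpa using h0
  have hann : (Submodule.annihilator (Ideal.span {x})) ≠ ⊤ := by
    intro h
    rw [Submodule.annihilator_eq_top_iff] at h
    exact hne h
  -- Near `m` the algebra is étale over a polynomial ring `P`. By flatness it embeds in its base
  -- change to `Frac P`, which is étale over a field and hence reduced. So a power of some `f ∉ m`
  -- kills `x`, against the choice of `m`.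
  obtain ⟨m, hm, hle⟩ := Ideal.exists_le_maximal _ hann
  obtain ⟨f, hfm, n, _, _, _⟩ :=
    Algebra.IsSmoothAt.exists_isStandardEtale_mvPolynomial (R := F) (p := m)
  let P := MvPolynomial (Fin n) F
  let K := FractionRing P
  let S := Localization.Away f
  have : IsReduced (K ⊗[P] S) := Algebra.FormallyUnramified.isReduced_of_field K _
  have hinj : Function.Injective (Algebra.TensorProduct.includeRight : S →ₐ[P] K ⊗[P] S) :=
    Algebra.TensorProduct.includeRight_injective (IsFractionRing.injective P K)
  have : IsReduced S := isReduced_of_injective _ hinj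
  have hx0 : algebraMap R S x = 0 := (hx.map (algebraMap R S)).eq_zero
  rw [IsLocalization.map_eq_zero_iff (Submonoid.powers f)] at hx0
  obtain ⟨⟨_, k, rfl⟩, hk⟩ := hx0
  have : f ^ k ∈ m := hle (by
    rw [Submodule.mem_annihilator_span_singleton]
    exact hk)
  exact hfm (hm.isPrime.mem_of_pow_mem _ this)

variable {F R : Type u} [Field F] [CommRing R] [Algebra F R]

/-- Jacobian criterion: the conormal sequence is split by `ω ↦ ∑ Dᵢ(ω) [aᵢ]`, since `Dᵢ x ≡ cᵢ`
modulo the ideal whenever `x = ∑ cᵢ aᵢ`. -/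
lemma formallySmooth_quotient_span [Algebra.FormallySmooth F R] {ι : Type*} [Finite ι]
    [DecidableEq ι] (a : ι → R) (D : ι → Derivation F R R)
    (hD : ∀ i j, D i (a j) = if i = j then 1 else 0) :
    Algebra.FormallySmooth F (R ⧸ Ideal.span (Set.range a)) := by
  have := Fintype.ofFinite ι
  set J := Ideal.span (Set.range a)
  rw [Algebra.FormallySmooth.iff_split_injection (P := R) Ideal.Quotient.mk_surjective]
  have hker : RingHom.ker (algebraMap R (R ⧸ J)) = J := Ideal.mk_ker
  have ha (i) : a i ∈ RingHom.ker (algebraMap R (R ⧸ J)) := by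
    rw [hker]; exact Ideal.subset_span ⟨i, rfl⟩
  let v (i : ι) := Ideal.toCotangent (RingHom.ker (algebraMap R (R ⧸ J))) ⟨a i, ha i⟩
  have hv (i : ι) (r : R) (hr : r ∈ J) : r • v i = 0 := by
    rw [← map_smul, Ideal.toCotangent_eq_zero, pow_two]
    exact Ideal.mul_mem_mul (hker.symm ▸ hr) (ha i)
  let g (i : ι) : (R ⧸ J) →ₗ[R] (RingHom.ker (algebraMap R (R ⧸ J))).Cotangent :=
    Submodule.liftQ J (LinearMap.toSpanSingleton R _ (v i)) fun r hr ↦ hv i r hr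
  let l : (R ⧸ J) ⊗[R] Ω[R⁄F] →ₗ[R] (RingHom.ker (algebraMap R (R ⧸ J))).Cotangent :=
    ∑ i, g i ∘ₗ (TensorProduct.rid R (R ⧸ J)).toLinearMap ∘ₗ
      (D i).liftKaehlerDifferential.lTensor (R ⧸ J)
  refine ⟨l, LinearMap.ext fun y ↦ ?_⟩
  obtain ⟨⟨x, hx⟩, rfl⟩ := Ideal.toCotangent_surjective _ y
  have hx' := hx
  rw [hker, Ideal.mem_span_range_iff_exists_fun] at hx'
  obtain ⟨c, hc⟩ := hx'
  have h1 (i : ι) : D i x • v i = c i • v i := by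
    rw [← sub_eq_zero, ← sub_smul]
    apply hv
    have : D i x - c i = ∑ j, a j * D i (c j) := by
      simp [← hc, hD, Finset.sum_add_distrib]
    rw [this]
    exact Ideal.sum_mem _ fun j _ ↦ Ideal.mul_mem_right _ _ (Ideal.subset_span ⟨j, rfl⟩)
  have h2 (i : ι) : g i ((D i x) • (1 : R ⧸ J)) = D i x • v i := by
    rw [map_smul]; congr 1
    exact one_smul R (v i)
  simp only [l, LinearMap.comp_apply, KaehlerDifferential.kerCotangentToTensor_toCotangent,
    LinearMap.coe_sum, Finset.sum_apply, LinearMap.lTensor_tmul,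
    Derivation.liftKaehlerDifferential_comp_D, LinearEquiv.coe_coe, TensorProduct.rid_tmul, h2, h1,
    LinearMap.id_coe, id_eq]
  simp only [v, ← map_smul, ← map_sum]
  congr 1
  apply Subtype.ext
  simpa using hc

lemma isReduced_quotient_span [Algebra.Smooth F R] {ι : Type*} [Finite ι]
    [DecidableEq ι] (a : ι → R) (D : ι → Derivation F R R)
    (hD : ∀ i j, D i (a j) = if i = j then 1 else 0) :
    IsReduced (R ⧸ Ideal.span (Set.range a)) := by
  have := formallySmooth_quotient_span a D hD
  have : IsNoetherianRing R := Algebra.FiniteType.isNoetherianRing F R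
  have : Algebra.FiniteType F (R ⧸ Ideal.span (Set.range a)) := .of_surjective
    (Ideal.Quotient.mkₐ F (Ideal.span (Set.range a))) Ideal.Quotient.mk_surjective
  have : Algebra.FinitePresentation F (R ⧸ Ideal.span (Set.range a)) :=
    Algebra.FinitePresentation.of_finiteType.mp this
  have : Algebra.Smooth F (R ⧸ Ideal.span (Set.range a)) := {}
  exact isReduced_of_smooth F _

/-- If `R ⧸ J` is reduced and a derivation `E` preserving `J` satisfies `E b = 1`, then `b` is a
nonzerodivisor modulo `J`. -/
lemma mem_of_mul_mem_of_derivation {J : Ideal R} [IsReduced (R ⧸ J)] (E : Derivation F R R)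
    (hE : ∀ x ∈ J, E x ∈ J) {b : R} (hb : E b = 1) {x : R} (hx : b * x ∈ J) : x ∈ J := by
  have h1 : b * E x + x ∈ J := by simpa [hb] using hE _ hx
  -- Multiplying `b * E x + x` by `x` and subtracting `E x * (b * x)` leaves `x ^ 2`.
  have h2 : x ^ 2 ∈ J := by
    have := J.sub_mem (J.mul_mem_left x h1) (J.mul_mem_left (E x) hx)
    convert this using 1; ring
  rw [← Ideal.Quotient.eq_zero_iff_mem] at h2 ⊢
  rw [map_pow] at h2
  exact pow_eq_zero_iff (two_ne_zero) |>.mp h2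

lemma derivation_mem_span {ι : Type*} (a : ι → R) (E : Derivation F R R) (hE : ∀ i, E (a i) = 0)
    (x : R) (hx : x ∈ Ideal.span (Set.range a)) : E x ∈ Ideal.span (Set.range a) := by
  induction hx using Submodule.span_induction with
  | mem x h => obtain ⟨i, rfl⟩ := h; simp [hE]
  | zero => simp
  | add x y _ _ hx hy => rw [map_add]; exact add_mem hx hy
  | smul r x hx' hx =>
    rw [smul_eq_mul, Derivation.leibniz]
    exact add_mem (Ideal.mul_mem_left _ _ hx) (Ideal.mul_mem_right _ _ hx')

end SmoothAlgebra
end BlowUp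
namespace BlowUp

section SmoothAlgebra

open TensorProduct

variable {F R : Type u} [Field F] [CommRing R] [Algebra F R]

/-- A linear functional on the fibre of a finite projective module lifts, up to a scalar. -/
lemma exists_lift_functionals {M : Type u} [AddCommGroup M] [Module R M] [Module.Finite R M]
    [Module.Projective R M] (p : Ideal R) [p.IsPrime] {ι : Type*} [Finite ι]
    (μ : ι → M →ₗ[R] p.ResidueField) :
    ∃ s : R, s ∉ p ∧ ∃ f : ι → M →ₗ[R] R, ∀ i m,
      algebraMap R p.ResidueField (f i m) = algebraMap R p.ResidueField s * μ i m := by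
  have := Fintype.ofFinite ι
  obtain ⟨k, π, hπ⟩ := Module.Finite.exists_fin' R M
  obtain ⟨σ, hσ⟩ := Module.projective_lifting_property π LinearMap.id hπ
  -- `s` is a common denominator for the values of the functionals on finitely many generators. The
  -- section `σ`, which exists by projectivity, turns the cleared values into linear forms on `M`.
  obtain ⟨⟨s, hs⟩, h⟩ := IsLocalization.exist_integer_multiples (nonZeroDivisors (R ⧸ p))
    (S := p.ResidueField) Finset.univ fun x : ι × Fin k ↦ μ x.1 (π (Pi.single x.2 1))
  obtain ⟨s, rfl⟩ := Ideal.Quotient.mk_surjective s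
  have hs' : s ∉ p := fun h ↦ nonZeroDivisors.ne_zero hs (Ideal.Quotient.eq_zero_iff_mem.mpr h)
  have h2 (x : ι × Fin k) : ∃ t : R, algebraMap R p.ResidueField t =
      algebraMap R p.ResidueField s * μ x.1 (π (Pi.single x.2 1)) := by
    obtain ⟨t, ht⟩ := h x (Finset.mem_univ x)
    obtain ⟨t, rfl⟩ := Ideal.Quotient.mk_surjective t
    refine ⟨t, ht.trans ?_⟩
    rw [Algebra.smul_def]; rfl
  choose t ht using h2
  refine ⟨s, hs', fun i ↦ (∑ l, t (i, l) • LinearMap.proj l) ∘ₗ σ, fun i m ↦ ?_⟩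
  have e : m = ∑ l, σ m l • π (Pi.single l 1) := by
    conv_lhs => rw [← LinearMap.id_apply (R := R) m, ← hσ, LinearMap.comp_apply,
      pi_eq_sum_univ' (σ m), map_sum]
    refine Finset.sum_congr rfl fun l _ ↦ ?_
    rw [← map_smul]
  conv_rhs => rw [e]
  simp only [LinearMap.comp_apply, LinearMap.coe_sum, Finset.sum_apply, LinearMap.smul_apply,
    LinearMap.proj_apply, smul_eq_mul, map_sum, map_mul, map_smul, ht, Finset.mul_sum,
    Algebra.smul_def]
  refine Finset.sum_congr rfl fun l _ ↦ ?_
  ring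

/-- Smoothness of `R ⧸ I` splits the conormal module off `Ω`. Elements of `I` whose classes form a
basis of the conormal fibre at `p` therefore have independent differentials there; dual functionals
lift to derivations up to a scalar `s ∉ p`, and Nakayama makes these elements generate `I` after
inverting some `h ∉ p`. -/
lemma exists_dual_family [Algebra.Smooth F R] (I : Ideal R) [Algebra.FormallySmooth F (R ⧸ I)]
    (p : Ideal R) [p.IsPrime] (hI : I ≤ p) :
    ∃ (n : ℕ) (a : Fin n → R) (D : Fin n → Derivation F R R), (∀ j, a j ∈ I) ∧
      (∃ s ∉ p, ∀ i j, D i (a j) - (if i = j then s else 0) ∈ p) ∧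
      ∃ h ∉ p, ∀ x ∈ I, h * x ∈ Ideal.span (Set.range a) := by
  have : IsNoetherianRing R := Algebra.FiniteType.isNoetherianRing F R
  obtain ⟨l, hl⟩ := (Algebra.FormallySmooth.iff_split_injection (R := F) (P := R) (A := R ⧸ I)
    Ideal.Quotient.mk_surjective).mp inferInstance
  let K := RingHom.ker (algebraMap R (R ⧸ I))
  have hK : K = I := Ideal.mk_ker
  have hκ (x : R) : algebraMap R p.ResidueField x = 0 ↔ x ∈ p := Ideal.algebraMap_residueField_eq_zero
  let v (x : K) : p.ResidueField ⊗[R] K.Cotangent := 1 ⊗ₜ K.toCotangent x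
  have hv : Submodule.span p.ResidueField (Set.range v) = ⊤ := by
    refine eq_top_iff.mpr fun y _ ↦ ?_
    induction y with
    | zero => exact zero_mem _
    | add x y hx hy => exact add_mem (hx trivial) (hy trivial)
    | tmul c m =>
      obtain ⟨x, rfl⟩ := Ideal.toCotangent_surjective _ m
      have : c ⊗ₜ[R] K.toCotangent x = c • v x := by
        rw [TensorProduct.smul_tmul', smul_eq_mul, mul_one]
      rw [this]
      exact Submodule.smul_mem _ _ (Submodule.subset_span ⟨x, rfl⟩)
  obtain ⟨J, a, -, hspan, hli⟩ := exists_linearIndependent' p.ResidueField v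
  rw [hv] at hspan
  have : Module.Finite R K.Cotangent := .of_surjective _ (Ideal.toCotangent_surjective K)
  have : Finite J := hli.finite
  obtain ⟨n, ⟨e⟩⟩ := Finite.exists_equiv_fin J
  let w (j : J) : p.ResidueField ⊗[R] Ω[R⁄F] := 1 ⊗ₜ KaehlerDifferential.D F R (a j)
  -- The splitting `l` carries the differentials back to the independent conormal classes.
  have hw : LinearIndependent p.ResidueField w := by
    refine .of_comp ((l ∘ₗ TensorProduct.mk R (R ⧸ I) _ 1).baseChange p.ResidueField) ?_
    suffices h : (l ∘ₗ TensorProduct.mk R (R ⧸ I) _ 1).baseChange p.ResidueField ∘ w = v ∘ a by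
      rw [h]; exact hli
    ext j
    simp only [Function.comp_apply, w, LinearMap.baseChange_tmul, LinearMap.comp_apply, v,
      TensorProduct.mk_apply]
    exact congr(1 ⊗ₜ $(LinearMap.congr_fun hl (K.toCotangent (a j))))
  have := Fintype.ofFinite J
  classical
  obtain ⟨g, hg⟩ := (Fintype.linearCombination p.ResidueField w).exists_leftInverse_of_injective
    (LinearMap.ker_eq_bot.mpr (linearIndependent_iff_injective_fintypeLinearCombination.mp hw))
  obtain ⟨s, hs, f, hf⟩ := exists_lift_functionals p fun i : J ↦
    ((LinearMap.proj i ∘ₗ g).restrictScalars R ∘ₗ TensorProduct.mk R p.ResidueField Ω[R⁄F] 1)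
  have hgw (j : J) : g (w j) = Pi.single j 1 := by
    have := LinearMap.congr_fun hg (Pi.single j 1)
    simpa using this
  refine ⟨n, fun j ↦ a (e.symm j), fun i ↦ (f (e.symm i)).compDer (KaehlerDifferential.D F R),
    fun j ↦ hK ▸ (a (e.symm j)).2, ⟨s, hs, fun i j ↦ ?_⟩, ?_⟩
  · rw [← hκ, map_sub, sub_eq_zero]
    refine (hf _ _).trans ?_
    change _ * g (w _) _ = _
    rw [hgw]
    by_cases h : i = j
    · simp [h]
    · simp [h]
  · have hra : Set.range (fun j : Fin n ↦ (a (e.symm j) : R)) = Set.range (fun j ↦ (a j : R)) :=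
      e.symm.surjective.range_comp fun j ↦ (a j : R)
    rw [hra]
    let N0 := Ideal.span (Set.range fun j ↦ (a j : R))
    let M := K ⧸ N0.submoduleOf K
    let τ : K →ₗ[R] p.ResidueField ⊗[R] M := TensorProduct.mk R p.ResidueField M 1 ∘ₗ Submodule.mkQ _
    -- The map factors through the cotangent space because the first factor lies in `p`, so it acts
    -- as zero on the fibre at `p`.
    have hτ (x y : K) : τ (x * y) = 0 := by
      have : x * y = (x : R) • y := rfl
      rw [this, map_smul]
      change (x : R) • (1 ⊗ₜ _) = _
      rw [TensorProduct.smul_tmul', Algebra.smul_def, (hκ x).mpr (hI (hK ▸ x.2)), zero_mul,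
        TensorProduct.zero_tmul]
    let T : p.ResidueField ⊗[R] K.Cotangent →ₗ[p.ResidueField] p.ResidueField ⊗[R] M :=
      (Ideal.Cotangent.lift τ hτ).liftBaseChange p.ResidueField
    have hTv (x : K) : T (v x) = 1 ⊗ₜ Submodule.Quotient.mk x := by
      simp only [T, v, LinearMap.liftBaseChange_tmul, Ideal.Cotangent.lift_toCotangent, one_smul]
      rfl
    have hT : T = 0 := by
      refine LinearMap.ext_on hspan ?_
      rintro _ ⟨j, rfl⟩
      simp only [Function.comp_apply, hTv, LinearMap.zero_apply]
      have : (Submodule.Quotient.mk (a j) : M) = 0 := by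
        rw [Submodule.Quotient.mk_eq_zero]
        exact Ideal.subset_span ⟨j, rfl⟩
      rw [this, TensorProduct.tmul_zero]
    have hsub : Subsingleton (p.ResidueField ⊗[R] M) := by
      refine subsingleton_of_forall_eq 0 fun y ↦ ?_
      induction y with
      | zero => rfl
      | add x y hx hy => rw [hx, hy, add_zero]
      | tmul c m =>
        obtain ⟨x, rfl⟩ := Submodule.Quotient.mk_surjective _ m
        have : c ⊗ₜ[R] (Submodule.Quotient.mk x : M) = c • T (v x) := by
          rw [hTv, TensorProduct.smul_tmul', smul_eq_mul, mul_one]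
        rw [this, hT]; simp
    -- The fibre of `K / (a)` at `p` vanishes, so the finite module has an annihilating element
    -- outside `p`.
    have hsupp : (⟨p, inferInstance⟩ : PrimeSpectrum R) ∉ Module.support R M := by
      rw [Module.mem_support_iff_nontrivial_residueField_tensorProduct]
      exact not_nontrivial_iff_subsingleton.mpr hsub
    rw [Module.mem_support_iff_of_finite] at hsupp
    obtain ⟨h, h1, h2⟩ := Set.not_subset.mp hsupp
    refine ⟨h, h2, fun x hx ↦ ?_⟩
    have := Module.mem_annihilator.mp h1 (Submodule.Quotient.mk (⟨x, hK.symm ▸ hx⟩ : K))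
    rw [← Submodule.Quotient.mk_smul, Submodule.Quotient.mk_eq_zero] at this
    exact this

section DualFamily

variable {ι : Type*} [Finite ι] [DecidableEq ι] {a : ι → R} {D : ι → Derivation F R R}
  (hD : ∀ i j, D i (a j) = if i = j then 1 else 0)

include hD

/-- The ideal of the `aᵢ` with `i ∈ s` has reduced quotient and is preserved by `D j`, while `D j (a
j) = 1`. Used repeatedly, this makes the family weakly regular in any order. -/
lemma mem_span_image_of_mul_mem [Algebra.Smooth F R] {s : Set ι} {j : ι} (hj : j ∉ s) {x : R}
    (hx : a j * x ∈ Ideal.span (a '' s)) : x ∈ Ideal.span (a '' s) := by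
  have e : a '' s = Set.range fun i : s ↦ a i := Set.image_eq_range ..
  have : IsReduced (R ⧸ Ideal.span (a '' s)) := by
    rw [e]
    exact isReduced_quotient_span (F := F) _ (fun i : s ↦ D i) fun i j ↦ by
      simp [hD, Subtype.ext_iff]
  refine mem_of_mul_mem_of_derivation (D j) ?_ (by simp [hD]) hx
  rw [e]
  refine derivation_mem_span _ _ fun i ↦ ?_
  rw [hD, if_neg]
  rintro rfl
  exact hj i.2

/-- With `J` generated by the other members, the ideal is `J + (aⱼ)` and its `k`-th power lies in `J
+ (aⱼᵏ)`. Thus `aⱼᵐ (r - c aⱼ) ∈ J` for some `c`, and `aⱼ` can be cancelled modulo `J`. -/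
lemma mem_span_range_of_pow_mul_mem [Algebra.Smooth F R] (j : ι) (m : ℕ) {r : R}
    (hr : a j ^ m * r ∈ Ideal.span (Set.range a) ^ (m + 1)) : r ∈ Ideal.span (Set.range a) := by
  let J := Ideal.span (a '' {j}ᶜ)
  have hI : Ideal.span (Set.range a) = J ⊔ Ideal.span {a j} := by
    rw [← Ideal.span_union, ← Set.image_singleton, ← Set.image_union, Set.compl_union_self,
      Set.image_univ]
  have hpow (k : ℕ) : (J ⊔ Ideal.span {a j}) ^ k ≤ J ⊔ Ideal.span {a j ^ k} := by
    induction k with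
    | zero => simp
    | succ k ih =>
      rw [pow_succ]
      refine (Ideal.mul_mono_left ih).trans ?_
      rw [Ideal.sup_mul, Ideal.mul_sup, Ideal.mul_sup, Ideal.span_singleton_mul_span_singleton,
        ← pow_succ]
      exact sup_le (le_sup_of_le_left (sup_le Ideal.mul_le_right Ideal.mul_le_left))
        (sup_le_sup Ideal.mul_le_right le_rfl)
  have h1 := hpow _ (hI ▸ hr)
  obtain ⟨y, hy, z, hz, h⟩ := Submodule.mem_sup.mp h1
  obtain ⟨c, rfl⟩ := Ideal.mem_span_singleton'.mp hz
  have key (k : ℕ) : ∀ x, a j ^ k * x ∈ J → x ∈ J := by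
    induction k with
    | zero => simp
    | succ k ih =>
      intro x hx
      refine ih x (mem_span_image_of_mul_mem hD (j := j) (by simp) ?_)
      convert hx using 1; ring
  have h2 : r - c * a j ∈ J := by
    refine key m _ ?_
    convert hy using 1
    linear_combination -h
  rw [hI, ← sub_add_cancel r (c * a j)]
  exact add_mem (Submodule.mem_sup_left h2)
    (Submodule.mem_sup_right (Ideal.mul_mem_left _ _ (Ideal.mem_span_singleton_self _)))

end DualFamily

end SmoothAlgebra
end BlowUp
namespace BlowUp

section SmoothAlgebra

open TensorProduct

variable {F R : Type u} [Field F] [CommRing R] [Algebra F R]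

/-- A derivation of `R` extends to every localization `S` of `R`. -/
lemma exists_derivation_extension (M : Submonoid R) (S : Type u) [CommRing S] [Algebra R S]
    [IsLocalization M S] [Algebra F S] [IsScalarTower F R S] (D : Derivation F R R) :
    ∃ E : Derivation F S S, ∀ r, E (algebraMap R S r) = algebraMap R S (D r) := by
  have := Algebra.FormallyEtale.of_isLocalization (Rₘ := S) M
  let hb := KaehlerDifferential.isBaseChange_of_formallyEtale F R S
  refine ⟨(hb.lift (Algebra.linearMap R S ∘ₗ D.liftKaehlerDifferential)).compDer
    (KaehlerDifferential.D F S), fun r ↦ ?_⟩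
  have := hb.lift_eq (Algebra.linearMap R S ∘ₗ D.liftKaehlerDifferential)
    (KaehlerDifferential.D F R r)
  simpa using this

/-- The local algebraic properties of a pair `I ⊆ R` corresponding to a smooth closed subscheme of
codimension at least two, used for the blow-up along `I`: there is a regular sequence `a, b` in `I`
and, unless `I` is trivial, a derivation `δ` of `R` with `δ a = 0` and `δ b = 1` modulo `I`, and
`a` is a nonzerodivisor of degree one of the associated graded ring in the given weak sense. -/
def HasRegularPair (F : Type u) {R : Type u} [Field F] [CommRing R] [Algebra F R] (I : Ideal R) :
    Prop :=
  ∃ a ∈ I, ∃ b ∈ I, (∀ x, a * x = 0 → x = 0) ∧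
    (∀ x, b * x ∈ Ideal.span {a} → x ∈ Ideal.span {a}) ∧
    (I = ⊤ ∨ ((∀ m r, a ^ m * r ∈ I ^ (m + 1) → r ∈ I) ∧
      ∃ δ : Derivation F R R, δ a ∈ I ∧ δ b - 1 ∈ I))

lemma hasRegularPair_top : HasRegularPair F (⊤ : Ideal R) :=
  ⟨1, trivial, 1, trivial, by simp, by simp, .inl rfl⟩

lemma hasRegularPair_of_dual_family [Algebra.Smooth F R] {n : ℕ} (hn : 2 ≤ n) {a : Fin n → R}
    {D : Fin n → Derivation F R R} (hD : ∀ i j, D i (a j) = if i = j then 1 else 0) :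
    HasRegularPair F (Ideal.span (Set.range a)) := by
  obtain ⟨n, rfl⟩ := Nat.exists_eq_add_of_le' hn
  refine ⟨a 0, Ideal.subset_span ⟨_, rfl⟩, a 1, Ideal.subset_span ⟨_, rfl⟩, fun x hx ↦ ?_,
    fun x hx ↦ ?_, .inr ⟨fun m r ↦ mem_span_range_of_pow_mul_mem hD 0 m, D 1, ?_, ?_⟩⟩
  · have := mem_span_image_of_mul_mem hD (s := ∅) (j := 0) (by simp) (x := x)
    simpa using this (by simpa using hx)
  · have := mem_span_image_of_mul_mem hD (s := {0}) (j := 1) (by simp) (x := x)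
    simpa using this (by simpa using hx)
  · simp [hD]
  · simp [hD]

/-- Near `p` either `I` is the unit ideal, or it is generated by a family dual to derivations, whose
size is at least two by Krull's height theorem. -/
lemma exists_hasRegularPair [Algebra.Smooth F R] (I : Ideal R) [Algebra.FormallySmooth F (R ⧸ I)]
    (p : Ideal R) [p.IsPrime] (hI : ∀ q ∈ I.minimalPrimes, q ≤ p → 2 ≤ q.height) :
    ∃ h ∉ p, ∀ (S : Type u) [CommRing S] [Algebra R S] [IsLocalization.Away h S] [Algebra F S]
      [IsScalarTower F R S], HasRegularPair F (I.map (algebraMap R S)) := by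
  have : IsNoetherianRing R := Algebra.FiniteType.isNoetherianRing F R
  classical
  by_cases hIp : I ≤ p
  swap
  · obtain ⟨h, h1, h2⟩ := Set.not_subset.mp hIp
    refine ⟨h, h2, fun S _ _ _ _ _ ↦ ?_⟩
    rw [Ideal.eq_top_of_isUnit_mem _ (Ideal.mem_map_of_mem _ h1)
      (IsLocalization.Away.algebraMap_isUnit h)]
    exact hasRegularPair_top
  obtain ⟨n, a, D, haI, ⟨s, hs, hsD⟩, h, hhp, hh⟩ := exists_dual_family (F := F) I p hIp
  have hn : 2 ≤ n := by
    obtain ⟨q, hq, hqp⟩ := Ideal.exists_minimalPrimes_le hIp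
    -- A prime containing the `aⱼ` and contained in `q ≤ p` avoids `h`, hence contains `I`; so `q`
    -- is also minimal over the `n` elements `aⱼ`.
    have hqa : q ∈ (Ideal.span (Set.range a)).minimalPrimes := by
      refine ⟨⟨hq.1.1, Ideal.span_le.mpr ?_⟩, fun q' hq' hle ↦ hq.2 ⟨hq'.1, fun x hx ↦ ?_⟩ hle⟩
      · rintro _ ⟨j, rfl⟩
        exact hq.1.2 (haI j)
      · exact (hq'.1.mem_or_mem (hq'.2 (hh x hx))).resolve_left fun h' ↦ hhp (hqp (hle h'))
    have h1 := Ideal.height_le_card_of_mem_minimalPrimes_span_finset (p := q)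
      (s := Finset.univ.image a) (by simpa using hqa)
    have h2 := (hI q hq hqp).trans h1
    have h3 : (Finset.univ.image a).card ≤ n := by
      simpa using Finset.card_image_le (s := Finset.univ) (f := a)
    exact (Nat.cast_le.mp h2 : 2 ≤ _).trans h3
  let N : Matrix (Fin n) (Fin n) R := Matrix.of fun i j ↦ D i (a j)
  -- Modulo `p` the Jacobian matrix is `s` times the identity, so its determinant is `s ^ n`.
  have hdet : N.det ∉ p := by
    intro hdet
    rw [← Ideal.Quotient.eq_zero_iff_mem, RingHom.map_det] at hdet
    have : (Ideal.Quotient.mk p).mapMatrix N = (Ideal.Quotient.mk p s) • (1 : Matrix _ _ _) := by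
      ext i j
      have := hsD i j
      rw [← Ideal.Quotient.mk_eq_mk_iff_sub_mem] at this
      simp only [N, RingHom.mapMatrix_apply, Matrix.map_apply, Matrix.of_apply, this,
        Matrix.smul_apply, Matrix.one_apply, smul_eq_mul, mul_ite, mul_one, mul_zero]
      split_ifs <;> simp
    rw [this, Matrix.det_smul, Matrix.det_one, mul_one] at hdet
    exact hs (Ideal.Quotient.eq_zero_iff_mem.mp (eq_zero_of_pow_eq_zero hdet))
  refine ⟨h * N.det, fun h' ↦ (‹p.IsPrime›.mem_or_mem h').elim hhp hdet, fun S _ _ _ _ _ ↦ ?_⟩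
  have hu : IsUnit (algebraMap R S h * algebraMap R S N.det) := by
    rw [← map_mul]
    exact IsLocalization.Away.algebraMap_isUnit _
  have hu1 := isUnit_of_mul_isUnit_left hu
  have hu2 := isUnit_of_mul_isUnit_right hu
  choose E hE using fun i ↦ exists_derivation_extension (Submonoid.powers (h * N.det)) S (D i)
  let N' : Matrix (Fin n) (Fin n) S := (algebraMap R S).mapMatrix N
  have hN' : N'⁻¹ * N' = 1 := Matrix.nonsing_inv_mul _ (by
    rw [← RingHom.map_det]; exact hu2)
  have : Algebra.Smooth R S := Algebra.Smooth.of_isLocalization_Away (h * N.det)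
  have : Algebra.Smooth F S := .comp F R S
  -- The inverse Jacobian matrix turns the extended derivations into an exactly dual family.
  have key := hasRegularPair_of_dual_family (F := F) hn (a := fun j ↦ algebraMap R S (a j))
    (D := fun i ↦ ∑ k, N'⁻¹ i k • E k) fun i j ↦ by
      have := congr_fun₂ hN' i j
      rw [Matrix.mul_apply, Matrix.one_apply] at this
      rw [← this]
      have e : (∑ k, N'⁻¹ i k • E k) (algebraMap R S (a j)) =
          ∑ k, (N'⁻¹ i k • E k) (algebraMap R S (a j)) :=
        (congrFun (map_sum (Derivation.coeFnAddMonoidHom : Derivation F S S →+ S → S) _ _) _).trans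
          (Finset.sum_apply ..)
      rw [e]
      simp [hE, N', N]
  convert key using 1
  apply le_antisymm
  · rw [Ideal.map_le_iff_le_comap]
    intro x hx
    have h1 := Ideal.mem_map_of_mem (algebraMap R S) (hh x hx)
    rw [Ideal.map_span, ← Set.range_comp, map_mul, Ideal.unit_mul_mem_iff_mem _ hu1] at h1
    exact h1
  · rw [Ideal.span_le]
    rintro _ ⟨j, rfl⟩
    exact Ideal.mem_map_of_mem _ (haI j)

end SmoothAlgebra
end BlowUp
namespace BlowUp

/-! ### The affine blow-up algebra `R[I/a]`, its universal property and its derivations -/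

section AffineChart

variable {R S : Type u} [CommRing R] [CommRing S]

/-- `f : R → S` identifies `S` with the affine blow-up algebra `R[I/a]`. -/
structure IsAffineChart (f : R →+* S) (I : Ideal R) (a : R) : Prop where
  mem : a ∈ I
  eq_zero : ∀ s, f a * s = 0 → s = 0
  dvd : ∀ b ∈ I, f a ∣ f b
  closure : Subring.closure (Set.range f ∪ {s | ∃ b ∈ I, f a * s = f b}) = ⊤
  ker : ∀ r, f r = 0 → ∃ k : ℕ, a ^ k * r = 0

namespace IsAffineChart

variable {f : R →+* S} {I : Ideal R} {a : R}

lemma induction (h : IsAffineChart f I a) {P : S → Prop} (h1 : ∀ r, P (f r))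
    (h2 : ∀ s, ∀ b ∈ I, f a * s = f b → P s) (hadd : ∀ s t, P s → P t → P (s + t))
    (hmul : ∀ s t, P s → P t → P (s * t)) (s : S) : P s := by
  have hs : s ∈ Subring.closure (Set.range f ∪ {s | ∃ b ∈ I, f a * s = f b}) := by
    rw [h.closure]; trivial
  induction hs using Subring.closure_induction with
  | mem x hx =>
    obtain ⟨r, rfl⟩ | ⟨b, hb, hx⟩ := hx
    · exact h1 r
    · exact h2 x b hb hx
  | zero => simpa using h1 0
  | one => simpa using h1 1
  | add x y _ _ hx hy => exact hadd _ _ hx hy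
  | mul x y _ _ hx hy => exact hmul _ _ hx hy
  | neg x _ hx => simpa using hmul _ _ (h1 (-1)) hx

lemma cancel (h : IsAffineChart f I a) (k : ℕ) {s t : S} (e : f a ^ k * s = f a ^ k * t) :
    s = t := by
  induction k with
  | zero => simpa using e
  | succ k ih =>
    refine ih (sub_eq_zero.mp (h.eq_zero _ ?_))
    linear_combination e

lemma exists_pow_mul_eq (h : IsAffineChart f I a) (s : S) :
    ∃ n : ℕ, ∃ x ∈ I ^ n, f a ^ n * s = f x := by
  induction s using h.induction with
  | h1 r => exact ⟨0, r, by simp, by simp⟩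
  | h2 s b hb e => exact ⟨1, b, by simpa, by simpa⟩
  | hadd s t hs ht =>
    obtain ⟨n, x, hx, hs⟩ := hs
    obtain ⟨m, y, hy, ht⟩ := ht
    refine ⟨n + m, a ^ m * x + a ^ n * y, add_mem ?_ ?_, ?_⟩
    · rw [pow_add, mul_comm (I ^ n)]; exact Ideal.mul_mem_mul (Ideal.pow_mem_pow h.mem _) hx
    · rw [pow_add]; exact Ideal.mul_mem_mul (Ideal.pow_mem_pow h.mem _) hy
    · simp only [map_add, map_mul, map_pow, ← hs, ← ht]; ring
  | hmul s t hs ht =>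
    obtain ⟨n, x, hx, hs⟩ := hs
    obtain ⟨m, y, hy, ht⟩ := ht
    refine ⟨n + m, x * y, pow_add I n m ▸ Ideal.mul_mem_mul hx hy, ?_⟩
    rw [map_mul, ← hs, ← ht]; ring

lemma ringHom_ext (h : IsAffineChart f I a) {C : Type*} [CommRing C] {ψ ψ' : S →+* C}
    (e : ψ.comp f = ψ'.comp f) (ha : ∀ c, ψ (f a) * c = 0 → c = 0) : ψ = ψ' := by
  have e' (r : R) : ψ (f r) = ψ' (f r) := RingHom.congr_fun e r
  ext s
  induction s using h.induction with
  | h1 r => exact e' r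
  | h2 s b hb hs =>
    refine sub_eq_zero.mp (ha _ ?_)
    rw [mul_sub, ← map_mul, e', ← map_mul, hs, e', sub_self]
  | hadd s t hs ht => rw [map_add, hs, ht, map_add]
  | hmul s t hs ht => rw [map_mul, hs, ht, map_mul]

/-- Every element of `S` is of the form `x / aⁿ` with `x` from `R`, so inverting `a` makes `S` and
`R` agree. -/
lemma isLocalization (h : IsAffineChart f I a) (L : Type u) [CommRing L] [Algebra S L]
    [IsLocalization.Away (f a) L] :
    letI := ((algebraMap S L).comp f).toAlgebra
    IsLocalization.Away a L := by
  let := ((algebraMap S L).comp f).toAlgebra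
  have hal (r : R) : algebraMap R L r = algebraMap S L (f r) := rfl
  have hinj (s t : S) (e : algebraMap S L s = algebraMap S L t) : s = t := by
    obtain ⟨⟨_, k, rfl⟩, hk⟩ := (IsLocalization.eq_iff_exists (Submonoid.powers (f a)) L).mp e
    exact h.cancel k hk
  refine (isLocalization_iff _ _).mpr ⟨?_, ?_, ?_⟩
  · rintro ⟨_, k, rfl⟩
    simp only [map_pow, hal]
    exact (IsLocalization.Away.algebraMap_isUnit (f a)).pow k
  · intro z
    obtain ⟨⟨s, ⟨_, k, rfl⟩⟩, hz⟩ := IsLocalization.surj (Submonoid.powers (f a)) z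
    obtain ⟨n, x, -, hx⟩ := h.exists_pow_mul_eq s
    refine ⟨⟨x, ⟨_, k + n, rfl⟩⟩, ?_⟩
    simp only [hal, ← hx, map_mul, map_pow] at hz ⊢
    rw [← hz]; ring
  · intro x y e
    obtain ⟨k, hk⟩ := h.ker (x - y) (by
      rw [map_sub, sub_eq_zero]; exact hinj _ _ e)
    exact ⟨⟨_, k, rfl⟩, by linear_combination hk⟩

/-- Universal property of `R[I/a]`: the map from `S` through `R[1/a]` to `C[1/φ(a)]` sends the
generators `f r` and `b / a` into `C`, which is a subring because `φ a` is a nonzerodivisor. -/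
lemma exists_lift (h : IsAffineChart f I a) {C : Type u} [CommRing C] (φ : R →+* C)
    (ha : ∀ c, φ a * c = 0 → c = 0) (hI : ∀ b ∈ I, φ a ∣ φ b) :
    ∃ ψ : S →+* C, ψ.comp f = φ := by
  let L := Localization.Away (φ a)
  have hu : IsUnit (algebraMap C L (φ a)) := IsLocalization.Away.algebraMap_isUnit (φ a)
  have hinj : Function.Injective (algebraMap C L) := by
    refine IsLocalization.injective _ (M := Submonoid.powers (φ a)) ?_
    rintro _ ⟨k, rfl⟩
    exact pow_mem (mem_nonZeroDivisors_iff_right.mpr fun c hc ↦ ha c (by rwa [mul_comm])) k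
  let Sa := Localization.Away (f a)
  let := ((algebraMap S Sa).comp f).toAlgebra
  have := h.isLocalization Sa
  let χ : Sa →+* L := IsLocalization.Away.lift a (g := (algebraMap C L).comp φ) hu
  let ψ₀ : S →+* L := χ.comp (algebraMap S Sa)
  have hψ₀ (r : R) : ψ₀ (f r) = algebraMap C L (φ r) := IsLocalization.Away.lift_eq a hu r
  have hr (s : S) : ψ₀ s ∈ (algebraMap C L).range := by
    induction s using h.induction with
    | h1 r => exact ⟨_, (hψ₀ r).symm⟩
    | h2 s b hb hs =>
      obtain ⟨c, hc⟩ := hI b hb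
      refine ⟨c, hu.mul_left_cancel ?_⟩
      rw [← map_mul, ← hc, ← hψ₀, ← hψ₀, ← map_mul, hs]
    | hadd s t hs ht => rw [map_add]; exact add_mem hs ht
    | hmul s t hs ht => rw [map_mul]; exact mul_mem hs ht
  let e := RingEquiv.ofBijective (algebraMap C L).rangeRestrict
    ⟨fun x y hxy ↦ hinj (congrArg Subtype.val hxy), (algebraMap C L).rangeRestrict_surjective⟩
  refine ⟨e.symm.toRingHom.comp (ψ₀.codRestrict _ hr), RingHom.ext fun r ↦ ?_⟩
  refine e.injective ((e.apply_symm_apply _).trans (Subtype.ext ?_))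
  exact hψ₀ r

/-- The derivation `a δ` of `R[1/a]` preserves `R[I/a]`, since `a δ(b/a) = δ b - (b/a) δ a`. It is
obtained by extending the homomorphism `r ↦ r + a δ(r) ε` into the dual numbers over `S`. -/
lemma exists_derivation (h : IsAffineChart f I a) {k : Type*} [CommRing k] [Algebra k R]
    (δ : Derivation k R R) : ∃ E : S → S, (∀ s t, E (s + t) = E s + E t) ∧
      (∀ s t, E (s * t) = s * E t + t * E s) ∧ ∀ r, E (f r) = f a * f (δ r) := by
  let φ : R →+* TrivSqZeroExt S S :=
    { toFun r := (f r, f a * f (δ r))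
      map_one' := TrivSqZeroExt.ext (map_one f) (by
        simp only [Derivation.map_one_eq_zero, map_zero, mul_zero]; rfl)
      map_zero' := TrivSqZeroExt.ext (map_zero f) (by simp only [map_zero, mul_zero]; rfl)
      map_add' x y := TrivSqZeroExt.ext (map_add f x y) (by
        simp only [map_add, mul_add]; rfl)
      map_mul' x y := TrivSqZeroExt.ext (map_mul f x y) (by
        change f a * f (δ (x * y)) = f x * (f a * f (δ y)) + f a * f (δ x) * f y
        simp only [Derivation.leibniz, smul_eq_mul, map_add, map_mul]
        ring) }
  have h1 (r : R) : (φ r).fst = f r := rfl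
  have h2 (r : R) : (φ r).snd = f a * f (δ r) := rfl
  have hsnd (x y : TrivSqZeroExt S S) : (x * y).snd = x.fst * y.snd + y.fst * x.snd := by
    rw [TrivSqZeroExt.snd_mul, op_smul_eq_smul]; rfl
  obtain ⟨ψ, hψ⟩ := h.exists_lift φ (fun c hc ↦ by
    have e1 := congrArg TrivSqZeroExt.fst hc
    have e2 := congrArg TrivSqZeroExt.snd hc
    rw [TrivSqZeroExt.fst_mul, h1, TrivSqZeroExt.fst_zero] at e1
    have e3 := h.eq_zero _ e1
    rw [hsnd, h1, e3, zero_mul, add_zero, TrivSqZeroExt.snd_zero] at e2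
    exact TrivSqZeroExt.ext e3 (h.eq_zero _ e2)) (fun b hb ↦ by
    obtain ⟨s, hs⟩ := h.dvd b hb
    -- The quotient of `φ b` by `φ a`, with `ε`-part given by the quotient rule.
    let c : TrivSqZeroExt S S := (s, f (δ b) - s * f (δ a))
    have hc1 : c.fst = s := rfl
    have hc2 : c.snd = f (δ b) - s * f (δ a) := rfl
    refine ⟨c, TrivSqZeroExt.ext ?_ ?_⟩
    · rw [TrivSqZeroExt.fst_mul, h1, h1, hs, hc1]
    · rw [hsnd, h2, h2, h1, hc1, hc2]; ring)
  have hψr (r : R) : ψ (f r) = φ r := RingHom.congr_fun hψ r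
  -- By uniqueness the extension is a section of the projection to `S`, so its `ε`-part is a
  -- derivation.
  have hid : (TrivSqZeroExt.fstHom S S S).toRingHom.comp ψ = RingHom.id S := by
    refine h.ringHom_ext (RingHom.ext fun r ↦ ?_) ?_
    · exact (congrArg TrivSqZeroExt.fst (hψr r)).trans (h1 r)
    · intro c hc
      refine h.eq_zero c ?_
      rwa [show ((TrivSqZeroExt.fstHom S S S).toRingHom.comp ψ) (f a) = f a from
        (congrArg TrivSqZeroExt.fst (hψr a)).trans (h1 a)] at hc
  have hfst (s : S) : (ψ s).fst = s := RingHom.congr_fun hid s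
  refine ⟨fun s ↦ (ψ s).snd, fun s t ↦ ?_, fun s t ↦ ?_, fun r ↦ ?_⟩
  · exact (congrArg TrivSqZeroExt.snd (map_add ψ s t)).trans (TrivSqZeroExt.snd_add _ _)
  · refine (congrArg TrivSqZeroExt.snd (map_mul ψ s t)).trans ?_
    rw [hsnd, hfst, hfst]
  · exact (congrArg TrivSqZeroExt.snd (hψr r)).trans (h2 r)

/-- Geometrically, `E = a δ` is a vector field vertical along the exceptional divisor, and it moves
the fibre coordinate `t = b / a` with speed one there. If `σ a` were not divisible by `a`, the
functions in the image of `g` could not include `t`. -/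
lemma map_mem_of_derivation (h : IsAffineChart f I a) {k : Type*} [CommRing k] [Algebra k R]
    (δ : Derivation k R R) (ha : δ a ∈ I) {b : R} (hb : b ∈ I) (hδ : δ b - 1 ∈ I)
    (H : ∀ r, f a ∣ f r → r ∈ I) (g : S →+* S) (hg : Function.Surjective g) (σ : R →+* R)
    (hσ : ∀ r, g (f r) = f (σ r)) {x : R} (hx : x ∈ I) : σ x ∈ I := by
  obtain ⟨E, hE1, hE2, hE3⟩ := h.exists_derivation δ
  -- For `s = c / a`, apply `E` to `g(a) g(s) = σ c`: derivatives of elements of `R` are divisible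
  -- by `a`, and so the remaining term `g(a) E(g s)` is as well.
  have key (s : S) : f a ∣ g (f a) * E (g s) := by
    induction s using h.induction with
    | h1 r => rw [hσ r, hE3]; exact (dvd_mul_right _ _).mul_left _
    | h2 s c hc e =>
      have e1 : E (g (f a) * g s) = E (f (σ c)) := by rw [← map_mul, e, hσ]
      rw [hE2, hσ a, hE3, hE3] at e1
      rw [hσ a, eq_sub_of_add_eq e1]
      exact dvd_sub (dvd_mul_right _ _) ((dvd_mul_right _ _).mul_left _)
    | hadd s t hs ht => rw [map_add, hE1, mul_add]; exact dvd_add hs ht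
    | hmul s t hs ht =>
      rw [map_mul, hE2, mul_add, mul_left_comm, mul_left_comm _ (g t)]
      exact dvd_add (ht.mul_left _) (hs.mul_left _)
  obtain ⟨t, ht⟩ := h.dvd b hb
  have hEt : E t = f (δ b) - t * f (δ a) := by
    have e1 : E (f a * t) = E (f b) := by rw [ht]
    rw [hE2, hE3, hE3] at e1
    refine sub_eq_zero.mp (h.eq_zero _ ?_)
    linear_combination e1
  obtain ⟨w, hw⟩ := h.dvd _ ha
  obtain ⟨w', hw'⟩ := h.dvd _ hδ
  rw [map_sub, map_one] at hw'
  -- Choose `s` with `g s = t`. Then `E t = δ b - t δ a` is `1` modulo `a`, so `key` reads `a ∣ σ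
  -- a`.
  have h1 : f a ∣ f (σ a) := by
    obtain ⟨s, rfl⟩ := hg t
    have h2 := key s
    rw [hEt, hσ a] at h2
    have h3 : f (σ a) = f (σ a) * (f (δ b) - g s * f (δ a)) +
        f a * (f (σ a) * g s * w - f (σ a) * w') := by
      rw [hw, sub_eq_iff_eq_add.mp hw']; ring
    rw [h3]
    exact dvd_add h2 (dvd_mul_right _ _)
  obtain ⟨y, hy⟩ := h.dvd x hx
  refine H _ ?_
  rw [← hσ, hy, map_mul, hσ]
  exact h1.mul_right _

/-- Writing the quotient as `x / aⁿ` with `x ∈ Iⁿ` gives `aⁿ r = x a ∈ Iⁿ⁺¹`, to which `H` applies.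
-/
lemma mem_of_dvd (h : IsAffineChart f I a) (hf : Function.Injective f)
    (H : ∀ m r, a ^ m * r ∈ I ^ (m + 1) → r ∈ I) {r : R} (hr : f a ∣ f r) : r ∈ I := by
  obtain ⟨s, hs⟩ := hr
  obtain ⟨n, x, hx, e⟩ := h.exists_pow_mul_eq s
  refine H n r ?_
  have : a ^ n * r = x * a := hf (by
    simp only [map_mul, map_pow, hs, ← e]; ring)
  rw [this, pow_succ]
  exact Ideal.mul_mem_mul hx h.mem

end IsAffineChart

end AffineChart

/-! ### Tensoring affine charts with an algebra over the ground field -/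

section BaseChange

open TensorProduct

variable {F R S : Type u} [Field F] [CommRing R] [CommRing S] [Algebra F R] [Algebra F S]
  (f : R →ₐ[F] S) {I : Ideal R} {a : R} (C : Type u) [CommRing C] [Algebra F C]

/-- `C` is flat over the field `F`, so nonzerodivisors and the injectivity of `f` persist; the
latter settles `ker` with exponent zero. -/
lemma IsAffineChart.baseChange (h : IsAffineChart f.toRingHom I a) (hf : Function.Injective f) :
    IsAffineChart (Algebra.TensorProduct.map f (AlgHom.id F C)).toRingHom
      (I.map (Algebra.TensorProduct.includeLeftRingHom : R →+* R ⊗[F] C)) (a ⊗ₜ 1) where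
  mem := Ideal.mem_map_of_mem _ h.mem
  eq_zero s hs := by
    have hinj : Function.Injective (LinearMap.mulLeft F (f a)) := by
      rw [injective_iff_map_eq_zero]
      exact fun s hs ↦ h.eq_zero s hs
    have h2 := Module.Flat.rTensor_preserves_injective_linearMap (M := C) _ hinj
    refine (injective_iff_map_eq_zero _).mp h2 s (Eq.trans ?_ hs)
    have : (LinearMap.mulLeft F (f a)).rTensor C = LinearMap.mulLeft F (f a ⊗ₜ[F] (1 : C)) := by
      ext; simp
    rw [this]; simp
  dvd b hb := by
    rw [← Ideal.mem_span_singleton, ← Ideal.mem_comap]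
    revert b
    change _ ≤ Ideal.comap _ _
    rw [Ideal.map_le_iff_le_comap]
    intro b hb
    obtain ⟨c, hc⟩ := h.dvd b hb
    rw [Ideal.mem_comap, Ideal.mem_comap, Ideal.mem_span_singleton]
    refine ⟨c ⊗ₜ 1, ?_⟩
    change f b = f a * c at hc
    simp [hc]
  closure := by
    rw [eq_top_iff]
    rintro z -
    induction z with
    | zero => exact zero_mem _
    | add x y hx hy => exact add_mem hx hy
    | tmul s c =>
      have h1 : s ⊗ₜ[F] c = s ⊗ₜ 1 * 1 ⊗ₜ c := by simp
      rw [h1]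
      refine mul_mem ?_ (Subring.subset_closure (.inl ⟨1 ⊗ₜ c, by simp⟩))
      induction s using h.induction with
      | h1 r => exact Subring.subset_closure (.inl ⟨r ⊗ₜ 1, by simp⟩)
      | h2 s b hb hs =>
        refine Subring.subset_closure (.inr ⟨b ⊗ₜ 1, Ideal.mem_map_of_mem _ hb, ?_⟩)
        change f a * s = f b at hs
        simp [← hs]
      | hadd s t hs ht => rw [TensorProduct.add_tmul]; exact add_mem (hs (by simp)) (ht (by simp))
      | hmul s t hs ht =>
        have : (s * t) ⊗ₜ[F] (1 : C) = s ⊗ₜ 1 * t ⊗ₜ 1 := by simp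
        rw [this]; exact mul_mem (hs (by simp)) (ht (by simp))
  ker r hr := by
    refine ⟨0, ?_⟩
    have h2 := Module.Flat.rTensor_preserves_injective_linearMap (M := C) f.toLinearMap hf
    have : r = 0 := (injective_iff_map_eq_zero _).mp h2 r hr
    simp [this]

/-- The base change of a derivation. -/
def baseChangeDerivation (δ : Derivation F R R) : Derivation F (R ⊗[F] C) (R ⊗[F] C) :=
  .mk' (δ.toLinearMap.rTensor C) fun x y ↦ by
    induction x with
    | zero => simp
    | add x x' hx hx' =>
      simp only [add_mul, map_add, hx, hx', smul_eq_mul, mul_add]; ring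
    | tmul r c =>
      induction y with
      | zero => simp
      | add y y' hy hy' =>
        simp only [mul_add, map_add, hy, hy', smul_eq_mul, add_mul]; ring
      | tmul r' c' =>
        simp [TensorProduct.add_tmul, mul_comm c c']

@[simp] lemma baseChangeDerivation_tmul (δ : Derivation F R R) (r : R) (c : C) :
    baseChangeDerivation C δ (r ⊗ₜ c) = δ r ⊗ₜ c := rfl

/-- The hypotheses say that `R ⧸ I → S ⧸ (a)` is well defined and injective; it stays injective
after tensoring with `C` over `F`. -/
lemma mem_map_of_dvd_baseChange (H : ∀ r, f a ∣ f r → r ∈ I) (hfI : ∀ b ∈ I, f a ∣ f b)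
    {z : R ⊗[F] C} (hz : f a ⊗ₜ 1 ∣ Algebra.TensorProduct.map f (AlgHom.id F C) z) :
    z ∈ I.map (Algebra.TensorProduct.includeLeftRingHom : R →+* R ⊗[F] C) := by
  let J := Ideal.span {f a}
  let θ : (R ⧸ I) →ₐ[F] (S ⧸ J) := Ideal.Quotient.liftₐ I ((Ideal.Quotient.mkₐ F J).comp f)
    fun b hb ↦ by
      rw [AlgHom.comp_apply, Ideal.Quotient.mkₐ_eq_mk, Ideal.Quotient.eq_zero_iff_mem,
        Ideal.mem_span_singleton]
      exact hfI b hb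
  have hθ : Function.Injective θ := by
    rw [injective_iff_map_eq_zero]
    intro r hr
    obtain ⟨r, rfl⟩ := Ideal.Quotient.mk_surjective r
    rw [Ideal.Quotient.eq_zero_iff_mem]
    refine H r ?_
    rw [← Ideal.mem_span_singleton]
    exact Ideal.Quotient.eq_zero_iff_mem.mp hr
  have h2 : Function.Injective (Algebra.TensorProduct.map θ (AlgHom.id F C)) :=
    Module.Flat.rTensor_preserves_injective_linearMap (M := C) θ.toLinearMap hθ
  have h3 : (Algebra.TensorProduct.map θ (AlgHom.id F C)).comp
      (Algebra.TensorProduct.map (Ideal.Quotient.mkₐ F I) (AlgHom.id F C)) =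
      (Algebra.TensorProduct.map (Ideal.Quotient.mkₐ F J) (AlgHom.id F C)).comp
      (Algebra.TensorProduct.map f (AlgHom.id F C)) := by
    apply Algebra.TensorProduct.ext'
    intro r c
    rfl
  have h4 : Algebra.TensorProduct.map (Ideal.Quotient.mkₐ F I) (AlgHom.id F C) z = 0 := by
    refine (injective_iff_map_eq_zero _).mp h2 _ ((AlgHom.congr_fun h3 z).trans ?_)
    obtain ⟨w, hw⟩ := hz
    rw [AlgHom.comp_apply, hw, map_mul, Algebra.TensorProduct.map_tmul,
      Ideal.Quotient.mkₐ_eq_mk, Ideal.Quotient.eq_zero_iff_mem.mpr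
        (Ideal.mem_span_singleton_self (f a)), TensorProduct.zero_tmul, zero_mul]
  let q : R →ₐ[F] R ⧸ I := Ideal.Quotient.mkₐ F I
  have h5 := Algebra.TensorProduct.rTensor_ker (R := F) (S := F) (C := C) q Ideal.Quotient.mk_surjective
  have h6 : z ∈ RingHom.ker (Algebra.TensorProduct.map q (AlgHom.id F C)) := h4
  rw [h5] at h6
  have h7 : RingHom.ker q = I := Ideal.mk_ker
  rw [h7] at h6
  exact h6

end BaseChange

/-! ### Degree-zero localizations of the Rees algebra as affine charts -/

section Rees

open HomogeneousLocalization

variable {R : Type u} [CommRing R] {I : Ideal R} {a : R} (ha : a ∈ I)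

/-- The element `a t` of the Rees algebra. -/
abbrev reesVar (I : Ideal R) (a : R) (ha : a ∈ I) : reesAlgebra I :=
  reesMonomial I 1 a (by simpa using ha)

lemma reesVar_mem : reesVar I a ha ∈ reesGrading I 1 := reesMonomial_mem _ _ _

/-- `R → R[I/a]`. -/
def chartMap : R →+* Away (reesGrading I) (reesVar I a ha) :=
  (fromZeroRingHom (reesGrading I) (Submonoid.powers _)).comp (algebraMap R (reesGrading I 0))

/-- The element `x / aⁿ` of `R[I/a]`, for `x ∈ Iⁿ`. -/
def chartElem (n : ℕ) (x : R) (hx : x ∈ I ^ n) : Away (reesGrading I) (reesVar I a ha) :=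
  Away.mk (reesGrading I) (reesVar_mem ha) n (reesMonomial I n x hx)
    (by simpa using reesMonomial_mem n x hx)

lemma reesMonomial_mul (n m : ℕ) (x y : R) (hx : x ∈ I ^ n) (hy : y ∈ I ^ m) :
    reesMonomial I n x hx * reesMonomial I m y hy =
      reesMonomial I (n + m) (x * y) (pow_add I n m ▸ Ideal.mul_mem_mul hx hy) := by
  apply Subtype.ext
  simp [reesMonomial, Polynomial.monomial_mul_monomial]

lemma reesVar_pow (n : ℕ) : reesVar I a ha ^ n =
    reesMonomial I n (a ^ n) (Ideal.pow_mem_pow ha n) := by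
  apply Subtype.ext
  simp [reesMonomial, Polynomial.monomial_pow]

lemma val_chartElem (n : ℕ) (x : R) (hx : x ∈ I ^ n) :
    (chartElem ha n x hx).val =
      Localization.mk (reesMonomial I n x hx) (⟨reesVar I a ha ^ n, ⟨n, rfl⟩⟩ : Submonoid.powers _) :=
  Away.val_mk ..

lemma chartMap_eq (r : R) : chartMap ha r = chartElem ha 0 r (by simp) := by
  apply val_injective
  rw [val_chartElem]
  change Localization.mk _ _ = _
  congr 1

lemma chartElem_mul (n m : ℕ) (x y : R) (hx : x ∈ I ^ n) (hy : y ∈ I ^ m) :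
    chartElem ha n x hx * chartElem ha m y hy =
      chartElem ha (n + m) (x * y) (pow_add I n m ▸ Ideal.mul_mem_mul hx hy) := by
  apply val_injective
  rw [val_mul, val_chartElem, val_chartElem, val_chartElem, Localization.mk_mul,
    reesMonomial_mul]
  congr 1
  exact Subtype.ext (pow_add _ _ _).symm

lemma chartElem_add (n : ℕ) (x y : R) (hx : x ∈ I ^ n) (hy : y ∈ I ^ n) :
    chartElem ha n (x + y) (add_mem hx hy) = chartElem ha n x hx + chartElem ha n y hy := by
  apply val_injective
  have : reesMonomial I n (x + y) (add_mem hx hy) = reesMonomial I n x hx + reesMonomial I n y hy :=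
    Subtype.ext (by simp [reesMonomial])
  rw [val_add, val_chartElem, val_chartElem, val_chartElem, this, Localization.add_mk_self]

lemma chartElem_eq_iff (n m : ℕ) (x y : R) (hx : x ∈ I ^ n) (hy : y ∈ I ^ m) :
    chartElem ha n x hx = chartElem ha m y hy ↔
      ∃ k : ℕ, a ^ k * (a ^ m * x) = a ^ k * (a ^ n * y) := by
  rw [← (val_injective _).eq_iff, val_chartElem, val_chartElem, Localization.mk_eq_mk_iff,
    Localization.r_iff_exists]
  simp only [reesVar_pow, reesMonomial_mul]
  constructor
  · rintro ⟨⟨_, k, rfl⟩, hk⟩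
    refine ⟨k, ?_⟩
    simp only [reesVar_pow, reesMonomial_mul] at hk
    have := congr(((($hk : reesAlgebra I) : Polynomial R)).coeff (k + (m + n)))
    simpa [reesMonomial, Polynomial.coeff_monomial, add_comm n m] using this
  · rintro ⟨k, hk⟩
    refine ⟨⟨_, k, rfl⟩, ?_⟩
    simp only [reesVar_pow, reesMonomial_mul]
    apply Subtype.ext
    simp [reesMonomial, hk, add_comm n m]

lemma chartElem_surjective (z : Away (reesGrading I) (reesVar I a ha)) :
    ∃ n x, ∃ hx : x ∈ I ^ n, z = chartElem ha n x hx := by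
  obtain ⟨n, b, hb, rfl⟩ := Away.mk_surjective (reesGrading I) (reesVar_mem ha) z
  have hb' : b ∈ reesGrading I n := by simpa using hb
  refine ⟨n, _, b.2 n, ?_⟩
  apply val_injective
  rw [val_chartElem, Away.val_mk, ← eq_reesMonomial hb']

lemma isAffineChart_chartMap : IsAffineChart (chartMap ha) I a where
  mem := ha
  eq_zero z hz := by
    obtain ⟨n, x, hx, rfl⟩ := chartElem_surjective ha z
    rw [← map_zero (chartMap ha), chartMap_eq, chartMap_eq, chartElem_mul, chartElem_eq_iff] at hz
    obtain ⟨k, hk⟩ := hz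
    rw [← map_zero (chartMap ha), chartMap_eq, chartElem_eq_iff]
    -- The extra power absorbs the factor `a` by which the element was multiplied.
    refine ⟨k + 1, ?_⟩
    simp only [pow_zero, one_mul, mul_zero] at hk ⊢
    linear_combination hk
  dvd b hb := by
    refine ⟨chartElem ha 1 b (by simpa), ?_⟩
    rw [chartMap_eq, chartMap_eq, chartElem_mul, chartElem_eq_iff]
    exact ⟨0, by ring⟩
  closure := by
    rw [eq_top_iff]
    rintro z -
    obtain ⟨n, x, hx, rfl⟩ := chartElem_surjective ha z
    -- Elements of `Iⁿ` are sums of products of `n` elements of `I`, so fractions `x / aⁿ` are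
    -- polynomials in the `b / a`.
    induction hx using Submodule.pow_induction_on_left' with
    | algebraMap r =>
      exact Subring.subset_closure (.inl ⟨r, chartMap_eq ha r⟩)
    | add x y i hx hy hx' hy' =>
      rw [chartElem_add ha i x y hx hy]
      exact add_mem hx' hy'
    | mem_mul b hb i x hx ih =>
      have : chartElem ha (i + 1) (b * x) (pow_succ' I i ▸ Ideal.mul_mem_mul hb hx) =
          chartElem ha 1 b (by simpa) * chartElem ha i x hx := by
        rw [chartElem_mul, chartElem_eq_iff]
        exact ⟨0, by ring⟩
      refine this ▸ mul_mem (Subring.subset_closure (.inr ⟨b, hb, ?_⟩)) ih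
      rw [chartMap_eq, chartMap_eq, chartElem_mul, chartElem_eq_iff]
      exact ⟨0, by ring⟩
  ker r hr := by
    rw [← map_zero (chartMap ha), chartMap_eq, chartMap_eq, chartElem_eq_iff] at hr
    simpa using hr

end Rees
end BlowUp
namespace BlowUp

/-! ### Ideal sheaves and scheme-theoretically dominant morphisms -/

section Generic

/-- The quotient `B → B / (ker g) B` is compatible with a map from `C`, hence factors through the
pushout `D`; this bounds the kernel of `B → D` from above. -/
lemma ker_of_isPushout {A B C D : CommRingCat.{u}} {f : A ⟶ B} {g : A ⟶ C} {i : B ⟶ D} {j : C ⟶ D}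
    (h : IsPushout f g i j) (hg : Function.Surjective g) :
    RingHom.ker i.hom = (RingHom.ker g.hom).map f.hom := by
  apply le_antisymm
  · intro b hb
    let q : B ⟶ CommRingCat.of (B ⧸ (RingHom.ker g.hom).map f.hom) :=
      CommRingCat.ofHom (Ideal.Quotient.mk _)
    have hle : RingHom.ker g.hom ≤ RingHom.ker (f ≫ q).hom := fun a ha ↦
      Ideal.Quotient.eq_zero_iff_mem.mpr (Ideal.mem_map_of_mem _ ha)
    let k : C →+* B ⧸ (RingHom.ker g.hom).map f.hom :=
      (RingHom.liftOfSurjective g.hom hg) ⟨(f ≫ q).hom, hle⟩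
    have hk : f ≫ q = g ≫ CommRingCat.ofHom k := by
      ext a
      exact (RingHom.liftOfRightInverse_comp_apply g.hom (Function.surjInv hg)
        (Function.rightInverse_surjInv hg) ⟨(f ≫ q).hom, hle⟩ a).symm
    have : q b = (h.desc q (CommRingCat.ofHom k) hk) (i b) := by
      rw [← CommRingCat.comp_apply, h.inl_desc]
    have hz : q b = 0 := by
      rw [this, show i b = 0 from hb, map_zero]
    exact Ideal.Quotient.eq_zero_iff_mem.mp hz
  · rw [Ideal.map_le_iff_le_comap]
    intro a ha
    have ha' : g a = 0 := ha
    change i (f a) = 0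
    rw [← CommRingCat.comp_apply, h.w, CommRingCat.comp_apply, ha', map_zero]

variable {X Y T : Scheme.{u}}

/-- On affine opens the pulled-back closed subscheme is a pushout of rings along a surjection, so
`ker_of_isPushout` computes its ideal. -/
lemma ideal_comap (I : Y.IdealSheafData) (f : X ⟶ Y) (U : Y.affineOpens) (V : X.affineOpens)
    (h : V.1 ≤ f ⁻¹ᵁ U.1) : (I.comap f).ideal V = (I.ideal U).map (f.appLE U V h).hom := by
  have H := isIso_pushoutSection_of_isAffineOpen (IsPullback.of_hasPullback f I.subschemeι)
    (US := U.1) (UT := I.subschemeι ⁻¹ᵁ U.1) (UX := V.1) (UY := pullback.fst f I.subschemeι ⁻¹ᵁ V.1)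
    le_rfl h (by
      rw [eq_comm, inf_eq_left, ← Scheme.Hom.comp_preimage, ← pullback.condition,
        Scheme.Hom.comp_preimage]
      exact (pullback.fst f I.subschemeι).preimage_mono h)
    U.2 (U.2.preimage _) V.2
  rw [isIso_pushoutSection_iff] at H
  have hs : Function.Surjective (I.subschemeι.appLE U.1 (I.subschemeι ⁻¹ᵁ U.1) le_rfl) := by
    rw [← Scheme.Hom.app_eq_appLE]
    exact I.subschemeι_app_surjective U
  have := ker_of_isPushout H hs
  rw [← Scheme.Hom.app_eq_appLE, ← Scheme.Hom.app_eq_appLE, I.ker_subschemeι_app] at this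
  rw [← this]
  exact Scheme.Hom.ker_apply _ _

/-- The ideal sheaf is locally generated by a nonzerodivisor. -/
def IsCartier (J : T.IdealSheafData) : Prop :=
  ∀ t : T, ∃ W : T.affineOpens, t ∈ W.1 ∧ ∃ s : Γ(T, W.1),
    (∀ c, s * c = 0 → c = 0) ∧ J.ideal W = Ideal.span {s}

lemma mul_eq_zero_of_flat {R S : Type*} [CommRing R] [CommRing S] (f : R →+* S) (hf : f.Flat)
    {s : R} (hs : ∀ c, s * c = 0 → c = 0) (c : S) (hc : f s * c = 0) : c = 0 := by
  algebraize [f]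
  have h1 : IsSMulRegular R s := by
    intro x y hxy
    exact sub_eq_zero.mp (hs _ (by simpa [mul_sub, sub_eq_zero] using hxy))
  have h2 : IsSMulRegular S (algebraMap R S s) := h1.of_flat
  exact h2 (by simpa [RingHom.algebraMap_toAlgebra] using hc)

lemma exists_affineOpens_le (f : X ⟶ Y) (x : X) (U : Y.Opens) (hx : f x ∈ U) :
    ∃ V : X.affineOpens, x ∈ V.1 ∧ V.1 ≤ f ⁻¹ᵁ U := by
  obtain ⟨_, ⟨V, hV, rfl⟩, hxV, hVU⟩ :=
    X.isBasis_affineOpens.exists_subset_of_mem_open (show x ∈ (f ⁻¹ᵁ U : Set X) from hx)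
      (f ⁻¹ᵁ U).isOpen
  exact ⟨⟨V, hV⟩, hxV, hVU⟩

lemma IsCartier.comap {J : Y.IdealSheafData} (hJ : IsCartier J) (f : X ⟶ Y) [Flat f] :
    IsCartier (J.comap f) := by
  intro x
  obtain ⟨W, hW, s, hs, e⟩ := hJ (f x)
  obtain ⟨V, hV, hVW⟩ := exists_affineOpens_le f x W.1 hW
  refine ⟨V, hV, f.appLE W.1 V.1 hVW s, fun c hc ↦ ?_, ?_⟩
  · exact mul_eq_zero_of_flat _ (f.flat_appLE W.2 V.2 hVW) hs c hc
  · rw [ideal_comap J f W V hVW, e, Ideal.map_span, Set.image_singleton]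

/-- A section vanishing off the support vanishes where the local equation `s` is invertible, so it
is killed by a power of the nonzerodivisor `s`. -/
lemma IsCartier.isSchemeTheoreticallyDominant {J : T.IdealSheafData} (hJ : IsCartier J)
    (O : T.Opens) (hO : ∀ t, t ∉ J.support → t ∈ O) : IsSchemeTheoreticallyDominant O.ι := by
  choose W hW s hs e using hJ
  refine ⟨le_bot_iff.mp (Scheme.IdealSheafData.le_of_iSup_eq_top W ?_ fun t ↦ ?_)⟩
  · exact top_le_iff.mp fun t _ ↦ TopologicalSpace.Opens.mem_iSup.mpr ⟨t, hW t⟩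
  · intro x hx
    have hx' : O.ι.app (W t).1 x = 0 := Scheme.Hom.ideal_ker_le _ _ hx
    have hle : T.basicOpen (s t) ≤ O := by
      intro y hy
      apply hO
      have hyW := T.basicOpen_le (s t) hy
      rw [Scheme.IdealSheafData.mem_support_iff_of_mem hyW, e]
      intro h
      have := (T.mem_zeroLocus_iff _ _).mp h (s t) (Ideal.subset_span rfl)
      exact this hy
    have hr : T.presheaf.map (homOfLE (T.basicOpen_le (s t))).op x = 0 := by
      have hle' : T.basicOpen (s t) ≤ O.ι ''ᵁ (O.ι ⁻¹ᵁ (W t).1) := by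
        rw [Scheme.Hom.image_preimage_eq_opensRange_inf, Scheme.Opens.opensRange_ι]
        exact le_inf hle (T.basicOpen_le _)
      have h1 : T.presheaf.map (homOfLE (T.basicOpen_le (s t))).op =
          O.ι.app (W t).1 ≫ T.presheaf.map (homOfLE hle').op := by
        rw [Scheme.Opens.ι_app]
        exact (T.presheaf.map_comp _ _)
      exact congr($h1 x).trans ((congrArg (T.presheaf.map (homOfLE hle').op) hx').trans (map_zero _))
    have loc := (W t).2.isLocalization_basicOpen (s t)
    have h0 : algebraMap Γ(T, (W t).1) Γ(T, T.basicOpen (s t)) x = 0 := hr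
    rw [IsLocalization.map_eq_zero_iff (Submonoid.powers (s t))] at h0
    obtain ⟨⟨_, n, rfl⟩, hn⟩ := h0
    have : x = 0 := by
      clear hr hx hx'
      dsimp only at hn
      induction n with
      | zero => simpa using hn
      | succ n ih => exact ih (hs t _ (by rw [← mul_assoc, ← pow_succ', hn]))
    exact this

/-- By separatedness the equalizer of `f` and `g` is a closed subscheme. The dominant `i` factors
through it, so its ideal is zero. -/
lemma hom_ext_of_isSchemeTheoreticallyDominant {W Z : Scheme.{u}} {f g : X ⟶ Y}
    (s : Y ⟶ Z) [IsSeparated s] (h : f ≫ s = g ≫ s)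
    (i : W ⟶ X) [IsSchemeTheoreticallyDominant i] (hU : i ≫ f = i ≫ g) : f = g := by
  let X' : Over Z := Over.mk (f ≫ s)
  let Y' : Over Z := Over.mk s
  let U' : Over Z := Over.mk (i ≫ f ≫ s)
  let f' : X' ⟶ Y' := Over.homMk f
  let g' : X' ⟶ Y' := Over.homMk g
  let i' : U' ⟶ X' := Over.homMk i
  have : IsSeparated Y'.hom := ‹_›
  have hk : Scheme.Hom.ker (equalizer.ι f' g').left = ⊥ := by
    have hi : i' ≫ f' = i' ≫ g' := by ext1; exact hU
    have e : (equalizer.lift i' hi).left ≫ (equalizer.ι f' g').left = i := by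
      rw [← Over.comp_left, equalizer.lift_ι]; rfl
    have h1 := Scheme.Hom.le_ker_comp (equalizer.lift i' hi).left (equalizer.ι f' g').left
    rw [e, i.ker_eq_bot] at h1
    exact le_bot_iff.mp h1
  have : IsIso (equalizer.ι f' g').left := IsClosedImmersion.isIso_iff_ker_eq_bot.mpr hk
  rw [← cancel_epi (equalizer.ι f' g').left]
  exact congr($(equalizer.condition f' g').left)

end Generic

end BlowUp
namespace BlowUp

/-! ### The charts of the blow-up -/

section AffineCover

variable {R : Type u} [CommRing R] {I : Ideal R}

/-- The Rees algebra is generated in degree one, so the charts `a t` with `a` in a generating set of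
`I` cover the blow-up. -/
lemma irrelevant_le_span_reesVar (G : Set R) (hG : Ideal.span G = I) :
    (HomogeneousIdeal.irrelevant (reesGrading I)).toIdeal ≤
      Ideal.span (Set.range fun g : G ↦ reesVar I g (hG ▸ Ideal.subset_span g.2)) := by
  set P := Ideal.span (Set.range fun g : G ↦ reesVar I g.1 (hG ▸ Ideal.subset_span g.2))
  have h1 : ∀ b ∈ Ideal.span G, ∀ hb' : b ∈ I, reesVar I b hb' ∈ P := by
    intro b hb
    induction hb using Submodule.span_induction with
    | mem x hx => exact fun _ ↦ Ideal.subset_span ⟨⟨x, hx⟩, rfl⟩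
    | zero =>
      intro hb'
      convert P.zero_mem
      exact Subtype.ext (by simp [reesMonomial])
    | add x y hx hy hx' hy' =>
      intro hb'
      convert P.add_mem (hx' (hG ▸ hx)) (hy' (hG ▸ hy))
      exact Subtype.ext (by simp [reesMonomial])
    | smul s x hx hx' =>
      intro hb'
      convert P.mul_mem_left (algebraMap R _ s) (hx' (hG ▸ hx))
      exact Subtype.ext (by simp [reesMonomial, Polynomial.C_mul_monomial])
  rw [HomogeneousIdeal.toIdeal_irrelevant_le]
  intro n hn p hp
  change p ∈ P
  rw [eq_reesMonomial hp]
  obtain ⟨m, rfl⟩ := Nat.exists_eq_succ_of_ne_zero hn.ne'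
  have h2 : ∀ b ∈ I * I ^ m, ∀ hb' : b ∈ I ^ (m + 1), reesMonomial I (m + 1) b hb' ∈ P := by
    intro b hb
    induction hb using Submodule.mul_induction_on' with
    | mem_mul_mem x hx y hy =>
      intro hb'
      have e : reesMonomial I (m + 1) (x * y) hb' = reesMonomial I m y hy * reesVar I x hx :=
        Subtype.ext (by simp [reesMonomial, Polynomial.monomial_mul_monomial, mul_comm])
      rw [e]
      exact P.mul_mem_left _ (h1 x (hG ▸ hx) hx)
    | add x hx y hy hx' hy' =>
      intro hb'
      rw [← pow_succ'] at hx hy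
      have e : reesMonomial I (m + 1) (x + y) hb' = reesMonomial I (m + 1) x hx +
        reesMonomial I (m + 1) y hy := Subtype.ext (by simp [reesMonomial])
      rw [e]
      exact P.add_mem (hx' hx) (hy' hy)
  exact h2 _ (pow_succ' I m ▸ p.2 _) _

lemma iSup_basicOpen_reesVar (G : Set R) (hG : Ideal.span G = I) :
    ⨆ g : G, Proj.basicOpen (reesGrading I) (reesVar I g.1 (hG ▸ Ideal.subset_span g.2)) = ⊤ :=
  Proj.iSup_basicOpen_eq_top _ _ (irrelevant_le_span_reesVar G hG)

/-- The chart `Spec R[I/a] ⟶ Proj (⨁ₙ Iⁿ)`. -/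
def affineBlowUpChart {a : R} (ha : a ∈ I) :
    Spec (.of (HomogeneousLocalization.Away (reesGrading I) (reesVar I a ha))) ⟶ affineBlowUp I :=
  Proj.awayι (reesGrading I) (reesVar I a ha) (reesVar_mem ha) one_pos

instance {a : R} (ha : a ∈ I) : IsOpenImmersion (affineBlowUpChart ha) := by
  delta affineBlowUpChart; infer_instance

lemma opensRange_affineBlowUpChart {a : R} (ha : a ∈ I) :
    (affineBlowUpChart ha).opensRange = Proj.basicOpen _ (reesVar I a ha) :=
  Proj.opensRange_awayι _ _ _ _

lemma affineBlowUpChart_π {a : R} (ha : a ∈ I) :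
    affineBlowUpChart ha ≫ affineBlowUpπ I = Spec.map (CommRingCat.ofHom (chartMap ha)) :=
  awayι_affineBlowUpπ _ _

lemma compactSpace_affineBlowUp (hI : I.FG) : CompactSpace (affineBlowUp I) := by
  obtain ⟨G, hG⟩ := hI
  refine ⟨?_⟩
  have h := iSup_basicOpen_reesVar (I := I) (G : Set R) hG
  have h2 : IsCompact ((⨆ g : (G : Set R), Proj.basicOpen (reesGrading I)
      (reesVar I g.1 (hG ▸ Ideal.subset_span g.2)) : (affineBlowUp I).Opens) :
      Set (affineBlowUp I)) := by
    rw [TopologicalSpace.Opens.coe_iSup]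
    have : Finite (G : Set R) := G.finite_toSet
    exact isCompact_iUnion fun g ↦
      (Proj.isAffineOpen_basicOpen _ _ (reesVar_mem _) one_pos).isCompact
  rw [h] at h2
  exact h2

instance isSeparated_affineBlowUpπ : IsSeparated (affineBlowUpπ I) := by
  delta affineBlowUpπ; infer_instance

lemma chartMap_bijective_of_one (h1 : (1 : R) ∈ I) : Function.Bijective (chartMap h1) := by
  have h := isAffineChart_chartMap h1
  constructor
  · rw [injective_iff_map_eq_zero]
    intro r hr
    obtain ⟨k, hk⟩ := h.ker r hr
    simpa using hk
  · intro s
    induction s using h.induction with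
    | h1 r => exact ⟨r, rfl⟩
    | h2 s b _ e => exact ⟨b, by rw [map_one] at e; exact e.symm.trans (one_mul s)⟩
    | hadd s t hs ht =>
      obtain ⟨x, rfl⟩ := hs
      obtain ⟨y, rfl⟩ := ht
      exact ⟨x + y, map_add _ _ _⟩
    | hmul s t hs ht =>
      obtain ⟨x, rfl⟩ := hs
      obtain ⟨y, rfl⟩ := ht
      exact ⟨x * y, map_mul _ _ _⟩

/-- For the unit ideal the chart of `a = 1` is all of the blow-up, and its ring is `R`. -/
lemma isIso_affineBlowUpπ (hI : I = ⊤) : IsIso (affineBlowUpπ I) := by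
  have h1 : (1 : R) ∈ I := hI ▸ trivial
  have hs : Function.Surjective (affineBlowUpChart h1) := by
    rw [← Set.range_eq_univ]
    have h := iSup_basicOpen_reesVar (I := I) {(1 : R)} (by rw [hI, Ideal.span_singleton_one])
    have h2 : (affineBlowUpChart h1).opensRange = ⊤ := by
      rw [opensRange_affineBlowUpChart, ← h]
      refine le_antisymm (le_iSup_of_le ⟨1, rfl⟩ le_rfl) (iSup_le ?_)
      rintro ⟨_, rfl⟩
      exact le_rfl
    exact congrArg SetLike.coe h2
  have : Surjective (affineBlowUpChart h1) := ⟨hs⟩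
  have : IsIso (affineBlowUpChart h1) :=
    isIso_of_isOpenImmersion_of_opensRange_eq_top _ (TopologicalSpace.Opens.ext hs.range_eq)
  have h2 : IsIso (affineBlowUpChart h1 ≫ affineBlowUpπ I) := by
    rw [affineBlowUpChart_π]
    have : IsIso (CommRingCat.ofHom (chartMap h1)) :=
      (RingEquiv.ofBijective _ (chartMap_bijective_of_one h1)).toCommRingCatIso.isIso_hom
    infer_instance
  exact IsIso.of_isIso_comp_left (affineBlowUpChart h1) _

end AffineCover

section Charts

open Scheme AffineZariskiSite

variable {Y : Scheme.{u}} (I : Y.IdealSheafData) (U : Y.affineOpens)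

/-- The inclusion of the blow-up of the affine open `U`. -/
def blowUpι : affineBlowUp (I.ideal U) ⟶ blowUp I :=
  (blowUpGluingData I).cover.f U

instance : IsOpenImmersion (blowUpι I U) :=
  (blowUpGluingData I).cover.map_prop U

lemma isPullback_affineBlowUpπ_ι :
    IsPullback (blowUpι I U) (affineBlowUpπ (I.ideal U) ≫ U.2.isoSpec.inv) (blowUpπ I) U.1.ι :=
  ((blowUpGluingData I).isPullback_natTrans_ι_toBase U).flip

lemma blowUpι_π : blowUpι I U ≫ blowUpπ I = affineBlowUpπ (I.ideal U) ≫ U.2.fromSpec := by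
  rw [(isPullback_affineBlowUpπ_ι I U).w, Category.assoc]
  exact congrArg (affineBlowUpπ (I.ideal U) ≫ ·) U.2.isoSpec_inv_ι

lemma opensRange_blowUpι : (blowUpι I U).opensRange = blowUpπ I ⁻¹ᵁ U.1 := by
  refine ((blowUpGluingData I).toBase_preimage_eq_opensRange_ι U).symm.trans ?_
  change blowUpπ I ⁻¹ᵁ U.1.ι.opensRange = _
  rw [Scheme.Opens.opensRange_ι]

end Charts

end BlowUp
namespace BlowUp

/-! ### Geometry of the blow-up -/

section Geometry

open Scheme

variable {Y : Scheme.{u}} (I : Y.IdealSheafData)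

lemma exists_chart (U : Y.affineOpens) (x : blowUp I) (hx : blowUpπ I x ∈ U.1) :
    ∃ (a : Γ(Y, U.1)) (ha : a ∈ I.ideal U),
      x ∈ (affineBlowUpChart ha ≫ blowUpι I U).opensRange := by
  have h1 : x ∈ (blowUpι I U).opensRange := by rw [opensRange_blowUpι]; exact hx
  obtain ⟨y, rfl⟩ := h1
  have h2 : y ∈ (⊤ : (affineBlowUp (I.ideal U)).Opens) := trivial
  rw [← iSup_basicOpen_reesVar (I.ideal U : Set Γ(Y, U.1)) (Ideal.span_eq _),
    TopologicalSpace.Opens.mem_iSup] at h2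
  obtain ⟨⟨a, ha⟩, h3⟩ := h2
  rw [← opensRange_affineBlowUpChart] at h3
  obtain ⟨z, rfl⟩ := h3
  exact ⟨a, ha, z, by simp⟩

lemma chart_π (U : Y.affineOpens) {a : Γ(Y, U.1)} (ha : a ∈ I.ideal U) :
    (affineBlowUpChart ha ≫ blowUpι I U) ≫ blowUpπ I =
      Spec.map (CommRingCat.ofHom (chartMap ha)) ≫ U.2.fromSpec := by
  rw [Category.assoc, blowUpι_π, ← Category.assoc, affineBlowUpChart_π]

lemma blowUpπ_of_affine (P : MorphismProperty Scheme.{u}) [IsZariskiLocalAtTarget P]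
    (H : ∀ U : Y.affineOpens, P (affineBlowUpπ (I.ideal U))) : P (blowUpπ I) := by
  refine IsZariskiLocalAtTarget.of_openCover (AffineZariskiSite.directedCover Y) fun U ↦ ?_
  have h := isPullback_affineBlowUpπ_ι I U
  change P (pullback.snd (blowUpπ I) U.1.ι)
  rw [← P.cancel_left_of_respectsIso h.isoPullback.hom, h.isoPullback_hom_snd,
    P.cancel_right_of_respectsIso]
  exact H U

instance : IsSeparated (blowUpπ I) :=
  blowUpπ_of_affine I @IsSeparated fun _ ↦ inferInstance

lemma quasiCompact_blowUpπ [IsLocallyNoetherian Y] : QuasiCompact (blowUpπ I) := by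
  rw [quasiCompact_iff_forall_isAffineOpen]
  intro U hU
  have := IsLocallyNoetherian.component_noetherian ⟨U, hU⟩
  have := compactSpace_affineBlowUp (IsNoetherian.noetherian (I.ideal ⟨U, hU⟩))
  rw [← opensRange_blowUpι I ⟨U, hU⟩]
  exact isCompact_range (blowUpι I ⟨U, hU⟩).continuous

lemma isIso_blowUpπ_restrict_of_affine (U : Y.affineOpens) (hU : I.ideal U = ⊤) :
    IsIso (blowUpπ I ∣_ U.1) := by
  have h := isPullback_affineBlowUpπ_ι I U
  have := isIso_affineBlowUpπ hU
  have h2 : IsIso (pullback.snd (blowUpπ I) U.1.ι) := by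
    have : IsIso (h.isoPullback.hom ≫ pullback.snd (blowUpπ I) U.1.ι) := by
      rw [h.isoPullback_hom_snd]
      exact IsIso.comp_isIso' inferInstance inferInstance
    exact IsIso.of_isIso_comp_left h.isoPullback.hom _
  have h3 := (isPullback_morphismRestrict (blowUpπ I) U.1).flip
  rw [← h3.isoPullback_hom_snd]
  infer_instance

lemma ideal_eq_top (U : Y.affineOpens) (hU : ∀ y ∈ I.support, y ∉ U.1) : I.ideal U = ⊤ := by
  by_contra h
  obtain ⟨m, hm, hle⟩ := Ideal.exists_le_maximal _ h
  let p : Spec Γ(Y, U.1) := ⟨m, hm.isPrime⟩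
  have hy : U.2.fromSpec p ∈ U.1 := by
    have := Set.mem_range_self (f := U.2.fromSpec) p
    rwa [U.2.range_fromSpec] at this
  refine hU (U.2.fromSpec p) ?_ hy
  rw [IdealSheafData.mem_support_iff_of_mem hy, mem_zeroLocus_iff]
  intro f hf hyf
  have : p ∈ U.2.fromSpec ⁻¹ᵁ Y.basicOpen f := hyf
  rw [U.2.fromSpec_preimage_basicOpen] at this
  exact this (hle hf)

/-- The question is local on `V`, and on an affine open that misses the support the ideal is the
unit ideal. -/
lemma isIso_blowUpπ_restrict (V : Y.Opens) (hV : ∀ y ∈ I.support, y ∉ V) :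
    IsIso (blowUpπ I ∣_ V) := by
  refine IsZariskiLocalAtTarget.of_forall_exists_morphismRestrict (P := .isomorphisms _) fun x ↦ ?_
  obtain ⟨_, ⟨U, hU, rfl⟩, hxU, hUV⟩ := Y.isBasis_affineOpens.exists_subset_of_mem_open
    (show x.1 ∈ (V : Set Y) from x.2) V.isOpen
  refine ⟨V.ι ⁻¹ᵁ U, hxU, ?_⟩
  rw [(MorphismProperty.isomorphisms _).arrow_mk_iso_iff (morphismRestrictRestrict _ _ _)]
  have e : V.ι ''ᵁ (V.ι ⁻¹ᵁ U) = U := by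
    rw [Scheme.Hom.image_preimage_eq_opensRange_inf, Scheme.Opens.opensRange_ι]
    exact inf_eq_right.mpr hUV
  rw [e]
  exact isIso_blowUpπ_restrict_of_affine I ⟨U, hU⟩
    (ideal_eq_top I ⟨U, hU⟩ fun y hy hyU ↦ hV y hy (hUV hyU))

/-- Away from the centre, lifts to the blow-up are unique. -/
lemma hom_ext_of_range {T : Scheme.{u}} (V : Y.Opens) (hV : ∀ y ∈ I.support, y ∉ V)
    {l l' : T ⟶ blowUp I} (h : l ≫ blowUpπ I = l' ≫ blowUpπ I)
    (hT : ∀ t, (l ≫ blowUpπ I) t ∈ V) : l = l' := by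
  have := isIso_blowUpπ_restrict I V hV
  have H := (isPullback_morphismRestrict (blowUpπ I) V).flip
  have hr : Set.range (l ≫ blowUpπ I) ⊆ Set.range V.ι := by
    rintro _ ⟨t, rfl⟩
    simpa using hT t
  let k : T ⟶ V.toScheme := IsOpenImmersion.lift V.ι (l ≫ blowUpπ I) hr
  have hk : k ≫ V.ι = l ≫ blowUpπ I := IsOpenImmersion.lift_fac _ _ _
  have e1 : k ≫ inv (blowUpπ I ∣_ V) ≫ (blowUpπ I ⁻¹ᵁ V).ι = l := by
    rw [← H.lift_fst l k hk.symm]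
    rw [← Category.assoc]
    congr 1
    rw [← cancel_mono (blowUpπ I ∣_ V)]
    simp
  have e2 : k ≫ inv (blowUpπ I ∣_ V) ≫ (blowUpπ I ⁻¹ᵁ V).ι = l' := by
    rw [← H.lift_fst l' k (h.symm.trans hk.symm)]
    rw [← Category.assoc]
    congr 1
    rw [← cancel_mono (blowUpπ I ∣_ V)]
    simp
  exact e1.symm.trans e2

/-- The complement of the support of an ideal sheaf. -/
def centreCompl : Y.Opens := ⟨(I.support : Set Y)ᶜ, I.support.isClosed.isOpen_compl⟩

lemma IsCartier.isSchemeTheoreticallyDominant_preimage {T : Scheme.{u}} {h : T ⟶ Y}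
    (hT : IsCartier (I.comap h)) : IsSchemeTheoreticallyDominant (h ⁻¹ᵁ centreCompl I).ι :=
  hT.isSchemeTheoreticallyDominant _ fun t ht ↦ by
    change h t ∉ I.support
    rw [IdealSheafData.support_comap] at ht
    exact ht

/-- Uniqueness in the universal property: the preimage of the complement of the centre is
schematically dense in `T`, lifts are unique there, and `blowUpπ I` is separated. -/
lemma blowUp_hom_ext {T : Scheme.{u}} {l l' : T ⟶ blowUp I}
    (h : l ≫ blowUpπ I = l' ≫ blowUpπ I) (hT : IsCartier (I.comap (l ≫ blowUpπ I))) : l = l' := by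
  have := hT.isSchemeTheoreticallyDominant_preimage
  refine hom_ext_of_isSchemeTheoreticallyDominant (blowUpπ I) h
    ((l ≫ blowUpπ I) ⁻¹ᵁ centreCompl I).ι ?_
  refine hom_ext_of_range I (centreCompl I) (fun y hy hy' ↦ hy' hy) (by simp [h]) fun t ↦ ?_
  rw [Category.assoc]
  exact t.2

lemma isCartier_of_openImmersion {T : Scheme.{u}} (J : T.IdealSheafData)
    (H : ∀ t : T, ∃ (T' : Scheme.{u}) (c : T' ⟶ T), IsOpenImmersion c ∧ t ∈ Set.range c ∧
      IsCartier (J.comap c)) : IsCartier J := by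
  intro t
  obtain ⟨T', c, hc, ⟨t', rfl⟩, hJ⟩ := H t
  obtain ⟨W, hW, s, hs, e⟩ := hJ t'
  rw [IdealSheafData.ideal_comap_of_isOpenImmersion] at e
  let φ := (c.appIso W.1).symm.commRingCatIsoToRingEquiv
  have hφ : ((c.appIso W.1).inv.hom : Γ(T', W.1) →+* Γ(T, c ''ᵁ W.1)) = φ := rfl
  refine ⟨⟨c ''ᵁ W.1, W.2.image_of_isOpenImmersion c⟩, ⟨t', hW, rfl⟩, φ s, fun x hx ↦ ?_, ?_⟩
  · have := hs (φ.symm x) (φ.injective (by simpa using hx))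
    simpa using this
  · rw [hφ] at e
    have h2 := congrArg (Ideal.map (φ : Γ(T', W.1) →+* Γ(T, c ''ᵁ W.1))) e
    rw [Ideal.map_span, Set.image_singleton] at h2
    exact (Ideal.map_comap_of_surjective (φ : Γ(T', W.1) →+* Γ(T, c ''ᵁ W.1))
      φ.surjective _).symm.trans h2

lemma appLE_specMap_fromSpec {U : Y.Opens} (hU : IsAffineOpen U) {S : CommRingCat.{u}}
    (φ : Γ(Y, U) ⟶ S) (hle : ⊤ ≤ (Spec.map φ ≫ hU.fromSpec) ⁻¹ᵁ U) :
    (Spec.map φ ≫ hU.fromSpec).appLE U ⊤ hle = φ ≫ (ΓSpecIso S).inv := by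
  rw [ΓSpecIso_inv_naturality, Scheme.Hom.comp_appLE, hU.fromSpec_app_self, Category.assoc]
  congr 1

lemma ideal_comap_spec (U : Y.affineOpens) (S : CommRingCat.{u}) (φ : Γ(Y, U.1) ⟶ S) :
    (I.comap (Spec.map φ ≫ U.2.fromSpec)).ideal ⟨⊤, isAffineOpen_top _⟩ =
      ((I.ideal U).map φ.hom).map
        ((ΓSpecIso S).symm.commRingCatIsoToRingEquiv : S →+* Γ(Spec S, ⊤)) := by
  have hle : (⊤ : (Spec S).Opens) ≤ (Spec.map φ ≫ U.2.fromSpec) ⁻¹ᵁ U.1 := by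
    rw [Scheme.Hom.comp_preimage, U.2.fromSpec_preimage_self]
    exact le_rfl
  rw [ideal_comap I _ U ⟨⊤, isAffineOpen_top _⟩ hle, Ideal.map_map]
  exact congrArg (fun g ↦ Ideal.map (CommRingCat.Hom.hom g) (I.ideal U))
    (appLE_specMap_fromSpec U.2 φ hle)

lemma map_eq_span_of_isAffineChart {R S : Type u} [CommRing R] [CommRing S] {f : R →+* S}
    {J : Ideal R} {a : R} (h : IsAffineChart f J a) : J.map f = Ideal.span {f a} := by
  apply le_antisymm
  · rw [Ideal.map_le_iff_le_comap]
    intro b hb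
    exact Ideal.mem_span_singleton.mpr (h.dvd b hb)
  · rw [Ideal.span_singleton_le_iff_mem]
    exact Ideal.mem_map_of_mem _ h.mem

lemma isCartier_comap_of_isAffineChart (U : Y.affineOpens) (S : CommRingCat.{u})
    (φ : Γ(Y, U.1) ⟶ S) {a : Γ(Y, U.1)} (h : IsAffineChart φ.hom (I.ideal U) a) :
    IsCartier (I.comap (Spec.map φ ≫ U.2.fromSpec)) := by
  intro t
  let e := (ΓSpecIso S).symm.commRingCatIsoToRingEquiv
  refine ⟨⟨⊤, isAffineOpen_top _⟩, trivial, e (φ a), fun c hc ↦ ?_, ?_⟩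
  · have := h.eq_zero (e.symm c) (e.injective (by simpa using hc))
    simpa using this
  · rw [ideal_comap_spec, map_eq_span_of_isAffineChart h, Ideal.map_span, Set.image_singleton]
    rfl

lemma isCartier_comap_chart (U : Y.affineOpens) {a : Γ(Y, U.1)} (ha : a ∈ I.ideal U) :
    IsCartier ((I.comap (blowUpπ I)).comap (affineBlowUpChart ha ≫ blowUpι I U)) := by
  rw [← IdealSheafData.comap_comp, chart_π]
  exact isCartier_comap_of_isAffineChart I U _ (CommRingCat.ofHom (chartMap ha))
    (isAffineChart_chartMap ha)

lemma isCartier_comap_blowUpπ : IsCartier (I.comap (blowUpπ I)) := by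
  refine isCartier_of_openImmersion _ fun x ↦ ?_
  obtain ⟨U, hU, -⟩ := exists_affineOpens_le (𝟙 Y) (blowUpπ I x) ⊤ trivial
  obtain ⟨a, ha, hx⟩ := exists_chart I U x hU
  exact ⟨_, _, inferInstance, hx, isCartier_comap_chart I U ha⟩

lemma IsCartier.exists_le {T : Scheme.{u}} {J : T.IdealSheafData} (hJ : IsCartier J) (t : T)
    (O : T.Opens) (ht : t ∈ O) : ∃ W : T.affineOpens, t ∈ W.1 ∧ W.1 ≤ O ∧ ∃ s : Γ(T, W.1),
      (∀ c, s * c = 0 → c = 0) ∧ J.ideal W = Ideal.span {s} := by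
  obtain ⟨W, hW, s, hs, e⟩ := hJ t
  obtain ⟨V, hV, hVW⟩ := exists_affineOpens_le (𝟙 T) t (W.1 ⊓ O) ⟨hW, ht⟩
  have hle : V.1 ≤ W.1 := hVW.trans inf_le_left
  refine ⟨V, hV, hVW.trans inf_le_right, (𝟙 T : T ⟶ T).appLE W.1 V.1 hle s, fun c hc ↦ ?_, ?_⟩
  · exact mul_eq_zero_of_flat _ ((𝟙 T : T ⟶ T).flat_appLE W.2 V.2 hle) hs c hc
  · have := ideal_comap J (𝟙 T) W V hle
    rw [IdealSheafData.comap_id, e, Ideal.map_span, Set.image_singleton] at this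
    exact this

/-- Locally the pulled-back ideal is `(s)`. Near `t` some `a ∈ I` already generates it, and then the
universal property of `R[I/a]` provides a lift into the chart of `a`. -/
lemma exists_local_lift {T : Scheme.{u}} (h : T ⟶ Y) (hT : IsCartier (I.comap h)) (t : T) :
    ∃ W : T.affineOpens, t ∈ W.1 ∧ ∃ l : W.1.toScheme ⟶ blowUp I, l ≫ blowUpπ I = W.1.ι ≫ h := by
  obtain ⟨U, hU, -⟩ := exists_affineOpens_le (𝟙 Y) (h t) ⊤ trivial
  obtain ⟨W, hW, hWU, s, hs, e⟩ := hT.exists_le t (h ⁻¹ᵁ U.1) hU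
  rw [ideal_comap I h U W hWU] at e
  set φ := (h.appLE U.1 W.1 hWU).hom with hφ
  have hdvd (a : Γ(Y, U.1)) (ha : a ∈ I.ideal U) : s ∣ φ a := by
    rw [← Ideal.mem_span_singleton, ← e]
    exact Ideal.mem_map_of_mem _ ha
  -- If every quotient `φ a / s` vanished at `t`, then `(s) ⊆ s P` for the prime `P` of `t`;
  -- cancelling `s` would put `1` in `P`.
  have key : ∃ a ∈ I.ideal U, ∃ d : Γ(T, W.1), φ a = s * d ∧ t ∈ T.basicOpen d := by
    by_contra hcon
    push Not at hcon
    let P : Ideal Γ(T, W.1) := (W.2.primeIdealOf ⟨t, hW⟩).asIdeal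
    have hP : P.IsPrime := (W.2.primeIdealOf ⟨t, hW⟩).isPrime
    have hmem (d : Γ(T, W.1)) (hd : t ∉ T.basicOpen d) : d ∈ P := by
      by_contra hdP
      apply hd
      have h1 : W.2.primeIdealOf ⟨t, hW⟩ ∈ PrimeSpectrum.basicOpen d := hdP
      have h2 := W.2.fromSpec_preimage_basicOpen d
      have h3 : W.2.primeIdealOf ⟨t, hW⟩ ∈ W.2.fromSpec ⁻¹ᵁ T.basicOpen d := h2.ge h1
      change W.2.fromSpec (W.2.primeIdealOf ⟨t, hW⟩) ∈ T.basicOpen d at h3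
      rwa [W.2.fromSpec_primeIdealOf] at h3
    have hle : (I.ideal U).map φ ≤ Ideal.span {s} * P := by
      rw [Ideal.map_le_iff_le_comap]
      intro a ha
      obtain ⟨d, hd⟩ := hdvd a ha
      rw [Ideal.mem_comap, hd]
      exact Ideal.mul_mem_mul (Ideal.mem_span_singleton_self s) (hmem d (hcon a ha d hd))
    have hs' : s ∈ Ideal.span {s} * P := hle (e ▸ Ideal.mem_span_singleton_self s)
    obtain ⟨p, hp, hsp⟩ := Ideal.mem_span_singleton_mul.mp hs'
    have h1 : 1 - p = 0 := hs _ (by rw [mul_sub, hsp, mul_one, sub_self])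
    exact hP.ne_top ((Ideal.eq_top_iff_one _).mpr (sub_eq_zero.mp h1 ▸ hp))
  obtain ⟨a, ha, d, had, htd⟩ := key
  have hle : T.basicOpen d ≤ W.1 := T.basicOpen_le d
  let W' : T.affineOpens := ⟨T.basicOpen d, W.2.basicOpen d⟩
  let r := T.presheaf.map (homOfLE hle).op
  have hr : h.appLE U.1 W'.1 (hle.trans hWU) = h.appLE U.1 W.1 hWU ≫ r :=
    (Scheme.Hom.appLE_map _ _ _).symm
  have hru : IsUnit (r d) := T.toRingedSpace.isUnit_res_basicOpen d
  have hrs (c) (hc : r s * c = 0) : c = 0 := by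
    have hflat := (𝟙 T : T ⟶ T).flat_appLE W.2 W'.2 hle
    have : (𝟙 T : T ⟶ T).appLE W.1 W'.1 hle = r := by
      exact Category.id_comp _
    rw [this] at hflat
    exact mul_eq_zero_of_flat _ hflat hs c hc
  set φ' : Γ(Y, U.1) →+* Γ(T, W'.1) := (h.appLE U.1 W'.1 (hle.trans hWU)).hom with hφ'
  have hval (b) : φ' b = r (φ b) := congr($hr b)
  have hd' : φ' a = r s * r d := by rw [hval, had, map_mul]
  obtain ⟨ψ, hψ⟩ := (isAffineChart_chartMap ha).exists_lift φ' (fun c hc ↦ by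
      rw [hd', mul_assoc] at hc
      exact hru.mul_right_eq_zero.mp (hrs _ hc)) (fun b hb ↦ by
      obtain ⟨c, hc⟩ := hdvd b hb
      obtain ⟨v, hv⟩ := hru.exists_right_inv
      exact ⟨v * r c, by rw [hd', hval, hc, map_mul]; linear_combination (-r s * r c) * hv⟩)
  refine ⟨W', htd, W'.2.isoSpec.hom ≫ Spec.map (CommRingCat.ofHom ψ) ≫
    affineBlowUpChart ha ≫ blowUpι I U, ?_⟩
  rw [Category.assoc, Category.assoc, chart_π, ← Spec.map_comp_assoc, ← CommRingCat.ofHom_comp, hψ]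
  change W'.2.isoSpec.hom ≫ Spec.map (h.appLE U.1 W'.1 (hle.trans hWU)) ≫ U.2.fromSpec = _
  rw [IsAffineOpen.SpecMap_appLE_fromSpec _ U.2 W'.2, ← Category.assoc]
  congr 1
  exact (Iso.eq_inv_comp _).mp W'.2.isoSpec_inv_ι.symm

/-- Local lifts agree on overlaps by `blowUp_hom_ext`, as Cartier ideals stay Cartier on open
subschemes. -/
lemma exists_lift_of_openCover {T : Scheme.{u}} (h : T ⟶ Y) (hT : IsCartier (I.comap h))
    (𝒰 : T.OpenCover) (l : ∀ i, 𝒰.X i ⟶ blowUp I) (hl : ∀ i, l i ≫ blowUpπ I = 𝒰.f i ≫ h) :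
    ∃ l : T ⟶ blowUp I, l ≫ blowUpπ I = h := by
  refine ⟨𝒰.glueMorphisms l fun x y ↦ ?_, 𝒰.hom_ext _ _ fun x ↦ ?_⟩
  · apply blowUp_hom_ext
    · rw [Category.assoc, Category.assoc, hl, hl, pullback.condition_assoc]
    · rw [Category.assoc, hl, ← Category.assoc, IdealSheafData.comap_comp]
      exact hT.comap _
  · rw [Scheme.Cover.ι_glueMorphisms_assoc]
    exact hl x

/-- The universal property of the blow-up. -/
lemma exists_lift_blowUp {T : Scheme.{u}} (h : T ⟶ Y) (hT : IsCartier (I.comap h)) :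
    ∃ l : T ⟶ blowUp I, l ≫ blowUpπ I = h := by
  choose W hW l hl using exists_local_lift I h hT
  have hcov : TopologicalSpace.IsOpenCover fun t ↦ (W t).1 :=
    top_le_iff.mp fun t _ ↦ TopologicalSpace.Opens.mem_iSup.mpr ⟨t, hW t⟩
  exact exists_lift_of_openCover I h hT (T.openCoverOfIsOpenCover _ hcov) l hl

end Geometry

end BlowUp
namespace BlowUp

/-! ### Lifting automorphisms to the blow-up -/

section Lift

open Scheme

variable {F : Type u} [Field F]

instance flat_structMap (A : CommAlgCat.{u} F) : Flat (structMap A) := by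
  rw [Flat.SpecMap_iff]
  exact (RingHom.flat_algebraMap_iff).mpr inferInstance

/-- The projection `X_A ⟶ X`. -/
abbrev proj (X : Over (Spec (.of F))) (A : CommAlgCat.{u} F) : (extend X A).left ⟶ X.left :=
  pullback.fst X.hom (structMap A)

instance flat_proj (X : Over (Spec (.of F))) (A : CommAlgCat.{u} F) : Flat (proj X A) := by
  infer_instance

lemma isPullback_proj (X : Over (Spec (.of F))) (A : CommAlgCat.{u} F) :
    IsPullback (proj X A) (extend X A).hom X.hom (structMap A) :=
  IsPullback.of_hasPullback _ _

variable {X X' : Over (Spec (.of F))}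

lemma extendMap_proj (f : X ⟶ X') (A : CommAlgCat.{u} F) :
    (extendMap f A).left ≫ proj X' A = proj X A ≫ f.left :=
  pullback.lift_fst _ _ _

lemma isPullback_extendMap (f : X ⟶ X') (A : CommAlgCat.{u} F) :
    IsPullback (proj X A) (extendMap f A).left f.left (proj X' A) := by
  refine IsPullback.of_bot ?_ (extendMap_proj f A).symm (isPullback_proj X' A)
  have h1 : (extendMap f A).left ≫ (extend X' A).hom = (extend X A).hom := Over.w _
  have h2 : f.left ≫ X'.hom = X.hom := Over.w _
  rw [h1, h2]
  exact isPullback_proj X A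

lemma ker_of_isPullback {Z Z' Y Y' : Scheme.{u}} {i : Z ⟶ Y} {i' : Z' ⟶ Y'} {k : Z' ⟶ Z}
    {f : Y' ⟶ Y} [IsClosedImmersion i] (h : IsPullback i' k f i) : i'.ker = i.ker.comap f := by
  rw [← IdealSheafData.ker_fst_of_isClosedImmersion, ← h.isoPullback_hom_fst,
    Scheme.Hom.ker_comp_of_isIso]

variable {Z Y : Over (Spec (.of F))} (ι : Z ⟶ Y) [IsClosedImmersion ι.left]

instance (A : CommAlgCat.{u} F) : IsClosedImmersion (extendMap ι A).left :=
  MorphismProperty.of_isPullback (isPullback_extendMap ι A) inferInstance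

lemma ker_extendMap (A : CommAlgCat.{u} F) :
    (extendMap ι A).left.ker = ι.left.ker.comap (proj Y A) :=
  ker_of_isPullback (isPullback_extendMap ι A).flip

/-- The square formed by `f` and its restriction to `Z_A` has invertible horizontal sides, so it is
cartesian and carries the ideal of `Z_A` to itself. -/
lemma comap_of_mem_stabSubgroup {A : CommAlgCat.{u} F} {f : Aut (extend Y A)}
    (hf : f ∈ stabSubgroup ι A) :
    ι.left.ker.comap (f.hom.left ≫ proj Y A) = ι.left.ker.comap (proj Y A) := by
  obtain ⟨k, hk⟩ := hf
  rw [IdealSheafData.comap_comp, ← ker_extendMap]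
  have hk' : k.hom.left ≫ (extendMap ι A).left = (extendMap ι A).left ≫ f.hom.left :=
    congr($(hk).left)
  have : IsIso k.hom.left := inferInstanceAs (IsIso ((Over.forget _).map k.hom))
  have : IsIso f.hom.left :=
    have := Iso.isIso_hom (show extend Y A ≅ extend Y A from f)
    inferInstanceAs (IsIso ((Over.forget _).map f.hom))
  exact (ker_of_isPullback (IsPullback.of_vert_isIso ⟨hk'.symm⟩)).symm

lemma isCartier_of_mem_stabSubgroup {A : CommAlgCat.{u} F} {f : Aut (extend Y A)}
    (hf : f ∈ stabSubgroup ι A) : IsCartier (ι.left.ker.comap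
      ((extendMap (blowUpHom ι) A ≫ f.hom).left ≫ proj Y A)) := by
  rw [Over.comp_left, Category.assoc, IdealSheafData.comap_comp, comap_of_mem_stabSubgroup ι hf,
    ← IdealSheafData.comap_comp, extendMap_proj, IdealSheafData.comap_comp]
  exact @IsCartier.comap _ _ _ (isCartier_comap_blowUpπ ι.left.ker) (proj (blowUpOver ι) A)
    (flat_proj _ _)

variable {ι}

-- A morphism of `A`-schemes to `X_A` is determined by its component in `X`. So the universal
-- property over `F` suffices, without identifying `X_A` with a blow-up of `Y_A`.
omit [IsClosedImmersion ι.left] in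
lemma extend_blowUp_hom_ext {A : CommAlgCat.{u} F} {T : Over (Spec (.of A))}
    {g g' : T ⟶ extend (blowUpOver ι) A}
    (h : g ≫ extendMap (blowUpHom ι) A = g' ≫ extendMap (blowUpHom ι) A)
    (hT : IsCartier (ι.left.ker.comap ((g ≫ extendMap (blowUpHom ι) A).left ≫ proj Y A))) :
    g = g' := by
  have e (g : T ⟶ extend (blowUpOver ι) A) : (g.left ≫ proj (blowUpOver ι) A) ≫
      blowUpπ ι.left.ker = (g ≫ extendMap (blowUpHom ι) A).left ≫ proj Y A := by
    rw [Over.comp_left, Category.assoc, extendMap_proj]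
    exact Category.assoc _ _ _
  apply Over.OverMorphism.ext
  apply pullback.hom_ext
  · refine blowUp_hom_ext ι.left.ker ?_ ?_
    · exact (e g).trans ((congr($(h).left ≫ proj Y A)).trans (e g').symm)
    · exact (congrArg (fun k ↦ IsCartier (ι.left.ker.comap k)) (e g)).mpr hT
  · exact (Over.w g).trans (Over.w g').symm

omit [IsClosedImmersion ι.left] in
lemma exists_lift_extend_blowUp {A : CommAlgCat.{u} F} {T : Over (Spec (.of A))}
    (h : T ⟶ extend Y A) (hT : IsCartier (ι.left.ker.comap (h.left ≫ proj Y A))) :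
    ∃ g : T ⟶ extend (blowUpOver ι) A, g ≫ extendMap (blowUpHom ι) A = h := by
  obtain ⟨l, hl⟩ := exists_lift_blowUp _ _ hT
  have hw : l ≫ (blowUpOver ι).hom = T.hom ≫ structMap A := by
    change l ≫ blowUpπ ι.left.ker ≫ Y.hom = _
    rw [← Category.assoc, hl, Category.assoc, (isPullback_proj Y A).w, ← Category.assoc]
    exact congrArg (· ≫ structMap A) (Over.w h)
  refine ⟨Over.homMk (pullback.lift l T.hom hw) (pullback.lift_snd _ _ _), ?_⟩
  apply Over.OverMorphism.ext
  apply pullback.hom_ext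
  · rw [Over.comp_left, Category.assoc]
    refine (congrArg (_ ≫ ·) (extendMap_proj (blowUpHom ι) A)).trans ?_
    rw [← Category.assoc]
    refine (congrArg (· ≫ blowUpπ ι.left.ker) (pullback.lift_fst l T.hom hw)).trans hl
  · exact (Over.w _).trans (Over.w h).symm

variable (ι)

/-- The lift of `f⁻¹` is inverse to the lift of `f`, because both composites lie over `β_A` and the
identity is the only such endomorphism. -/
lemma existsUnique_lift_aut {A : CommAlgCat.{u} F} (f : stabSubgroup ι A) :
    ∃! g : Aut (extend (blowUpOver ι) A),
      g.hom ≫ extendMap (blowUpHom ι) A = extendMap (blowUpHom ι) A ≫ f.1.hom := by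
  obtain ⟨g, hg⟩ := exists_lift_extend_blowUp _ (isCartier_of_mem_stabSubgroup ι f.2)
  obtain ⟨g', hg'⟩ := exists_lift_extend_blowUp _ (isCartier_of_mem_stabSubgroup ι (f⁻¹).2)
  have h1 : f.1.hom ≫ (f⁻¹).1.hom = 𝟙 _ := f.1.hom_inv_id
  have h2 : (f⁻¹).1.hom ≫ f.1.hom = 𝟙 _ := f.1.inv_hom_id
  have key (k : extend (blowUpOver ι) A ⟶ extend (blowUpOver ι) A)
      (hk : k ≫ extendMap (blowUpHom ι) A = extendMap (blowUpHom ι) A) : k = 𝟙 _ := by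
    have hC := isCartier_of_mem_stabSubgroup ι (A := A) (Subgroup.one_mem _)
    refine extend_blowUp_hom_ext (by rw [hk, Category.id_comp]) ?_
    rw [hk]
    convert hC
    exact (Category.comp_id _).symm
  refine ⟨⟨g, g', key _ ?_, key _ ?_⟩, hg, fun k hk ↦ Aut.ext ?_⟩
  · rw [Category.assoc, hg', ← Category.assoc, hg, Category.assoc, h1, Category.comp_id]
  · rw [Category.assoc, hg, ← Category.assoc, hg', Category.assoc, h2, Category.comp_id]
  · refine extend_blowUp_hom_ext (hk.trans hg.symm) ?_
    rw [hk]
    exact isCartier_of_mem_stabSubgroup ι f.2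

/-- The lift to the blow-up of an automorphism stabilising the centre. -/
def liftAut {A : CommAlgCat.{u} F} (f : stabSubgroup ι A) : Aut (extend (blowUpOver ι) A) :=
  (existsUnique_lift_aut ι f).choose

lemma liftAut_eq_iff {A : CommAlgCat.{u} F} (f : stabSubgroup ι A)
    (g : Aut (extend (blowUpOver ι) A)) : liftAut ι f = g ↔
      g.hom ≫ extendMap (blowUpHom ι) A = extendMap (blowUpHom ι) A ≫ f.1.hom := by
  have h := (existsUnique_lift_aut ι f).choose_spec
  exact ⟨fun e ↦ e ▸ h.1, fun e ↦ (h.2 g e).symm⟩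

lemma liftAut_hom {A : CommAlgCat.{u} F} (f : stabSubgroup ι A) :
    (liftAut ι f).hom ≫ extendMap (blowUpHom ι) A = extendMap (blowUpHom ι) A ≫ f.1.hom :=
  (liftAut_eq_iff ι f _).mp rfl

/-- The homomorphism of group functors from the stabiliser of the centre to the automorphism
functor of the blow-up. -/
def liftHom : stabFunctor ι ⟶ autFunctor (blowUpOver ι) where
  app A := GrpCat.ofHom
    { toFun := liftAut ι
      map_one' := by
        rw [liftAut_eq_iff]
        exact (Category.id_comp _).trans (Category.comp_id _).symm
      map_mul' f f' := by
        rw [liftAut_eq_iff]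
        change ((liftAut ι f').hom ≫ (liftAut ι f).hom) ≫ _ = _ ≫ f'.1.hom ≫ f.1.hom
        rw [Category.assoc, liftAut_hom, ← Category.assoc, liftAut_hom, Category.assoc] }
  naturality A B h := by
    refine GrpCat.hom_ext (MonoidHom.ext fun (f : stabSubgroup ι A) ↦ ?_)
    refine (liftAut_eq_iff ι _ _).mpr ?_
    change baseChangeHom h (liftAut ι f).hom ≫ _ = _ ≫ baseChangeHom h f.1.hom
    rw [← baseChangeHom_extendMap h, ← baseChangeHom_comp, liftAut_hom, baseChangeHom_comp]

/-! ### Injectivity -/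

omit [IsClosedImmersion ι.left] in
lemma isReduced_of_smooth_hom (Y : Over (Spec (.of F))) [Smooth Y.hom] : IsReduced Y.left := by
  refine @IsReduced.of_openCover _ Y.left.affineCover fun i ↦ ?_
  have h0 : Smooth (Y.left.affineCover.f i ≫ Y.hom) := inferInstance
  refine (affine_isReduced_iff _).mpr ?_
  let φ := Spec.preimage (Y.left.affineCover.f i ≫ Y.hom)
  have hφ : Smooth (Spec.map φ) := by
    rw [Spec.map_preimage]
    exact h0
  rw [HasRingHomProperty.Spec_iff (P := @Smooth)] at hφ
  algebraize [φ.hom]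
  exact isReduced_of_smooth F _

lemma isLocallyNoetherian_of_isVariety (hY : IsVariety Y) : IsLocallyNoetherian Y.left :=
  have := hY.locallyOfFiniteType
  LocallyOfFiniteType.isLocallyNoetherian Y.hom

lemma centreCompl_ker : (centreCompl ι.left.ker : Set Y.left) = (Set.range ι.left)ᶜ := by
  change (ι.left.ker.support : Set Y.left)ᶜ = _
  rw [Scheme.Hom.support_ker, ι.left.isClosedEmbedding.isClosed_range.closure_eq]

/-- On an irreducible component the complement of `Z` is a nonempty open subset, so it meets every
nonempty open subset of that component. -/
lemma dense_centreCompl (h : ContainsNoComponent ι) :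
    Dense (centreCompl ι.left.ker : Set Y.left) := by
  rw [centreCompl_ker, dense_iff_inter_open]
  rintro O hO ⟨x, hx⟩
  have hC := irreducibleComponent_mem_irreducibleComponents x
  obtain ⟨y, hy, hy'⟩ := Set.not_subset.mp (h _ hC)
  obtain ⟨z, -, hz⟩ := hC.1.2 _ _ hO
    ι.left.isClosedEmbedding.isClosed_range.isOpen_compl ⟨x, mem_irreducibleComponent, hx⟩
    ⟨y, hy, hy'⟩
  exact ⟨z, hz⟩

lemma isSchemeTheoreticallyDominant_centreCompl [Smooth Y.hom] (h : ContainsNoComponent ι) :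
    IsSchemeTheoreticallyDominant (centreCompl ι.left.ker).ι := by
  have := isReduced_of_smooth_hom Y
  have : IsDominant (centreCompl ι.left.ker).ι := ⟨by
    rw [DenseRange, Scheme.Opens.range_ι]
    exact dense_centreCompl ι h⟩
  exact .of_isDominant _

/-- Over the schematically dense complement of `Z` the blow-up is an isomorphism, so already the
restriction of `β` to the preimage of that complement is dominant. -/
lemma isSchemeTheoreticallyDominant_blowUpπ [Smooth Y.hom] (h : ContainsNoComponent ι) :
    IsSchemeTheoreticallyDominant (blowUpπ ι.left.ker) := by
  have h1 := isSchemeTheoreticallyDominant_centreCompl ι h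
  have h2 := isIso_blowUpπ_restrict ι.left.ker (centreCompl ι.left.ker) fun y hy hy' ↦ hy' hy
  have h3 : IsSchemeTheoreticallyDominant
      ((blowUpπ ι.left.ker ⁻¹ᵁ centreCompl ι.left.ker).ι ≫ blowUpπ ι.left.ker) := by
    rw [← morphismRestrict_ι]
    infer_instance
  refine ⟨le_bot_iff.mp ?_⟩
  rw [← h3.ker_eq_bot]
  exact Scheme.Hom.le_ker_comp _ _

/-- Schematic dominance of a quasi-compact morphism is stable under flat base change;
quasi-compactness of `β` comes from `Y` being locally noetherian. -/
lemma isSchemeTheoreticallyDominant_extendMap (hY : IsVariety Y) [Smooth Y.hom]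
    (h : ContainsNoComponent ι) (A : CommAlgCat.{u} F) :
    IsSchemeTheoreticallyDominant (extendMap (blowUpHom ι) A).left := by
  have := isLocallyNoetherian_of_isVariety hY
  have := isSchemeTheoreticallyDominant_blowUpπ ι h
  have := quasiCompact_blowUpπ ι.left.ker
  exact @IsSchemeTheoreticallyDominant.of_isPullback _ _ _ _ _ _ _ _
    (isPullback_extendMap (blowUpHom ι) A)
    ‹IsSchemeTheoreticallyDominant (blowUpπ ι.left.ker)› ‹QuasiCompact (blowUpπ ι.left.ker)› _

omit [IsClosedImmersion ι.left] in
lemma isSeparated_extend_hom (hY : IsVariety Y) (A : CommAlgCat.{u} F) :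
    IsSeparated (extend Y A).hom :=
  have := hY.isSeparated
  MorphismProperty.of_isPullback (isPullback_proj Y A) ‹IsSeparated Y.hom›

/-- Morphisms out of `Y_A` are determined by their composition with the blow-up. -/
lemma extend_hom_ext_of_blowUp (hY : IsVariety Y) [Smooth Y.hom] (h : ContainsNoComponent ι)
    {A : CommAlgCat.{u} F} {f f' : extend Y A ⟶ extend Y A}
    (e : extendMap (blowUpHom ι) A ≫ f = extendMap (blowUpHom ι) A ≫ f') : f = f' := by
  have := isSchemeTheoreticallyDominant_extendMap ι hY h A
  have := isSeparated_extend_hom hY A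
  apply Over.OverMorphism.ext
  exact hom_ext_of_isSchemeTheoreticallyDominant (extend Y A).hom
    ((Over.w f).trans (Over.w f').symm) (extendMap (blowUpHom ι) A).left congr($(e).left)

lemma liftHom_injective (hY : IsVariety Y) [Smooth Y.hom] (h : ContainsNoComponent ι)
    (A : CommAlgCat.{u} F) : Function.Injective ((liftHom ι).app A) := by
  intro (f : stabSubgroup ι A) (f' : stabSubgroup ι A) (e : liftAut ι f = liftAut ι f')
  refine Subtype.ext (Aut.ext (extend_hom_ext_of_blowUp ι hY h ?_))
  rw [← liftAut_hom, ← liftAut_hom, e]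

end Lift

end BlowUp
namespace BlowUp

/-! ### Affine open subsets on which the centre has a regular pair -/

section Good

open Scheme

variable {F : Type u} [Field F]

/-- The `F`-algebra structure on the sections of an `F`-scheme over an affine open subset. -/
abbrev sectionsAlgebra (Y : Over (Spec (.of F))) {U : Y.left.Opens} (hU : IsAffineOpen U) :
    Algebra F Γ(Y.left, U) :=
  (Spec.preimage (hU.fromSpec ≫ Y.hom)).hom.toAlgebra

lemma specMap_sectionsAlgebra (Y : Over (Spec (.of F))) {U : Y.left.Opens}
    (hU : IsAffineOpen U) : letI := sectionsAlgebra Y hU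
    Spec.map (CommRingCat.ofHom (algebraMap F Γ(Y.left, U))) = hU.fromSpec ≫ Y.hom :=
  Spec.map_preimage (hU.fromSpec ≫ Y.hom)

lemma smooth_sectionsAlgebra (Y : Over (Spec (.of F))) [Smooth Y.hom] {U : Y.left.Opens}
    (hU : IsAffineOpen U) : letI := sectionsAlgebra Y hU
    Algebra.Smooth F Γ(Y.left, U) := by
  let := sectionsAlgebra Y hU
  have h0 : Smooth (hU.fromSpec ≫ Y.hom) := inferInstance
  rw [← specMap_sectionsAlgebra Y hU, HasRingHomProperty.Spec_iff (P := @Smooth)] at h0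
  exact RingHom.smooth_algebraMap.mp h0

variable {Z Y : Over (Spec (.of F))} (ι : Z ⟶ Y) [IsClosedImmersion ι.left]

/-- `Z` is isomorphic to the closed subscheme cut out by its ideal sheaf, and the spectrum of the
quotient ring is an affine open of that subscheme. -/
lemma smooth_quotient_sections [Smooth Z.hom] {U : Y.left.Opens} (hU : IsAffineOpen U) :
    letI := sectionsAlgebra Y hU
    Algebra.Smooth F (Γ(Y.left, U) ⧸ ι.left.ker.ideal ⟨U, hU⟩) := by
  let := sectionsAlgebra Y hU
  have e : ι.left.imageι ≫ Y.hom = inv ι.left.toImage ≫ Z.hom := by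
    rw [IsIso.eq_inv_comp, ← Category.assoc, Scheme.Hom.toImage_imageι]
    exact Over.w ι
  have h0 : Smooth (Spec.map (CommRingCat.ofHom
      (algebraMap F (Γ(Y.left, U) ⧸ ι.left.ker.ideal ⟨U, hU⟩)))) := by
    have e2 : ι.left.ker.subschemeCover.f ⟨U, hU⟩ ≫ inv ι.left.toImage ≫ Z.hom =
        Spec.map (CommRingCat.ofHom
          (algebraMap F (Γ(Y.left, U) ⧸ ι.left.ker.ideal ⟨U, hU⟩))) := by
      rw [← e, ← Category.assoc]
      refine (congrArg (· ≫ Y.hom) (ι.left.ker.subschemeCover_map_subschemeι ⟨U, hU⟩)).trans ?_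
      refine (congrArg (· ≫ Y.hom) (ι.left.ker.glueDataObjι_ι ⟨U, hU⟩)).trans ?_
      refine (Category.assoc _ _ _).trans ?_
      refine (congrArg (_ ≫ ·) (specMap_sectionsAlgebra Y hU).symm).trans ?_
      exact (Spec.map_comp (CommRingCat.ofHom (algebraMap F Γ(Y.left, U)))
        (CommRingCat.ofHom (Ideal.Quotient.mk (ι.left.ker.ideal ⟨U, hU⟩)))).symm
    rw [← e2]
    have h1 : IsOpenImmersion (ι.left.ker.subschemeCover.f ⟨U, hU⟩) :=
      ι.left.ker.subschemeCover.openCover.map_prop ⟨U, hU⟩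
    have h2 : Smooth (inv ι.left.toImage ≫ Z.hom) := inferInstance
    have h3 : Smooth (ι.left.ker.subschemeCover.f ⟨U, hU⟩) := inferInstance
    exact MorphismProperty.comp_mem @Smooth _ _ h3 h2
  have h1 := (HasRingHomProperty.Spec_iff (P := @Smooth)).mp h0
  exact RingHom.smooth_algebraMap.mp h1

-- A minimal prime over the ideal of `Z` on `U` is the generic point of an irreducible component of
-- `Z`, and its height is the codimension of that component in `Y`.
omit [IsClosedImmersion ι.left] in
lemma le_codim_of_mem_minimalPrimes {n : ℕ} (h : ComponentsCodimGE ι n) [IsClosedImmersion ι.left]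
    (U : Y.left.affineOpens) {q : Ideal Γ(Y.left, U)} (hq : q ∈ (ι.left.ker.ideal U).minimalPrimes) :
    (n : ℕ∞) ≤ q.height := by
  have hqp : q.IsPrime := hq.1.1
  have hemb := ι.left.isClosedEmbedding
  have hU : IsOpenImmersion U.2.fromSpec := IsAffineOpen.isOpenImmersion_fromSpec _
  let Q : Spec Γ(Y.left, U) := ⟨q, hqp⟩
  let η : Y.left := U.2.fromSpec Q
  have hrange (P : Spec Γ(Y.left, U)) :
      U.2.fromSpec P ∈ Set.range ι.left ↔ ι.left.ker.ideal U ≤ P.asIdeal := by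
    have h1 : U.2.fromSpec P ∈ (U : Set Y.left) := by
      rw [← U.2.range_fromSpec]; exact ⟨P, rfl⟩
    have h2 := Set.ext_iff.mp (ι.left.ker.coe_support_inter U) (U.2.fromSpec P)
    rw [Scheme.Hom.support_ker, ι.left.isClosedEmbedding.isClosed_range.closure_eq,
      ← U.2.fromSpec_image_zeroLocus] at h2
    refine ⟨fun h3 ↦ ?_, fun h3 ↦ (h2.mpr ⟨P, h3, rfl⟩).1⟩
    obtain ⟨P', h4, h5⟩ := h2.mp ⟨h3, h1⟩
    rwa [← U.2.fromSpec.isOpenEmbedding.injective h5]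
  obtain ⟨z, hz⟩ := (hrange Q).mpr hq.1.2
  -- The generic point `w` of a larger irreducible set specializes to `z`, so its image lies in `U`
  -- and gives a prime below `q` that contains the ideal; minimality forces `w = z`.
  have hC : closure {z} ∈ irreducibleComponents Z.left := by
    refine ⟨isIrreducible_singleton.closure, fun D hD hzD ↦ ?_⟩
    have hw : IsGenericPoint hD.genericPoint (closure D) := hD.isGenericPoint_genericPoint_closure
    set w := hD.genericPoint
    have hwz : w ⤳ z := by
      rw [specializes_iff_mem_closure, hw.def]
      exact subset_closure (hzD (subset_closure rfl))
    have hwz' : ι.left w ⤳ η := (hwz.map ι.left.continuous).trans (specializes_of_eq hz)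
    have hηU : η ∈ U.1 := by
      change U.2.fromSpec Q ∈ (U : Set Y.left)
      rw [← U.2.range_fromSpec]
      exact ⟨Q, rfl⟩
    have hwU : ι.left w ∈ (U : Set Y.left) := hwz'.mem_open U.1.2 hηU
    rw [← U.2.range_fromSpec] at hwU
    obtain ⟨P, hP⟩ := hwU
    have hPI := (hrange P).mp ⟨w, hP.symm⟩
    have hPQ : P.asIdeal ≤ q := by
      refine (PrimeSpectrum.le_iff_specializes P Q).mpr ?_
      refine U.2.fromSpec.isOpenEmbedding.isInducing.specializes_iff.mp ?_
      exact (specializes_of_eq hP).trans hwz'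
    have hPQ' : P = Q := PrimeSpectrum.ext (le_antisymm hPQ (hq.2 ⟨P.2, hPI⟩ hPQ))
    have hwz2 : w = z := hemb.injective (by rw [← hP, hPQ', hz])
    rw [← hwz2, hw.def]
    exact subset_closure
  let T := irreducibleSetEquivPoints.symm η
  have := h T ⟨_, hC, ?_⟩
  · rw [codim, Order.coheight_orderIso] at this
    refine this.trans ?_
    rw [coheight_eq_of_isOpenImmersion, ← idealHeight_eq_coheight]
  · refine Eq.trans ?_ (hemb.closure_image_eq {z})
    rw [Set.image_singleton, hz]
    rfl

-- A component of `Y` lying in `Z` would be a component of `Z` of codimension zero.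
omit [IsClosedImmersion ι.left] in
lemma ComponentsCodimGE.containsNoComponent {n : ℕ} (h : ComponentsCodimGE ι n)
    [IsClosedImmersion ι.left] (hn : n ≠ 0) : ContainsNoComponent ι := by
  intro C hC hCZ
  obtain ⟨C', rfl⟩ := Set.subset_range_iff_exists_image_eq.mp hCZ
  have hemb := ι.left.isClosedEmbedding
  have hcl := isClosed_of_mem_irreducibleComponents _ hC
  have hirr : IsIrreducible C' := by
    obtain ⟨η, hη⟩ : ∃ η, IsGenericPoint η (ι.left '' C') := QuasiSober.sober hC.1 hcl
    obtain ⟨z, -, hz⟩ := hη.mem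
    have : C' = closure {z} := by
      apply hemb.injective.image_injective
      rw [← hemb.closure_image_eq, Set.image_singleton, hz, hη.def]
    rw [this]
    exact isIrreducible_singleton.closure
  have := h ⟨ι.left '' C', hC.1, hcl⟩ ⟨C', ⟨hirr, fun D hD hCD ↦ ?_⟩, rfl⟩
  · rw [codim, Order.coheight_eq_zero.mpr] at this
    · simp at this
      exact hn this
    · intro T hT
      exact hC.2 T.isIrreducible' hT
  · have := hC.2 (hD.image _ ι.left.continuous.continuousOn) (Set.image_mono hCD)
    exact (Set.image_subset_image_iff hemb.injective).mp this

lemma exists_affineOpens_hasRegularPair [Smooth Y.hom] [Smooth Z.hom] (h : ComponentsCodimGE ι 2)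
    (y : Y.left) : ∃ (U : Y.left.Opens) (hU : IsAffineOpen U), y ∈ U ∧
      letI := sectionsAlgebra Y hU
      HasRegularPair F (ι.left.ker.ideal ⟨U, hU⟩) := by
  obtain ⟨_, ⟨U, hU, rfl⟩, hyU, -⟩ :=
    Y.left.isBasis_affineOpens.exists_subset_of_mem_open (Set.mem_univ y) isOpen_univ
  have hyU' : y ∈ Set.range hU.fromSpec := by rw [hU.range_fromSpec]; exact hyU
  obtain ⟨P, rfl⟩ := hyU'
  let := sectionsAlgebra Y hU
  have := smooth_sectionsAlgebra Y hU
  have := smooth_quotient_sections ι hU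
  have := P.2
  obtain ⟨r, hr, H⟩ := exists_hasRegularPair (F := F) (ι.left.ker.ideal ⟨U, hU⟩) P.asIdeal
    fun q hq _ ↦ le_codim_of_mem_minimalPrimes ι h ⟨U, hU⟩ hq
  have hV := hU.basicOpen r
  refine ⟨Y.left.basicOpen r, hV, ?_, ?_⟩
  · have : P ∈ hU.fromSpec ⁻¹ᵁ Y.left.basicOpen r := by
      rw [hU.fromSpec_preimage_basicOpen]
      exact hr
    exact this
  · let := sectionsAlgebra Y hV
    let := (Y.left.presheaf.map (homOfLE (Y.left.basicOpen_le r)).op).hom.toAlgebra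
    have hloc : IsLocalization.Away r Γ(Y.left, Y.left.basicOpen r) :=
      hU.isLocalization_basicOpen r
    -- Both `F`-algebra structures are read off from the structure morphism of `Y`, so their
    -- compatibility may be checked on spectra.
    have : IsScalarTower F Γ(Y.left, U) Γ(Y.left, Y.left.basicOpen r) := by
      refine .of_algebraMap_eq' ?_
      refine congrArg CommRingCat.Hom.hom (Spec.map_injective (?_ : Spec.map
        (Spec.preimage (hV.fromSpec ≫ Y.hom)) = Spec.map (Spec.preimage (hU.fromSpec ≫ Y.hom) ≫
        (Y.left.presheaf.map (homOfLE (Y.left.basicOpen_le r)).op))))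
      rw [Spec.map_comp, Spec.map_preimage, Spec.map_preimage, ← Category.assoc]
      exact congrArg (· ≫ Y.hom) (hU.map_fromSpec hV _).symm
    have := H Γ(Y.left, Y.left.basicOpen r)
    convert this using 1
    exact (ι.left.ker.map_ideal (U := ⟨_, hV⟩) (V := ⟨_, hU⟩) (Y.left.basicOpen_le r)).symm

end Good

end BlowUp
namespace BlowUp

/-! ### Functions on the blow-up -/

section Hartogs

variable {R S : Type*} [CommRing R] [CommRing S]

/-- If `b` is regular modulo `a`, it is regular modulo every `aⁿ`: one factor `a` is split off and
cancelled at each stage. -/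
lemma mem_span_pow_of_mul_mem {a b : R} (ha : ∀ x, a * x = 0 → x = 0)
    (hb : ∀ x, b * x ∈ Ideal.span {a} → x ∈ Ideal.span {a}) (n : ℕ) {x : R}
    (hx : b * x ∈ Ideal.span {a ^ n}) : x ∈ Ideal.span {a ^ n} := by
  induction n generalizing x with
  | zero => simp
  | succ n ih =>
    have h1 : b * x ∈ Ideal.span {a} :=
      Ideal.span_singleton_le_span_singleton.mpr (dvd_pow_self a n.succ_ne_zero) hx
    obtain ⟨y, rfl⟩ := Ideal.mem_span_singleton.mp (hb x h1)
    obtain ⟨z, hz⟩ := Ideal.mem_span_singleton.mp hx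
    have h2 : b * y - a ^ n * z = 0 := ha _ (by linear_combination hz)
    have h3 : y ∈ Ideal.span {a ^ n} :=
      ih (Ideal.mem_span_singleton.mpr ⟨z, by linear_combination h2⟩)
    obtain ⟨w, rfl⟩ := Ideal.mem_span_singleton.mp h3
    exact Ideal.mem_span_singleton.mpr ⟨w, by ring⟩

/-- A ring extension which is trivial away from each member of a regular pair is trivial. -/
lemma surjective_of_regular_pair (f : R →+* S) (hf : Function.Injective f) {a b : R}
    (ha : ∀ x, a * x = 0 → x = 0) (hb : ∀ x, b * x ∈ Ideal.span {a} → x ∈ Ideal.span {a})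
    (hfa : ∀ x, f a * x = 0 → x = 0) (h1 : ∀ t, ∃ (n : ℕ) (x : R), f a ^ n * t = f x)
    (h2 : ∀ t, ∃ (n : ℕ) (x : R), f b ^ n * t = f x) : Function.Surjective f := by
  intro t
  obtain ⟨n, x, hx⟩ := h1 t
  obtain ⟨m, y, hy⟩ := h2 t
  -- Both sides represent `aⁿ bᵐ t`. Since `b` is regular modulo `aⁿ`, it follows that `aⁿ` divides
  -- `x`, and the quotient is the preimage of `t`.
  have e : b ^ m * x = a ^ n * y := hf (by
    simp only [map_mul, map_pow]
    linear_combination f a ^ n * hy - f b ^ m * hx)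
  have key (k : ℕ) (z : R) (hz : b ^ k * z ∈ Ideal.span {a ^ n}) : z ∈ Ideal.span {a ^ n} := by
    induction k with
    | zero => simpa using hz
    | succ k ih => exact ih (mem_span_pow_of_mul_mem ha hb n (by rwa [← mul_assoc, ← pow_succ']))
  obtain ⟨w, rfl⟩ := Ideal.mem_span_singleton.mp
    (key m x (Ideal.mem_span_singleton.mpr ⟨y, e⟩))
  have hpow (k : ℕ) (z : S) (hz : f a ^ k * z = 0) : z = 0 := by
    induction k with
    | zero => simpa using hz
    | succ k ih => exact ih (hfa _ (by rwa [← mul_assoc, ← pow_succ']))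
  refine ⟨w, (sub_eq_zero.mp (hpow n _ ?_)).symm⟩
  rw [mul_sub, hx]
  simp

end Hartogs

section Functions

open Scheme

variable {Y : Scheme.{u}} (I : Y.IdealSheafData)

omit I in
lemma presheaf_map_map {U V W : Y.Opens} (i : V ≤ U) (j : W ≤ V) (z : Γ(Y, U)) :
    Y.presheaf.map (homOfLE j).op (Y.presheaf.map (homOfLE i).op z) =
      Y.presheaf.map (homOfLE (j.trans i)).op z := by
  rw [← ConcreteCategory.comp_apply, ← Functor.map_comp]
  rfl

lemma basicOpen_le_centreCompl {U : Y.Opens} (hU : IsAffineOpen U) {c : Γ(Y, U)}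
    (hc : c ∈ I.ideal ⟨U, hU⟩) : Y.basicOpen c ≤ centreCompl I := by
  intro y hy hy'
  have := Set.ext_iff.mp (I.coe_support_inter ⟨U, hU⟩) y
  have h2 := (this.mp ⟨hy', Y.basicOpen_le c hy⟩).1
  rw [Scheme.mem_zeroLocus_iff] at h2
  exact h2 c hc hy

lemma isIso_blowUpπ_app {W : Y.Opens} (hW : W ≤ centreCompl I) : IsIso ((blowUpπ I).app W) := by
  have h1 := isIso_blowUpπ_restrict I W fun y hy hy' ↦ hW hy' hy
  have h2 : IsIso ((blowUpπ I ∣_ W).app ⊤) := inferInstance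
  rw [morphismRestrict_app] at h2
  have h3 : IsIso ((blowUpπ I).app (W.ι ''ᵁ ⊤)) :=
    @IsIso.of_isIso_comp_right _ _ _ _ _ ((blowUpπ I).app (W.ι ''ᵁ ⊤)) _
      (@Functor.map_isIso _ _ _ _ _ _ (blowUp I).presheaf _ (@isIso_op _ _ _ _ _
        (inferInstanceAs (IsIso (eqToHom _))))) h2
  have e : W.ι ''ᵁ ⊤ = W := by simp
  rwa [e] at h3

lemma exists_mem_basicOpen {U : Y.Opens} (hU : IsAffineOpen U) {y : Y} (hy : y ∈ U)
    (hy' : y ∈ centreCompl I) : ∃ c ∈ I.ideal ⟨U, hU⟩, y ∈ Y.basicOpen c := by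
  by_contra! H
  refine hy' ((Set.ext_iff.mp (I.coe_support_inter ⟨U, hU⟩) y).mpr ⟨?_, hy⟩).1
  rw [Scheme.mem_zeroLocus_iff]
  exact H

variable [IsLocallyNoetherian Y]

/-- The preimages of the basic opens `D(c)` with `c ∈ I` cover the complement of the exceptional
divisor over `U`, which is schematically dense. -/
lemma blowUpπ_app_eq_zero {U : Y.Opens} (hU : IsAffineOpen U) {z : Γ(blowUp I, blowUpπ I ⁻¹ᵁ U)}
    (hz : ∀ c ∈ I.ideal ⟨U, hU⟩, (blowUp I).presheaf.map (homOfLE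
      ((blowUpπ I).preimage_mono (Y.basicOpen_le c))).op z = 0) : z = 0 := by
  have h1 : IsSchemeTheoreticallyDominant (blowUpπ I ⁻¹ᵁ centreCompl I).ι :=
    (isCartier_comap_blowUpπ I).isSchemeTheoreticallyDominant_preimage
  have h2 : QuasiCompact (blowUpπ I ⁻¹ᵁ centreCompl I).ι :=
    MorphismProperty.of_isPullback (isPullback_morphismRestrict _ _) inferInstance
  apply (blowUpπ I ⁻¹ᵁ centreCompl I).ι.app_injective
  rw [map_zero, Scheme.Opens.ι_app]
  refine (blowUp I).IsSheaf.section_ext fun (x : blowUp I) hx ↦ ?_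
  obtain ⟨⟨x, hxV⟩, hxU, rfl⟩ := hx
  obtain ⟨c, hc, hxc⟩ := exists_mem_basicOpen I hU hxU hxV
  have hle : blowUpπ I ⁻¹ᵁ Y.basicOpen c ≤
      (blowUpπ I ⁻¹ᵁ centreCompl I).ι ''ᵁ (blowUpπ I ⁻¹ᵁ centreCompl I).ι ⁻¹ᵁ blowUpπ I ⁻¹ᵁ U :=
    fun x' hx' ↦ ⟨⟨x', basicOpen_le_centreCompl I hU hc hx'⟩, Y.basicOpen_le c hx', rfl⟩
  refine ⟨blowUpπ I ⁻¹ᵁ Y.basicOpen c, hle, hxc, ?_⟩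
  refine Eq.trans ?_ ((hz c hc).trans (map_zero ((blowUp I).presheaf.map
    (homOfLE hle).op).hom).symm)
  exact presheaf_map_map _ _ _

/-- A non-zero-divisor remains one on the blow-up. -/
lemma blowUpπ_app_mul_eq_zero {U : Y.Opens} (hU : IsAffineOpen U) {a : Γ(Y, U)}
    (ha : ∀ x, a * x = 0 → x = 0) (z : Γ(blowUp I, blowUpπ I ⁻¹ᵁ U))
    (hz : (blowUpπ I).app U a * z = 0) : z = 0 := by
  refine blowUpπ_app_eq_zero I hU fun c hc ↦ ?_
  have h1 := isIso_blowUpπ_app I (basicOpen_le_centreCompl I hU hc)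
  obtain ⟨w, hw⟩ := ((ConcreteCategory.isIso_iff_bijective _).mp h1).2
    ((blowUp I).presheaf.map (homOfLE ((blowUpπ I).preimage_mono (Y.basicOpen_le c))).op z)
  have h2 : (blowUpπ I).app (Y.basicOpen c) (Y.presheaf.map (homOfLE (Y.basicOpen_le c)).op a) =
      (blowUp I).presheaf.map (homOfLE ((blowUpπ I).preimage_mono (Y.basicOpen_le c))).op
        ((blowUpπ I).app U a) := by
    rw [← ConcreteCategory.comp_apply, (blowUpπ I).naturality]
    rfl
  have h3 := congr((blowUp I).presheaf.map
    (homOfLE ((blowUpπ I).preimage_mono (Y.basicOpen_le c))).op $hz)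
  rw [map_mul, map_zero, ← h2, ← hw, ← map_mul] at h3
  have h4 := ((ConcreteCategory.isIso_iff_bijective _).mp h1).1 (h3.trans (map_zero _).symm)
  have h5 : (Y.presheaf.map (homOfLE (Y.basicOpen_le c)).op).hom.Flat :=
    have := hU.isLocalization_basicOpen c
    RingHom.flat_algebraMap_iff.mpr (IsLocalization.flat _ (Submonoid.powers c))
  rw [← hw, mul_eq_zero_of_flat _ h5 ha w h4, map_zero]

/-- Over `D(c)` the blow-up is an isomorphism, so `t` becomes a fraction `x / cⁿ` there. By
quasi-compactness a section vanishing on `D(c)` is killed by a power of `c`. -/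
lemma exists_blowUpπ_app_pow_mul_eq {U : Y.Opens} (hU : IsAffineOpen U) {c : Γ(Y, U)}
    (hc : c ∈ I.ideal ⟨U, hU⟩) (t : Γ(blowUp I, blowUpπ I ⁻¹ᵁ U)) :
    ∃ (n : ℕ) (x : Γ(Y, U)), (blowUpπ I).app U c ^ n * t = (blowUpπ I).app U x := by
  have h1 := isIso_blowUpπ_app I (basicOpen_le_centreCompl I hU hc)
  have hqc := quasiCompact_blowUpπ I
  have hcpt : IsCompact (blowUpπ I ⁻¹ᵁ U).1 := (blowUpπ I).isCompact_preimage hU.isCompact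
  have nat (x : Γ(Y, U)) : (blowUpπ I).app (Y.basicOpen c)
      (Y.presheaf.map (homOfLE (Y.basicOpen_le c)).op x) =
      (blowUp I).presheaf.map (homOfLE ((blowUpπ I).preimage_mono (Y.basicOpen_le c))).op
        ((blowUpπ I).app U x) := by
    rw [← ConcreteCategory.comp_apply, (blowUpπ I).naturality]
    rfl
  obtain ⟨w, hw⟩ := ((ConcreteCategory.isIso_iff_bijective _).mp h1).2
    ((blowUp I).presheaf.map (homOfLE ((blowUpπ I).preimage_mono (Y.basicOpen_le c))).op t)
  have := hU.isLocalization_basicOpen c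
  obtain ⟨n, x, hx⟩ := IsLocalization.Away.surj c w
  have key : (blowUp I).presheaf.map (homOfLE ((blowUpπ I).preimage_mono (Y.basicOpen_le c))).op
      ((blowUpπ I).app U c ^ n * t - (blowUpπ I).app U x) = 0 := by
    rw [map_sub, map_mul, map_pow, ← hw, ← nat, ← nat, ← map_pow, ← map_mul, ← map_sub]
    refine (congrArg _ ?_).trans (map_zero ((blowUpπ I).app (Y.basicOpen c)).hom)
    rw [sub_eq_zero, mul_comm]
    exact hx
  obtain ⟨m, hm⟩ := exists_pow_mul_eq_zero_of_res_basicOpen_eq_zero_of_isCompact _ hcpt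
    ((blowUpπ I).app U c ^ n * t - (blowUpπ I).app U x) ((blowUpπ I).app U c) (by
      have e : (blowUp I).basicOpen ((blowUpπ I).app U c) ≤ blowUpπ I ⁻¹ᵁ Y.basicOpen c := by
        rw [Scheme.preimage_basicOpen]
      have := congr((blowUp I).presheaf.map (homOfLE e).op $key)
      rw [map_zero, ← ConcreteCategory.comp_apply, ← Functor.map_comp] at this
      exact this)
  refine ⟨m + n, c ^ m * x, ?_⟩
  simp only [map_mul, map_pow]
  linear_combination hm

/-- Hartogs extension: functions on the blow-up have denominators that are powers of `a` and also
powers of `b`, so they come from the base. -/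
lemma isIso_blowUpπ_app_of_regular_pair {U : Y.Opens} (hU : IsAffineOpen U) {a b : Γ(Y, U)}
    (haI : a ∈ I.ideal ⟨U, hU⟩) (hbI : b ∈ I.ideal ⟨U, hU⟩) (ha : ∀ x, a * x = 0 → x = 0)
    (hb : ∀ x, b * x ∈ Ideal.span {a} → x ∈ Ideal.span {a}) : IsIso ((blowUpπ I).app U) := by
  have hinj : Function.Injective ((blowUpπ I).app U) := by
    refine (injective_iff_map_eq_zero ((blowUpπ I).app U).hom).mpr fun r hr ↦ ?_
    have h1 := isIso_blowUpπ_app I (basicOpen_le_centreCompl I hU haI)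
    have h2 : (blowUpπ I).app (Y.basicOpen a) (algebraMap _ _ r) = 0 := by
      change (blowUpπ I).app (Y.basicOpen a) (Y.presheaf.map (homOfLE (Y.basicOpen_le a)).op r) = 0
      rw [← ConcreteCategory.comp_apply, (blowUpπ I).naturality, ConcreteCategory.comp_apply]
      exact (congrArg _ hr).trans (map_zero _)
    have h3 := ((ConcreteCategory.isIso_iff_bijective _).mp h1).1 (h2.trans (map_zero _).symm)
    have := hU.isLocalization_basicOpen a
    obtain ⟨⟨_, n, rfl⟩, hn⟩ := (IsLocalization.map_eq_zero_iff (Submonoid.powers a) _ r).mp h3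
    dsimp only at hn
    induction n with
    | zero => simpa using hn
    | succ n ih => exact ih (ha _ (by rwa [← mul_assoc, ← pow_succ']))
  refine (ConcreteCategory.isIso_iff_bijective _).mpr ⟨hinj, ?_⟩
  exact surjective_of_regular_pair ((blowUpπ I).app U).hom hinj ha hb
    (blowUpπ_app_mul_eq_zero I hU ha) (exists_blowUpπ_app_pow_mul_eq I hU haI)
    (exists_blowUpπ_app_pow_mul_eq I hU hbI)

end Functions

section BaseChange

open Scheme

/-- Flat base change for functions: those on `X'` over the preimage of `U` are the pushout of those
on `X`, and a pushout of an isomorphism is an isomorphism. -/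
lemma isIso_app_of_isPullback {X Y X' Y' : Scheme.{u}} {f : X ⟶ Y} {f' : X' ⟶ Y'} {g' : X' ⟶ X}
    {g : Y' ⟶ Y} (H : IsPullback g' f' f g) [Flat g] [QuasiCompact f] [QuasiSeparated f]
    {U : Y.Opens} (hU : IsAffineOpen U) (hU' : IsAffineOpen (g ⁻¹ᵁ U)) (h : IsIso (f.app U)) :
    IsIso (f'.app (g ⁻¹ᵁ U)) := by
  have e : f' ⁻¹ᵁ g ⁻¹ᵁ U = g' ⁻¹ᵁ f ⁻¹ᵁ U ⊓ f' ⁻¹ᵁ g ⁻¹ᵁ U := by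
    rw [← Scheme.Hom.comp_preimage, ← Scheme.Hom.comp_preimage, H.w, inf_idem]
  have h1 := (isIso_pushoutSection_iff H le_rfl le_rfl e).mp
    (isIso_pushoutSection_of_isQuasiSeparated_of_flat_right H le_rfl le_rfl e hU hU'
    (f.isCompact_preimage hU.isCompact) (f.isQuasiSeparated_preimage hU.isQuasiSeparated))
  rw [← Scheme.Hom.app_eq_appLE] at h1
  have := h1.isIso_inr_of_isIso
  rwa [← Scheme.Hom.app_eq_appLE] at this

variable {F : Type u} [Field F]

lemma isAffineOpen_proj_preimage (Y : Over (Spec (.of F))) (A : CommAlgCat.{u} F)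
    {U : Y.left.Opens} (hU : IsAffineOpen U) : IsAffineOpen (proj Y A ⁻¹ᵁ U) := by
  have : IsAffineHom (proj Y A) :=
    MorphismProperty.of_isPullback (isPullback_proj Y A).flip inferInstance
  exact hU.preimage _

variable {Z Y : Over (Spec (.of F))} (ι : Z ⟶ Y) [IsClosedImmersion ι.left]

omit [IsClosedImmersion ι.left] in
lemma isIso_extendMap_app (hY : IsVariety Y) {U : Y.left.Opens} (hU : IsAffineOpen U)
    (h : letI := sectionsAlgebra Y hU; HasRegularPair F (ι.left.ker.ideal ⟨U, hU⟩))
    (A : CommAlgCat.{u} F) :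
    IsIso ((extendMap (blowUpHom ι) A).left.app (proj Y A ⁻¹ᵁ U)) := by
  have := isLocallyNoetherian_of_isVariety hY
  obtain ⟨a, haI, b, hbI, ha, hb, -⟩ := h
  have h1 := isIso_blowUpπ_app_of_regular_pair ι.left.ker hU haI hbI ha hb
  have hqc := quasiCompact_blowUpπ ι.left.ker
  have hqs : QuasiSeparated (blowUpπ ι.left.ker) := inferInstance
  have h2 : IsPullback (proj (blowUpOver ι) A) (extendMap (blowUpHom ι) A).left
    (blowUpπ ι.left.ker) (proj Y A) := isPullback_extendMap (blowUpHom ι) A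
  exact @isIso_app_of_isPullback _ _ _ _ _ _ _ _ h2 inferInstance hqc hqs _ hU (isAffineOpen_proj_preimage Y A hU) h1

end BaseChange

end BlowUp
namespace BlowUp

/-! ### Descending automorphisms of the blow-up -/

section Points

open Scheme TensorProduct

variable {F : Type u} [Field F] {A : Type u} [CommRing A] [Algebra F A]

lemma isPullback_transition (X : Over (Spec (.of F))) {A B : CommAlgCat.{u} F} (h : A ⟶ B) :
    IsPullback (transition X h) (extend X B).hom (extend X A).hom
      (Spec.map (CommRingCat.ofHom h.hom.toRingHom)) := by
  refine IsPullback.of_right ?_ (transition_hom X h) (isPullback_proj X A)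
  rw [transition_fst, specMap_structMap]
  exact isPullback_proj X B

/-- Modulo nilpotents every tensor equals `1 ⊗ ρ(z)`, since `a - ρ(a)` lies in the maximal ideal of
the artinian local ring `A`. -/
lemma isNilpotent_of_residueMap_eq_zero [IsLocalRing A] [Module.Finite F A] (ρ : A →ₐ[F] F)
    (B : CommAlgCat.{u} F) {z : A ⊗[F] B} (hz : residueMap ρ B z = 0) : IsNilpotent z := by
  have key (z : A ⊗[F] B) : z - 1 ⊗ₜ residueMap ρ B z ∈ nilradical (A ⊗[F] B) := by
    induction z with
    | zero => simp
    | add x y hx hy =>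
      rw [map_add, tmul_add, add_sub_add_comm]
      exact add_mem hx hy
    | tmul a b =>
      have : IsArtinianRing A := IsArtinianRing.of_finite F A
      have h1 : IsNilpotent (a - algebraMap F A (ρ a)) := by
        rw [Ring.KrullDimLE.isNilpotent_iff_mem_maximalIdeal, IsLocalRing.mem_maximalIdeal]
        intro hu
        have := hu.map ρ
        simp at this
      have h2 : (a ⊗ₜ b - 1 ⊗ₜ residueMap ρ B (a ⊗ₜ b) : A ⊗[F] B) =
          (a - algebraMap F A (ρ a)) ⊗ₜ[F] b := by
        have : residueMap ρ B (a ⊗ₜ b) = ρ a • b := by simp [residueMap]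
        rw [this, sub_tmul, Algebra.algebraMap_eq_smul_one, smul_tmul]
      rw [h2, mem_nilradical, ← mul_one (a - _), ← one_mul b, ← Algebra.TensorProduct.tmul_mul_tmul]
      exact (Commute.all _ _).isNilpotent_mul_right
        (h1.map (Algebra.TensorProduct.includeLeft (S := F)))
  have := key z
  rw [hz, tmul_zero, sub_zero] at this
  exact mem_nilradical.mp this

lemma surjective_transition_residueMap [IsLocalRing A] [Module.Finite F A] (ρ : A →ₐ[F] F)
    (B : CommAlgCat.{u} F) (X : Over (Spec (.of F))) :
    Function.Surjective (transition X (residueMap ρ B)) := by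
  have h1 : Surjective (Spec.map (CommRingCat.ofHom (residueMap ρ B).hom.toRingHom)) := by
    refine ⟨(PrimeSpectrum.isHomeomorph_comap (residueMap ρ B).hom.toRingHom (fun x ↦ ?_)
      fun z hz ↦ isNilpotent_of_residueMap_eq_zero ρ B hz).surjective⟩
    refine ⟨1, one_pos, 1 ⊗ₜ x, ?_⟩
    change residueMap ρ B (1 ⊗ₜ x) = _
    simp [residueMap]
  have h2 : Surjective (transition X (residueMap ρ B)) :=
    MorphismProperty.of_isPullback (isPullback_transition X (residueMap ρ B)).flip h1
  exact h2.1

lemma transition_left_eq {X : Over (Spec (.of F))} {A B : CommAlgCat.{u} F} {h : A ⟶ B}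
    {g : Aut (extend X A)} (hg : autMap X h g = 1) : transition X h ≫ g.hom.left = transition X h := by
  have h1 : baseChangeHom h g.hom = 𝟙 _ := congr(($hg).hom)
  have h2 := baseChangeHom_transition h g.hom
  rw [h1] at h2
  rw [← h2]
  exact Category.id_comp _

/-- Every point comes from the base change to `B`, because `A ⊗ B → B` is surjective with nil
kernel; there `g` restricts to the identity. -/
lemma hom_left_apply_eq [IsLocalRing A] [Module.Finite F A] (ρ : A →ₐ[F] F)
    (B : CommAlgCat.{u} F) {X : Over (Spec (.of F))} {g : Aut (extend X (.of F (A ⊗[F] B)))}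
    (hg : autMap X (residueMap ρ B) g = 1) (x : (extend X (.of F (A ⊗[F] B))).left) :
    g.hom.left x = x := by
  obtain ⟨y, rfl⟩ := surjective_transition_residueMap ρ B X x
  exact congr($(transition_left_eq hg) y)

end Points

/-! ### Descending morphisms along a dominant map with the same local functions -/

section Descent

open Scheme

variable {X Y W : Scheme.{u}} (π : X ⟶ Y) [QuasiCompact π] [IsSchemeTheoreticallyDominant π]

-- A morphism to the affine `V` is a ring map from its functions, and those on `π ⁻¹ᵁ U` are the
-- functions on `U`.
omit [QuasiCompact π] [IsSchemeTheoreticallyDominant π] in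
lemma exists_local_desc (h : X ⟶ W) {U : Y.Opens} (hU : IsIso (π.app U)) {V : W.Opens}
    (hV : IsAffineOpen V) (hle : π ⁻¹ᵁ U ≤ h ⁻¹ᵁ V) :
    ∃ f : U.toScheme ⟶ W, π ∣_ U ≫ f = (π ⁻¹ᵁ U).ι ≫ h := by
  refine ⟨U.toSpecΓ ≫ Spec.map (h.appLE V (π ⁻¹ᵁ U) hle ≫ inv (π.app U)) ≫ hV.fromSpec, ?_⟩
  rw [← Category.assoc, ← Scheme.Opens.toSpecΓ_naturality, Category.assoc, ← Spec.map_comp_assoc,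
    Category.assoc, IsIso.inv_hom_id, Category.comp_id, Scheme.Opens.toSpecΓ_SpecMap_appLE_assoc,
    hV.toSpecΓ_fromSpec, Scheme.Hom.resLE_comp_ι]

/-- After pulling `π` back to `P`, both sides become `h`. The pullback is schematically dominant
since `P` is flat over `Y`, and `W` is separated. -/
lemma hom_ext_of_local_desc [W.IsSeparated] (h : X ⟶ W) {ι : Type u} (U : ι → Y.Opens)
    (f : ∀ i, (U i).toScheme ⟶ W) (hf : ∀ i, π ∣_ (U i) ≫ f i = (π ⁻¹ᵁ (U i)).ι ≫ h)
    {P : Scheme.{u}} {i j : ι} (p : P ⟶ U i) (q : P ⟶ U j) [Flat (p ≫ (U i).ι)]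
    (hpq : p ≫ (U i).ι = q ≫ (U j).ι) : p ≫ f i = q ≫ f j := by
  have key {i : ι} {P' : Scheme.{u}} (p' : P' ⟶ U i) (k : P' ⟶ X) (e : k ≫ π = p' ≫ (U i).ι) :
      p' ≫ f i = k ≫ h := by
    have H := (isPullback_morphismRestrict π (U i)).flip
    rw [← H.lift_snd k p' e, Category.assoc, hf, ← Category.assoc, H.lift_fst]
  refine hom_ext_of_isSchemeTheoreticallyDominant (terminal.from W) (Subsingleton.elim _ _)
    (pullback.snd π (p ≫ (U i).ι)) ?_
  rw [← Category.assoc, ← Category.assoc,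
    key (pullback.snd π (p ≫ (U i).ι) ≫ p) (pullback.fst _ _) (by
      rw [pullback.condition, Category.assoc]),
    key (pullback.snd π (p ≫ (U i).ι) ≫ q) (pullback.fst _ _) (by
      rw [pullback.condition, Category.assoc, hpq])]

lemma exists_desc [W.IsSeparated] (h : X ⟶ W)
    (H : ∀ y : Y, ∃ (U : Y.Opens) (V : W.Opens), y ∈ U ∧ IsIso (π.app U) ∧ IsAffineOpen V ∧
      π ⁻¹ᵁ U ≤ h ⁻¹ᵁ V) : ∃ f : Y ⟶ W, π ≫ f = h := by
  choose U V hyU hU hV hle using H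
  choose f hf using fun y ↦ exists_local_desc π h (hU y) (hV y) (hle y)
  have hcov : TopologicalSpace.IsOpenCover U :=
    top_le_iff.mp fun t _ ↦ TopologicalSpace.Opens.mem_iSup.mpr ⟨t, hyU t⟩
  let 𝒰 := Y.openCoverOfIsOpenCover _ hcov
  let g : Y ⟶ W := 𝒰.glueMorphisms f fun i j ↦ by
    have hfl : Flat (pullback.fst (𝒰.f i) (𝒰.f j) ≫ 𝒰.f i) := inferInstance
    exact @hom_ext_of_local_desc _ _ _ π _ _ _ h _ U f hf _ i j _ _ hfl pullback.condition
  have hg (y : Y) : (U y).ι ≫ g = f y := 𝒰.ι_glueMorphisms _ _ y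
  refine ⟨g, (X.openCoverOfIsOpenCover _ (hcov.comap π.base.hom)).hom_ext _ _ fun (y : Y) ↦ ?_⟩
  change (π ⁻¹ᵁ U y).ι ≫ _ = (π ⁻¹ᵁ U y).ι ≫ _
  rw [← Category.assoc, ← morphismRestrict_ι, Category.assoc, hg, hf]

end Descent

section DescentAut

open Scheme TensorProduct

variable {F : Type u} [Field F] {Z Y : Over (Spec (.of F))} (ι : Z ⟶ Y) [IsClosedImmersion ι.left]
  (hY : IsVariety Y) [Smooth Y.hom] [Smooth Z.hom] (hι : ComponentsCodimGE ι 2)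

include hY hι in
/-- An endomorphism of the base change of the blow-up which fixes all points descends. -/
lemma exists_desc_extend {A : CommAlgCat.{u} F}
    (g : extend (blowUpOver ι) A ⟶ extend (blowUpOver ι) A) (hg : ∀ x, g.left x = x) :
    ∃ f : extend Y A ⟶ extend Y A,
      extendMap (blowUpHom ι) A ≫ f = g ≫ extendMap (blowUpHom ι) A := by
  have hN := hι.containsNoComponent ι two_ne_zero
  have := isLocallyNoetherian_of_isVariety hY
  have hqc : QuasiCompact (extendMap (blowUpHom ι) A).left :=
    MorphismProperty.of_isPullback (isPullback_extendMap (blowUpHom ι) A)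
      (quasiCompact_blowUpπ ι.left.ker)
  have hstd := isSchemeTheoreticallyDominant_extendMap ι hY hN A
  have hsep : Y.left.IsSeparated := by
    have := hY.isSeparated
    refine ⟨?_⟩
    rw [← terminal.comp_from Y.hom]
    infer_instance
  -- The descent takes values in `Y`, whose affine opens carry the regular pairs; the component in
  -- `Spec A` is restored afterwards. Because `g` fixes points, the composite sends the preimage of
  -- `U` into `U`.
  obtain ⟨f, hf⟩ := exists_desc (extendMap (blowUpHom ι) A).left
    (g.left ≫ (extendMap (blowUpHom ι) A).left ≫ proj Y A) fun y ↦ by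
      obtain ⟨U, hU, hyU, h⟩ := exists_affineOpens_hasRegularPair ι hι (proj Y A y)
      refine ⟨proj Y A ⁻¹ᵁ U, U, hyU, isIso_extendMap_app ι hY hU h A, hU, fun x hx ↦ ?_⟩
      change proj Y A ((extendMap (blowUpHom ι) A).left (g.left x)) ∈ U
      rw [hg x]
      exact hx
  have e1 : g.left ≫ (extendMap (blowUpHom ι) A).left ≫ (extend Y A).hom =
      (extendMap (blowUpHom ι) A).left ≫ (extend Y A).hom := by
    have e2 : (extendMap (blowUpHom ι) A).left ≫ (extend Y A).hom = _ :=
      Over.w (extendMap (blowUpHom ι) A)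
    rw [e2]
    exact Over.w g
  have hw : f ≫ Y.hom = (extend Y A).hom ≫ structMap A := by
    refine hom_ext_of_isSchemeTheoreticallyDominant (terminal.from _) (Subsingleton.elim _ _)
      (extendMap (blowUpHom ι) A).left ?_
    rw [← Category.assoc, hf, Category.assoc, Category.assoc, (isPullback_proj Y A).w]
    exact congrArg (· ≫ structMap A) e1
  refine ⟨Over.homMk (pullback.lift f (extend Y A).hom hw) (pullback.lift_snd _ _ _), ?_⟩
  apply Over.OverMorphism.ext
  apply pullback.hom_ext
  · rw [Over.comp_left, Over.comp_left, Category.assoc, Category.assoc]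
    exact (congrArg (_ ≫ ·) (pullback.lift_fst _ _ _)).trans hf
  · exact (Over.w (_ ≫ _)).trans (Over.w (g ≫ _)).symm

include hY hι in
lemma exists_desc_aut {A : CommAlgCat.{u} F} (g : Aut (extend (blowUpOver ι) A))
    (hg : ∀ x, g.hom.left x = x) : ∃ f : Aut (extend Y A),
      extendMap (blowUpHom ι) A ≫ f.hom = g.hom ≫ extendMap (blowUpHom ι) A := by
  have hN := hι.containsNoComponent ι two_ne_zero
  have h1 : g.hom ≫ g.inv = 𝟙 _ := g.hom_inv_id
  have h2 : g.inv ≫ g.hom = 𝟙 _ := g.inv_hom_id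
  have hg' (x) : g.inv.left x = x := by
    have := congr(($h1).left x)
    rw [Over.comp_left, Scheme.Hom.comp_apply, hg] at this
    exact this
  obtain ⟨f, hf⟩ := exists_desc_extend ι hY hι g.hom hg
  obtain ⟨f', hf'⟩ := exists_desc_extend ι hY hι g.inv hg'
  refine ⟨⟨f, f', extend_hom_ext_of_blowUp ι hY hN ?_, extend_hom_ext_of_blowUp ι hY hN ?_⟩, hf⟩
  · rw [← Category.assoc, hf, Category.assoc, hf', ← Category.assoc, h1, Category.id_comp,
      Category.comp_id]
  · rw [← Category.assoc, hf', Category.assoc, hf, ← Category.assoc, h2, Category.id_comp,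
      Category.comp_id]

omit [Smooth Z.hom] in
include hY in
lemma autMap_eq_one_of_desc (hN : ContainsNoComponent ι) {A B : CommAlgCat.{u} F} (h : A ⟶ B)
    {g : Aut (extend (blowUpOver ι) A)} {f : Aut (extend Y A)}
    (hf : extendMap (blowUpHom ι) A ≫ f.hom = g.hom ≫ extendMap (blowUpHom ι) A)
    (hg : autMap _ h g = 1) : autMap Y h f = 1 := by
  refine Aut.ext (extend_hom_ext_of_blowUp ι hY hN ?_)
  have h1 : baseChangeHom h g.hom = 𝟙 _ := congr(($hg).hom)
  change _ ≫ baseChangeHom h f.hom = _ ≫ 𝟙 _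
  rw [← baseChangeHom_extendMap h, ← baseChangeHom_comp, hf, baseChangeHom_comp, h1,
    Category.id_comp, Category.comp_id]

end DescentAut

end BlowUp
namespace BlowUp

/-! ### Automorphisms of the blow-up fixing all points stabilise the centre -/

section Charts

open Scheme TensorProduct

variable {F : Type u} [Field F] {X Y : Over (Spec (.of F))} {R S : CommRingCat.{u}}
  [Algebra F R] [Algebra F S]

/-- The base change of a morphism `Spec S ⟶ X` of `F`-schemes. -/
def extendChart (c : Spec S ⟶ X.left)
    (hc : c ≫ X.hom = Spec.map (CommRingCat.ofHom (algebraMap F S))) (A : CommAlgCat.{u} F) :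
    Spec (.of (S ⊗[F] A)) ⟶ (extend X A).left :=
  pullback.lift
    (Spec.map (CommRingCat.ofHom (Algebra.TensorProduct.includeLeftRingHom : S →+* S ⊗[F] A)) ≫ c)
    (Spec.map (CommRingCat.ofHom (Algebra.TensorProduct.includeRight : A →ₐ[F] S ⊗[F] A).toRingHom))
    (by
      rw [Category.assoc, hc]
      exact ((CommRingCat.isPushout_tensorProduct F S A).op.map Scheme.Spec).w.symm)

variable (c : Spec S ⟶ X.left) (hc : c ≫ X.hom = Spec.map (CommRingCat.ofHom (algebraMap F S)))
  (u : Spec R ⟶ Y.left) (hu : u ≫ Y.hom = Spec.map (CommRingCat.ofHom (algebraMap F R)))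
  (A : CommAlgCat.{u} F)

lemma extendChart_proj : extendChart c hc A ≫ proj X A =
    Spec.map (CommRingCat.ofHom (Algebra.TensorProduct.includeLeftRingHom : S →+* S ⊗[F] A)) ≫ c :=
  pullback.lift_fst _ _ _

lemma extendChart_hom : extendChart c hc A ≫ (extend X A).hom =
    Spec.map (CommRingCat.ofHom
      (Algebra.TensorProduct.includeRight : A →ₐ[F] S ⊗[F] A).toRingHom) :=
  pullback.lift_snd _ _ _

lemma isPullback_extendChart : IsPullback
    (Spec.map (CommRingCat.ofHom (Algebra.TensorProduct.includeLeftRingHom : S →+* S ⊗[F] A)))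
    (extendChart c hc A) c (proj X A) := by
  refine IsPullback.of_bot ?_ (extendChart_proj c hc A).symm (isPullback_proj X A)
  rw [extendChart_hom, hc]
  exact ((CommRingCat.isPushout_tensorProduct F S A).op.map Scheme.Spec).flip

instance [IsOpenImmersion c] : IsOpenImmersion (extendChart c hc A) :=
  MorphismProperty.of_isPullback (isPullback_extendChart c hc A) inferInstance

lemma mem_range_extendChart (x : (extend X A).left) (hx : proj X A x ∈ Set.range c) :
    x ∈ Set.range (extendChart c hc A) := by
  have h1 : x ∈ Set.range (pullback.snd c (proj X A)) := by
    rw [Scheme.Pullback.range_snd]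
    exact hx
  obtain ⟨y, rfl⟩ := h1
  rw [← (isPullback_extendChart c hc A).isoPullback_inv_snd]
  exact ⟨_, rfl⟩

variable {A}

lemma extendChart_extendMap (β : X ⟶ Y) (φ : R →ₐ[F] S)
    (h : c ≫ β.left = Spec.map (CommRingCat.ofHom φ.toRingHom) ≫ u) :
    extendChart c hc A ≫ (extendMap β A).left =
      Spec.map (CommRingCat.ofHom (Algebra.TensorProduct.map φ (AlgHom.id F A)).toRingHom) ≫
        extendChart u hu A := by
  apply pullback.hom_ext
  · rw [Category.assoc, Category.assoc]
    refine (congrArg (_ ≫ ·) (extendMap_proj β A)).trans ?_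
    refine Eq.trans ?_ (congrArg (_ ≫ ·) (extendChart_proj u hu A)).symm
    rw [← Category.assoc]
    refine (congrArg (· ≫ β.left) (extendChart_proj c hc A)).trans ?_
    rw [Category.assoc, h, ← Category.assoc, ← Category.assoc, ← Spec.map_comp, ← Spec.map_comp]
    congr 2
  · rw [Category.assoc, Category.assoc]
    refine (congrArg (_ ≫ ·) (Over.w (extendMap β A))).trans ?_
    refine (extendChart_hom c hc A).trans ?_
    refine Eq.trans ?_ (congrArg (_ ≫ ·) (extendChart_hom u hu A)).symm
    rw [← Spec.map_comp]
    congr 1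
    ext r
    simp

/-- A morphism fixing all points maps each open chart into itself, so it is given there by a ring
endomorphism. -/
lemma exists_specMap_extendChart [IsOpenImmersion c] {g : (extend X A).left ⟶ (extend X A).left}
    (hg : ∀ x, g x = x) : ∃ γ : S ⊗[F] A →+* S ⊗[F] A,
      Spec.map (CommRingCat.ofHom γ) ≫ extendChart c hc A = extendChart c hc A ≫ g := by
  have hr : Set.range (extendChart c hc A ≫ g) ⊆ Set.range (extendChart c hc A) := by
    rintro _ ⟨x, rfl⟩
    rw [Scheme.Hom.comp_apply, hg]
    exact ⟨x, rfl⟩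
  refine ⟨(Spec.preimage (IsOpenImmersion.lift (extendChart c hc A) _ hr)).hom, ?_⟩
  rw [CommRingCat.ofHom_hom, Spec.map_preimage, IsOpenImmersion.lift_fac]

include hc in
lemma surjective_of_specMap_extendChart [IsOpenImmersion c] {g : Aut (extend X A)}
    (hg : ∀ x, g.hom.left x = x) {γ : S ⊗[F] A →+* S ⊗[F] A}
    (hγ : Spec.map (CommRingCat.ofHom γ) ≫ extendChart c hc A =
      extendChart c hc A ≫ g.hom.left) : Function.Surjective γ := by
  have h1 : g.hom ≫ g.inv = 𝟙 _ := g.hom_inv_id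
  have hg' (x) : g.inv.left x = x := by
    have := congr(($h1).left x)
    rw [Over.comp_left, Scheme.Hom.comp_apply, hg] at this
    exact this
  obtain ⟨γ', hγ'⟩ := exists_specMap_extendChart c hc hg'
  have h2 : Spec.map (CommRingCat.ofHom (γ.comp γ')) = 𝟙 _ := by
    rw [CommRingCat.ofHom_comp, Spec.map_comp, ← cancel_mono (extendChart c hc A), Category.assoc,
      hγ', ← Category.assoc, hγ, Category.assoc, ← Over.comp_left, h1]
    exact (Category.comp_id _).trans (Category.id_comp _).symm
  have h3 : γ.comp γ' = RingHom.id _ := by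
    have := Spec.map_injective (h2.trans (Spec.map_id _).symm)
    exact congrArg CommRingCat.Hom.hom this
  exact fun s ↦ ⟨γ' s, RingHom.congr_fun h3 s⟩

-- On the chart, `g` is a surjective ring endomorphism lying over `σ`, so the base-changed chart and
-- derivation satisfy the hypotheses of `IsAffineChart.map_mem_of_derivation`.
include hc in
lemma map_mem_of_extendChart [IsOpenImmersion c] [IsOpenImmersion u] (β : X ⟶ Y) (φ : R →ₐ[F] S)
    (h : c ≫ β.left = Spec.map (CommRingCat.ofHom φ.toRingHom) ≫ u) {I : Ideal R} {a b : R}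
    (hφ : IsAffineChart φ.toRingHom I a) (ha : ∀ x, a * x = 0 → x = 0)
    (H : ∀ m r, a ^ m * r ∈ I ^ (m + 1) → r ∈ I) (δ : Derivation F R R) (hδa : δ a ∈ I)
    (hb : b ∈ I) (hδb : δ b - 1 ∈ I) {g : Aut (extend X A)} (hg : ∀ x, g.hom.left x = x)
    {f : Aut (extend Y A)} (hfg : extendMap β A ≫ f.hom = g.hom ≫ extendMap β A)
    {σ : R ⊗[F] A →+* R ⊗[F] A} (hσ : Spec.map (CommRingCat.ofHom σ) ≫ extendChart u hu A =
      extendChart u hu A ≫ f.hom.left) {x : R ⊗[F] A}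
    (hx : x ∈ I.map (Algebra.TensorProduct.includeLeftRingHom : R →+* R ⊗[F] A)) :
    σ x ∈ I.map (Algebra.TensorProduct.includeLeftRingHom : R →+* R ⊗[F] A) := by
  obtain ⟨γ, hγ⟩ := exists_specMap_extendChart c hc hg
  have hinj : Function.Injective φ := by
    refine (injective_iff_map_eq_zero φ).mpr fun r hr ↦ ?_
    obtain ⟨k, hk⟩ := hφ.ker r hr
    induction k with
    | zero => simpa using hk
    | succ k ih => exact ih (ha _ (by rwa [← mul_assoc, ← pow_succ']))
  have hcomm : γ.comp (Algebra.TensorProduct.map φ (AlgHom.id F A)).toRingHom =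
      (Algebra.TensorProduct.map φ (AlgHom.id F A)).toRingHom.comp σ := by
    have e : Spec.map (CommRingCat.ofHom (γ.comp
        (Algebra.TensorProduct.map φ (AlgHom.id F A)).toRingHom)) = Spec.map (CommRingCat.ofHom
        ((Algebra.TensorProduct.map φ (AlgHom.id F A)).toRingHom.comp σ)) := by
      rw [CommRingCat.ofHom_comp, CommRingCat.ofHom_comp, Spec.map_comp, Spec.map_comp,
        ← cancel_mono (extendChart u hu A), Category.assoc, Category.assoc, hσ,
        ← extendChart_extendMap c hc u hu β φ h, ← Category.assoc, hγ, ← Category.assoc,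
        ← extendChart_extendMap c hc u hu β φ h, Category.assoc, Category.assoc]
      exact congrArg (_ ≫ ·) congr(($hfg).left).symm
    exact congrArg CommRingCat.Hom.hom (Spec.map_injective e)
  refine (hφ.baseChange φ A hinj).map_mem_of_derivation (baseChangeDerivation A δ) (b := b ⊗ₜ 1)
    ?_ (Ideal.mem_map_of_mem _ hb) ?_ (fun r hr ↦ ?_) γ
    (surjective_of_specMap_extendChart c hc hg hγ) σ (fun r ↦ RingHom.congr_fun hcomm r) hx
  · rw [baseChangeDerivation_tmul]
    exact Ideal.mem_map_of_mem _ hδa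
  · rw [baseChangeDerivation_tmul, Algebra.TensorProduct.one_def, ← sub_tmul]
    exact Ideal.mem_map_of_mem _ hδb
  · refine mem_map_of_dvd_baseChange φ A (fun r hr ↦ hφ.mem_of_dvd hinj H hr) hφ.dvd ?_
    simpa using hr

end Charts

section Stable

open Scheme TensorProduct

/-- Inclusions of ideal sheaves can be tested on affine charts. -/
lemma le_of_comap_le {X : Scheme.{u}} {J K : X.IdealSheafData} {κ : Type*} (R : κ → CommRingCat.{u})
    (c : ∀ i, Spec (R i) ⟶ X) [∀ i, IsOpenImmersion (c i)] (hc : ∀ x, ∃ i, x ∈ Set.range (c i))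
    (h : ∀ i, (J.comap (c i)).ideal ⟨⊤, isAffineOpen_top _⟩ ≤
      (K.comap (c i)).ideal ⟨⊤, isAffineOpen_top _⟩) : J ≤ K := by
  refine IdealSheafData.le_of_iSup_eq_top (fun i ↦ ⟨(c i).opensRange, isAffineOpen_opensRange _⟩)
    (top_le_iff.mp fun x _ ↦ TopologicalSpace.Opens.mem_iSup.mpr (hc x)) fun i x hx ↦ ?_
  have hle : (⊤ : (Spec (R i)).Opens) ≤ c i ⁻¹ᵁ (c i).opensRange := fun y _ ↦ ⟨y, rfl⟩
  have h1 := h i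
  rw [ideal_comap _ _ ⟨(c i).opensRange, isAffineOpen_opensRange _⟩ _ hle,
    ideal_comap _ _ ⟨(c i).opensRange, isAffineOpen_opensRange _⟩ _ hle] at h1
  have h2 : Function.Bijective ((c i).appLE (c i).opensRange ⊤ hle).hom := by
    have : IsIso ((c i).appLE (c i).opensRange ⊤ hle) := by
      have h3 : IsIso ((c i).app (c i).opensRange) := (c i).isIso_app _ le_rfl
      rw [Scheme.Hom.appLE]
      have h4 : c i ⁻¹ᵁ (c i).opensRange = ⊤ := top_le_iff.mp hle
      have h5 : IsIso (homOfLE hle) := ⟨homOfLE h4.le, Subsingleton.elim _ _, Subsingleton.elim _ _⟩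
      infer_instance
    exact (ConcreteCategory.isIso_iff_bijective _).mp this
  have h3 := h1 (Ideal.mem_map_of_mem _ hx)
  rw [Ideal.mem_map_iff_of_surjective _ h2.2] at h3
  obtain ⟨y, hy, e⟩ := h3
  rwa [← h2.1 e]

lemma isOpenImmersion_chart {Y : Scheme.{u}} (I : Y.IdealSheafData) (U : Y.affineOpens)
    {a : Γ(Y, U.1)} (ha : a ∈ I.ideal U) :
    IsOpenImmersion (affineBlowUpChart ha ≫ blowUpι I U) :=
  inferInstance

variable {F : Type u} [Field F] {Z Y : Over (Spec (.of F))} (ι : Z ⟶ Y) [IsClosedImmersion ι.left]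
  [Smooth Y.hom] [Smooth Z.hom] (hι : ComponentsCodimGE ι 2)

-- `f` preserves the ideal of `Z_A`. This is checked on affine opens with a regular pair `a, b`,
-- where the single chart `R[I/a]` suffices even though it does not cover the blow-up.
include hι in
lemma comap_le_of_desc {A : CommAlgCat.{u} F} {g : Aut (extend (blowUpOver ι) A)}
    (hg : ∀ x, g.hom.left x = x) {f : Aut (extend Y A)} (hf : ∀ y, f.hom.left y = y)
    (hfg : extendMap (blowUpHom ι) A ≫ f.hom = g.hom ≫ extendMap (blowUpHom ι) A) :
    (ι.left.ker.comap (proj Y A)).comap f.hom.left ≤ ι.left.ker.comap (proj Y A) := by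
  choose U hU hyU hreg using exists_affineOpens_hasRegularPair ι hι
  let alg (y : Y.left) : Algebra F Γ(Y.left, U y) := sectionsAlgebra Y (hU y)
  have hu (y : Y.left) : (hU y).fromSpec ≫ Y.hom =
      Spec.map (CommRingCat.ofHom (algebraMap F Γ(Y.left, U y))) :=
    (specMap_sectionsAlgebra Y (hU y)).symm
  refine le_of_comap_le (fun y ↦ .of (Γ(Y.left, U y) ⊗[F] A))
    (fun y ↦ extendChart (hU y).fromSpec (hu y) A)
    (fun x ↦ ⟨proj Y A x, mem_range_extendChart _ _ _ _ ?_⟩) fun y ↦ ?_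
  · rw [(hU _).range_fromSpec]
    exact hyU _
  obtain ⟨σ, hσ⟩ := exists_specMap_extendChart (hU y).fromSpec (hu y) hf
  have e : extendChart (hU y).fromSpec (hu y) A ≫ f.hom.left ≫ proj Y A =
      Spec.map (CommRingCat.ofHom (σ.comp Algebra.TensorProduct.includeLeftRingHom)) ≫
        (hU y).fromSpec := by
    rw [← Category.assoc, ← hσ, Category.assoc, extendChart_proj, ← Category.assoc,
      ← Spec.map_comp, ← CommRingCat.ofHom_comp]
  rw [← IdealSheafData.comap_comp, ← IdealSheafData.comap_comp, ← IdealSheafData.comap_comp,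
    extendChart_proj, Category.assoc, e]
  refine (ideal_comap_spec ι.left.ker ⟨U y, hU y⟩ _ _).le.trans
    (le_trans ?_ (ideal_comap_spec ι.left.ker ⟨U y, hU y⟩ _ _).ge)
  refine Ideal.map_mono ?_
  change Ideal.map (σ.comp Algebra.TensorProduct.includeLeftRingHom) _ ≤
    Ideal.map Algebra.TensorProduct.includeLeftRingHom _
  rw [Ideal.map_le_iff_le_comap]
  intro x hx
  rw [Ideal.mem_comap]
  obtain ⟨a, ha, b, hb, hanz, -, h⟩ := hreg y
  rcases h with h | ⟨H, δ, hδa, hδb⟩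
  · rw [h, Ideal.map_top]
    trivial
  let S := HomogeneousLocalization.Away (reesGrading (ι.left.ker.ideal ⟨U y, hU y⟩))
    (reesVar _ a ha)
  let : Algebra F S := ((chartMap ha).comp (algebraMap F _)).toAlgebra
  let φ : Γ(Y.left, U y) →ₐ[F] S := { chartMap ha with commutes' := fun _ ↦ rfl }
  let c : Spec (.of S) ⟶ (blowUpOver ι).left :=
    affineBlowUpChart ha ≫ blowUpι ι.left.ker ⟨U y, hU y⟩
  have hc1 : IsOpenImmersion c := isOpenImmersion_chart _ _ _
  have hc2 : c ≫ (blowUpHom ι).left =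
      Spec.map (CommRingCat.ofHom φ.toRingHom) ≫ (hU y).fromSpec :=
    chart_π ι.left.ker ⟨U y, hU y⟩ ha
  have hc3 : c ≫ (blowUpOver ι).hom = Spec.map (CommRingCat.ofHom (algebraMap F S)) := by
    refine (congrArg (c ≫ ·) (Over.w (blowUpHom ι)).symm).trans ?_
    refine (Category.assoc _ _ _).symm.trans ((congrArg (· ≫ Y.hom) hc2).trans ?_)
    refine (Category.assoc _ _ _).trans ((congrArg (_ ≫ ·) (hu y)).trans ?_)
    refine (Spec.map_comp _ _).symm.trans (congrArg Spec.map ?_)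
    exact congrArg CommRingCat.ofHom φ.comp_algebraMap
  exact map_mem_of_extendChart (S := .of S) c hc3 (hU y).fromSpec (hu y) (blowUpHom ι) φ hc2
    (isAffineChart_chartMap ha) hanz H δ hδa hb hδb hg hfg hσ (Ideal.mem_map_of_mem _ hx)

end Stable

end BlowUp
namespace BlowUp

/-! ### The jet groups of the blow-up -/

section Main

open Scheme TensorProduct

lemma comp_aut_inv {C : Type*} [Category C] {X Y : C} {β : X ⟶ Y} {f : Aut Y} {g : Aut X}
    (h : β ≫ f.hom = g.hom ≫ β) : β ≫ (f⁻¹).hom = (g⁻¹).hom ≫ β := by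
  have h1 : g.inv ≫ g.hom = 𝟙 _ := g.inv_hom_id
  have h2 : f.hom ≫ f.inv = 𝟙 _ := f.hom_inv_id
  calc β ≫ f.inv = (g.inv ≫ g.hom) ≫ β ≫ f.inv := by rw [h1, Category.id_comp]
    _ = g.inv ≫ (g.hom ≫ β) ≫ f.inv := by simp only [Category.assoc]
    _ = g.inv ≫ β ≫ f.hom ≫ f.inv := by rw [← h]; simp only [Category.assoc]
    _ = g.inv ≫ β := by rw [h2, Category.comp_id]

variable {F : Type u} [Field F] {Z Y : Over (Spec (.of F))} (ι : Z ⟶ Y) [IsClosedImmersion ι.left]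

lemma exists_extend_hom_of_comap_le {A : CommAlgCat.{u} F} {f : extend Y A ⟶ extend Y A}
    (h : (ι.left.ker.comap (proj Y A)).comap f.left ≤ ι.left.ker.comap (proj Y A)) :
    ∃ k : extend Z A ⟶ extend Z A, k ≫ extendMap ι A = extendMap ι A ≫ f := by
  have h1 : (extendMap ι A).left.ker ≤ ((extendMap ι A).left ≫ f.left).ker := by
    rw [Scheme.Hom.ker_comp, IdealSheafData.le_map_iff_comap_le, ker_extendMap]
    exact h
  have hl := IsClosedImmersion.lift_fac (extendMap ι A).left ((extendMap ι A).left ≫ f.left) h1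
  refine ⟨Over.homMk (IsClosedImmersion.lift _ _ h1) ?_, Over.OverMorphism.ext hl⟩
  rw [← Over.w (extendMap ι A), ← Category.assoc, hl, Category.assoc]
  exact congrArg (_ ≫ ·) (Over.w f)

/-- The two inclusions give restrictions of `f` and `f⁻¹` to `Z_A`. They are mutually inverse
because `Z_A → Y_A` is a monomorphism. -/
lemma mem_stabSubgroup_of_comap_le {A : CommAlgCat.{u} F} {f : Aut (extend Y A)}
    (h : (ι.left.ker.comap (proj Y A)).comap f.hom.left ≤ ι.left.ker.comap (proj Y A))
    (h' : (ι.left.ker.comap (proj Y A)).comap (f⁻¹).hom.left ≤ ι.left.ker.comap (proj Y A)) :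
    f ∈ stabSubgroup ι A := by
  obtain ⟨k, hk⟩ := exists_extend_hom_of_comap_le ι h
  obtain ⟨k', hk'⟩ := exists_extend_hom_of_comap_le ι h'
  have h1 : f.hom ≫ (f⁻¹).hom = 𝟙 _ := f.hom_inv_id
  have h2 : (f⁻¹).hom ≫ f.hom = 𝟙 _ := f.inv_hom_id
  have key (l : extend Z A ⟶ extend Z A) (hl : l ≫ extendMap ι A = extendMap ι A) : l = 𝟙 _ := by
    apply Over.OverMorphism.ext
    rw [← cancel_mono (extendMap ι A).left]
    exact congr(($hl).left).trans (Category.id_comp _).symm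
  refine ⟨⟨k, k', key _ ?_, key _ ?_⟩, hk⟩
  · rw [Category.assoc, hk', ← Category.assoc, hk, Category.assoc, h1, Category.comp_id]
  · rw [Category.assoc, hk, ← Category.assoc, hk', Category.assoc, h2, Category.comp_id]

variable [Smooth Y.hom] [Smooth Z.hom] (hι : ComponentsCodimGE ι 2)

include hι in
lemma mem_stabSubgroup_of_desc {A : CommAlgCat.{u} F} {g : Aut (extend (blowUpOver ι) A)}
    {f : Aut (extend Y A)} (hg : ∀ x, g.hom.left x = x) (hg' : ∀ x, (g⁻¹).hom.left x = x)
    (hf : ∀ y, f.hom.left y = y) (hf' : ∀ y, (f⁻¹).hom.left y = y)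
    (hfg : extendMap (blowUpHom ι) A ≫ f.hom = g.hom ≫ extendMap (blowUpHom ι) A) :
    f ∈ stabSubgroup ι A := by
  have hfg' : extendMap (blowUpHom ι) A ≫ (f⁻¹).hom = (g⁻¹).hom ≫ extendMap (blowUpHom ι) A :=
    comp_aut_inv hfg
  exact mem_stabSubgroup_of_comap_le ι (comap_le_of_desc ι hι hg hf hfg)
    (comap_le_of_desc ι hι hg' hf' hfg')

variable (hY : IsVariety Y) {A : Type u} [CommRing A] [Algebra F A] [IsLocalRing A]
  [Module.Finite F A] (ρ : A →ₐ[F] F)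

-- Surjectivity on jet groups: the descended `f` is again trivial modulo `ρ`, so it also fixes all
-- points and stabilises `Z`; `g` is then its lift by uniqueness.
include hY hι in
lemma exists_liftAut_eq (B : CommAlgCat.{u} F)
    (g : Aut (extend (blowUpOver ι) (.of F (A ⊗[F] B))))
    (hg : autMap (blowUpOver ι) (residueMap ρ B) g = 1) :
    ∃ f : stabSubgroup ι (.of F (A ⊗[F] B)), liftAut ι f = g ∧
      autMap Y (residueMap ρ B) f.1 = 1 := by
  have hN := hι.containsNoComponent ι two_ne_zero
  obtain ⟨f, hf⟩ := exists_desc_aut ι hY hι g (hom_left_apply_eq ρ B hg)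
  have hf1 := autMap_eq_one_of_desc ι hY hN (residueMap ρ B) hf hg
  have hginv : autMap (blowUpOver ι) (residueMap ρ B) g⁻¹ = 1 := by rw [map_inv, hg, inv_one]
  have hfinv : autMap Y (residueMap ρ B) f⁻¹ = 1 := by rw [map_inv, hf1, inv_one]
  exact ⟨⟨f, mem_stabSubgroup_of_desc ι hι (hom_left_apply_eq ρ B hg) (hom_left_apply_eq ρ B hginv)
    (hom_left_apply_eq ρ B hf1) (hom_left_apply_eq ρ B hfinv) hf⟩,
    (liftAut_eq_iff ι _ _).mpr hf.symm, hf1⟩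

include hY hι in
lemma isIso_jetMap_liftHom : IsIso (jetMap ρ (liftHom ι)) := by
  have hN := hι.containsNoComponent ι two_ne_zero
  have (B : CommAlgCat.{u} F) : IsIso ((jetMap ρ (liftHom ι)).app B) := by
    refine (ConcreteCategory.isIso_iff_bijective _).mpr ⟨fun f f' h ↦ ?_, fun g ↦ ?_⟩
    · exact Subtype.ext (liftHom_injective ι hY hN _ congr(($h).1))
    · obtain ⟨f, h1, h2⟩ := exists_liftAut_eq ι hι hY ρ B g.1 g.2
      exact ⟨⟨f, Subtype.ext h2⟩, Subtype.ext h1⟩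
  exact NatIso.isIso_of_isIso_app _

end Main

end BlowUp

end

theorem mainTheorem2 {F : Type u} [Field F] {Z Y : Over (Spec (.of F))}
    (hY : IsVariety Y) [Smooth Y.hom] [Smooth Z.hom] (ι : Z ⟶ Y) [IsClosedImmersion ι.left] :
    ∃ φ : stabFunctor ι ⟶ autFunctor (blowUpOver ι),
      (∀ (A : CommAlgCat.{u} F) (f : stabSubgroup ι A) (g : Aut (extend (blowUpOver ι) A)),
        φ.app A f = g ↔
          g.hom ≫ extendMap (blowUpHom ι) A = extendMap (blowUpHom ι) A ≫ f.1.hom) ∧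
      (ContainsNoComponent ι → ∀ A : CommAlgCat.{u} F, Function.Injective (φ.app A)) ∧
      (ComponentsCodimGE ι 2 →
        ∀ (A : Type u) [CommRing A] [Algebra F A] [IsLocalRing A] [Module.Finite F A]
          (ρ : A →ₐ[F] F), IsIso (jetMap ρ φ)) := by
  exact ⟨liftHom ι, fun A f g ↦ liftAut_eq_iff ι f g, fun h A ↦ liftHom_injective ι hY h A,
    fun h A _ _ _ _ ρ ↦ isIso_jetMap_liftHom ι h hY ρ⟩
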